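/- **Conventions.** Fix a prime $p$ and write $\Gamma=\mathbb Z$ for the value group of $\mathbb Q_p$. "Definable" means first-order definable with parameters in the field $\mathbb Q_p$; a set $M\subset\Gamma^m$ is definable if $\{x\in(\mathbb Q_p^\times)^m : (v(x_1),\dots,v(x_m))\in M\}$ is. The dimension of a definable set $X\subset\mathbb Q_p^n$ is the dimension of its Zariski closure in $\overline{\mathbb Q}_p^{\,n}$ (with $\dim\emptyset=-\infty$). A tree is a rooted tree in which every node has finite depth (distance to the root); the empty tree is allowed. A leaf is a node without children. Isomorphisms are bijections of the nodes preserving and reflecting the is-child-of relation. Attaching a non-empty tree $\mathcal T'$ to a node $v$ means taking the disjoint union and identifying the root of $\mathcal T'$ with $v$. The product of trees is layerwise: nodes are pairs of nodes of equal depth, and $(w,w')$ is a child of $(v,v')$ if $w$ is a child of $v$ and $w'$ is a child of $v'$. **The tree of a set.** For $X\subset\mathbb Q_p^n$, the nodes of $\mathrm T(X)$ of depth $\lambda\ge 0$ are the elements of the image of $X\cap\mathbb Z_p^n$ in $(\mathbb Z/p^\lambda\mathbb Z)^n$; the tree structure is given by the projections $(\mathbb Z/p^{\lambda+1}\mathbb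 Z)^n\to(\mathbb Z/p^{\lambda}\mathbb Z)^n$. **Trees of level $d$.** A parametrized tree is a map $\mathcal T$ from a definable set $M\subset\Gamma^m$ to the class of trees. The parametrized trees of level $d$ are, up to isomorphism for each $\kappa\in M$, those built from the following data, by recursion on $d$. A linear function on $M$ is one of the form $\kappa\mapsto\sum a_i\kappa_i+b$ with $a_i,b\in\mathbb Q$. *Level $0$.* The datum is a finite (possibly empty) tree $S$, whose nodes are called joints and whose edges are called bones, together with, for each bone $e=(u,v)$, a length $\ell_e$ which is either a linear function $M\to\Gamma_{>0}$ or the constant $\infty$, the latter only if $v$ is a leaf of $S$. A joint is virtual if it follows a bone of length $\infty$, and real otherwise. The tree at $\kappa\in M$ is obtained from $S$ by replacing each bone $e=(u,v)$ of finite length by a path of length $\ell_e(\kappa)$ from $u$ to $v$, and each bone of infinite length, together with its virtual joint, by an infinite path starting at $u$. Let $\operatorname{depth}(v)(\kappa)$ be the depth of the joint $v$ in this tree, with value $\infty$ if $v$ is virtual. *Side branches of level $d$ on a set $N$.* The datum is a finite non-empty tree $F$ and, for each leaf $w$ of $F$, a parametrized tree $\mathcal T_w$ of level $d$ on $N$ whose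 values are all non-empty. The side branch at $\kappa\in N$ is $F$ with $\mathrm T(\mathbb Z_p)\times\mathcal T_w(\kappa)$ attached to $w$, for each leaf $w$ of $F$. *Level $d+1$.* The datum consists of an integer $\rho>0$; a level $0$ datum on $M$ (the skeleton) such that for each bone $e$ the length $\ell_e(\kappa)$ modulo $\rho$ does not depend on $\kappa\in M$; for each real joint $v$, a side branch $\mathcal B_v$ of level $d$ on $M$; and for each bone $e=(u,v)$ and each class $c\in\Gamma/\rho\Gamma$, a side branch $\mathcal B_{e,c}$ of level $d$ on $$N_{e,c}=\{(\kappa,\lambda)\in M\times c : \operatorname{depth}(u)(\kappa)<\lambda<\operatorname{depth}(v)(\kappa)\}.$$ The tree at $\kappa$ is the level $0$ tree of the skeleton at $\kappa$, with $\mathcal B_v(\kappa)$ attached to the copy of each real joint $v$, and with $\mathcal B_{e,c}(\kappa,\lambda)$ attached to each other node, where $\lambda$ is the depth of the node, $c$ is the class of $\lambda$, and $e$ is the bone on whose path the node lies. An (unparametrized) tree is of level $d$ if it is a parametrized tree of level $d$ on the one-point set $M=\Gamma^0$. **Theorem.** Let $d\ge 0$ and let $\mathcal T$ be an unparametrized tree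 of level $d$ without leaves. Then there exist $n\in\mathbb N$ and a definable set $X\subset\mathbb Q_p^n$ with $\dim X\le d$ such that $\mathrm T(X)\cong\mathcal T$. -/

import Mathlib

namespace PadicTrees

/-- A (possibly empty) rooted tree: every node has a finite depth, at most one node (the root) has
depth `0`, and every other node has exactly one parent, whose depth is one less. -/
structure RTree where
  Node : Type
  /-- `Child v w` means that `w` is a child of `v`, i.e. `(v, w)` is an edge. -/
  Child : Node → Node → Prop
  depth : Node → ℕ
  depth_child : ∀ {a b}, Child a b → depth b = depth a + 1
  exists_parent : ∀ {b}, 0 < depth b → ∃ a, Child a b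
  parent_unique : ∀ {a b c}, Child a c → Child b c → a = b
  root_unique : ∀ {a b}, depth a = 0 → depth b = 0 → a = b

namespace RTree

/-- Isomorphisms of trees: bijections of the nodes that preserve and reflect the is-child-of
relation. -/
abbrev Iso (T T' : RTree) : Type := RelIso T.Child T'.Child

/-- A leaf is a node without children. -/
def IsLeaf (T : RTree) (v : T.Node) : Prop := ∀ w, ¬ T.Child v w

/-- The tree with exactly one node. -/
def point : RTree where
  Node := Unit
  Child _ _ := False
  depth _ := 0
  depth_child h := h.elim
  exists_parent h := absurd h (lt_irrefl 0)
  parent_unique h := h.elim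
  root_unique _ _ := rfl

/-- The layerwise product of two trees. -/
def prod (T T' : RTree) : RTree where
  Node := {x : T.Node × T'.Node // T.depth x.1 = T'.depth x.2}
  Child x y := T.Child x.1.1 y.1.1 ∧ T'.Child x.1.2 y.1.2
  depth x := T.depth x.1.1
  depth_child h := T.depth_child h.1
  exists_parent := by
    rintro ⟨⟨b, b'⟩, hb⟩ h
    obtain ⟨a, ha⟩ := T.exists_parent h
    have h3 : T.depth b = T'.depth b' := hb
    obtain ⟨a', ha'⟩ := T'.exists_parent (b := b') (h3 ▸ h)
    have h1 : T.depth b = T.depth a + 1 := T.depth_child ha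
    have h2 := T'.depth_child ha'
    have h4 : T.depth a = T'.depth a' := by omega
    exact ⟨⟨(a, a'), h4⟩, ha, ha'⟩
  parent_unique h h' :=
    Subtype.ext (Prod.ext (T.parent_unique h.1 h'.1) (T'.parent_unique h.2 h'.2))
  root_unique {a b} h h' :=
    Subtype.ext (Prod.ext (T.root_unique h h')
      (T'.root_unique (a.2.symm.trans h) (b.2.symm.trans h')))

/-- The nodes obtained by attaching to every node `v` of `T` the tree `B v`: the disjoint union of
the nodes of `T` and of the `B v`, where the root of `B v` is identified with `v`. -/
abbrev AttachNode (T : RTree) (B : T.Node → RTree) : Type :=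
  T.Node ⊕ (Σ v : T.Node, {b : (B v).Node // 0 < (B v).depth b})

/-- The is-child-of relation after attaching the trees `B v`. -/
inductive AttachChild (T : RTree) (B : T.Node → RTree) :
    T.AttachNode B → T.AttachNode B → Prop
  | base {v w : T.Node} (h : T.Child v w) : AttachChild T B (Sum.inl v) (Sum.inl w)
  | first {v : T.Node} (b : {b : (B v).Node // 0 < (B v).depth b}) (h : (B v).depth b.1 = 1) :
      AttachChild T B (Sum.inl v) (Sum.inr ⟨v, b⟩)
  | inner {v : T.Node} (b b' : {b : (B v).Node // 0 < (B v).depth b})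
      (h : (B v).Child b.1 b'.1) :
      AttachChild T B (Sum.inr ⟨v, b⟩) (Sum.inr ⟨v, b'⟩)

/-- The tree obtained from `T` by attaching `B v` to `v`, for all nodes `v` of `T`. -/
def attach (T : RTree) (B : T.Node → RTree) : RTree where
  Node := T.AttachNode B
  Child := AttachChild T B
  depth := Sum.elim T.depth fun x => T.depth x.1 + (B x.1).depth x.2.1
  depth_child := by
    rintro _ _ (h | ⟨b, h⟩ | ⟨b, b', h⟩)
    · exact T.depth_child h
    · simp [h]
    · have := (B _).depth_child h
      simp only [Sum.elim_inr]
      omega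
  exists_parent := by
    rintro (b | ⟨v, b, hb⟩) h
    · obtain ⟨a, ha⟩ := T.exists_parent h
      exact ⟨_, .base ha⟩
    · obtain ⟨a, ha⟩ := (B v).exists_parent hb
      have := (B v).depth_child ha
      rcases Nat.eq_zero_or_pos ((B v).depth a) with h0 | h0
      · exact ⟨_, .first ⟨b, hb⟩ (by simp only; omega)⟩
      · exact ⟨_, .inner ⟨a, h0⟩ ⟨b, hb⟩ ha⟩
  parent_unique := by
    rintro _ _ _ (h | ⟨b, h⟩ | ⟨b, b', h⟩) h'
    · cases h' with
      | base h' => rw [T.parent_unique h h']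
    · cases h' with
      | first _ h' => rfl
      | inner c _ h' =>
        have := (B _).depth_child h'
        have := c.2
        omega
    · cases h' with
      | first _ h' =>
        have := (B _).depth_child h
        have := b.2
        omega
      | inner c _ h' =>
        have := Subtype.ext ((B _).parent_unique h h')
        rw [this]
  root_unique := by
    rintro (a | ⟨a, x⟩) (b | ⟨b, y⟩) h h'
    · rw [T.root_unique h h']
    · have := y.2
      simp only [Sum.elim_inr] at h'
      omega
    · have := x.2
      simp only [Sum.elim_inr] at h
      omega
    · have := x.2
      simp only [Sum.elim_inr] at h
      omega

end RTree

/-! ### Trees, definability and dimension of subsets of `ℚ_p ^ n` -/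

/-- The set `X_k`: the image of `X ∩ ℤ_p ^ n` in `(ℤ / p ^ k) ^ n`. -/
def residueSet (p : ℕ) [Fact p.Prime] {n : ℕ} (X : Set (Fin n → ℚ_[p])) (k : ℕ) :
    Set (Fin n → ZMod (p ^ k)) :=
  {a | ∃ x : Fin n → ℤ_[p], (fun i => (x i : ℚ_[p])) ∈ X ∧ ∀ i, PadicInt.toZModPow k (x i) = a i}

/-- The is-child-of relation on the disjoint union of the `X_k`, given by the projections
`(ℤ / p ^ (k + 1)) ^ n → (ℤ / p ^ k) ^ n`. -/
inductive ResidueChild (p : ℕ) [Fact p.Prime] {n : ℕ} (X : Set (Fin n → ℚ_[p])) :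
    (Σ k : ℕ, residueSet p X k) → (Σ k : ℕ, residueSet p X k) → Prop
  | mk {k : ℕ} (a : residueSet p X k) (b : residueSet p X (k + 1))
      (h : ∀ i, ZMod.castHom (pow_dvd_pow p (Nat.le_succ k)) (ZMod (p ^ k)) (b.1 i) = a.1 i) :
      ResidueChild p X ⟨k, a⟩ ⟨k + 1, b⟩

/-- The tree `T(X)` of a set `X ⊆ ℚ_p ^ n`. -/
def treeOf (p : ℕ) [Fact p.Prime] {n : ℕ} (X : Set (Fin n → ℚ_[p])) : RTree where
  Node := Σ k : ℕ, residueSet p X k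
  Child := ResidueChild p X
  depth x := x.1
  depth_child := by
    rintro _ _ ⟨a, b, h⟩
    rfl
  exists_parent := by
    rintro ⟨_ | k, b, x, hx, hb⟩ h
    · exact absurd h (lt_irrefl 0)
    · refine ⟨_, .mk ⟨fun i => PadicInt.toZModPow k (x i), x, hx, fun i => rfl⟩ _ fun i => ?_⟩
      simp only
      rw [← hb i, ← RingHom.comp_apply,
        PadicInt.zmod_cast_comp_toZModPow k (k + 1) (Nat.le_succ k)]
  parent_unique := by
    rintro _ _ _ ⟨a, b, h⟩ ⟨a', _, h'⟩
    have : a = a' := Subtype.ext (funext fun i => (h i).symm.trans (h' i))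
    rw [this]
  root_unique := by
    rintro ⟨k, a, ha⟩ ⟨l, b, hb⟩ h h'
    dsimp only at h h'
    subst h h'
    have : a = b := funext fun i => by
      have : Subsingleton (ZMod (p ^ 0)) := by rw [pow_zero]; infer_instance
      exact Subsingleton.elim _ _
    subst this
    rfl

/-- The tree `T(ℤ_p)`. -/
noncomputable def treeZp (p : ℕ) [Fact p.Prime] : RTree :=
  treeOf p (Set.univ : Set (Fin 1 → ℚ_[p]))

/-- A subset of `ℚ_p ^ n` is definable if it is first-order definable in the field `ℚ_p`, with
parameters. -/
def IsDefinable (p : ℕ) [Fact p.Prime] {n : ℕ} (X : Set (Fin n → ℚ_[p])) : Prop :=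
  letI := FirstOrder.Ring.compatibleRingOfRing ℚ_[p]
  Set.Definable Set.univ FirstOrder.Language.ring X

/-- A subset of `Γ ^ m = ℤ ^ m` is definable if it is definable in `ℚ_p`, where the value group
`Γ = ℚ_pˣ / ℤ_pˣ` is regarded as a sort interpreted in the field `ℚ_p`. -/
def IsDefinableGamma (p : ℕ) [Fact p.Prime] {m : ℕ} (M : Set (Fin m → ℤ)) : Prop :=
  IsDefinable p {x : Fin m → ℚ_[p] | (∀ i, x i ≠ 0) ∧ (fun i => (x i).valuation) ∈ M}

/-- The dimension of a subset `X` of `ℚ_p ^ n`: the Krull dimension of the coordinate ring of the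
Zariski closure of `X` in `K ^ n`, where `K` is the algebraic closure of `ℚ_p`. It is `⊥` if `X` is
empty. -/
noncomputable def dim (p : ℕ) [Fact p.Prime] {n : ℕ} (X : Set (Fin n → ℚ_[p])) : WithBot ℕ∞ :=
  ringKrullDim (MvPolynomial (Fin n) (AlgebraicClosure ℚ_[p]) ⧸
    MvPolynomial.vanishingIdeal (AlgebraicClosure ℚ_[p])
      ((fun (x : Fin n → ℚ_[p]) i => algebraMap ℚ_[p] (AlgebraicClosure ℚ_[p]) (x i)) '' X))

/-! ### Trees of level `d` -/

/-- Trees parametrized by subsets `M` of `Γ ^ m`. Only the values on the set `M` under consideration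
matter; values elsewhere are junk. -/
abbrev PTree (m : ℕ) : Type 1 := (Fin m → ℤ) → RTree

/-- A function on `M ⊆ Γ ^ m` is linear if it is given by a polynomial of degree at most one with
rational coefficients. -/
def IsLinearOn {m : ℕ} (M : Set (Fin m → ℤ)) (f : (Fin m → ℤ) → ℕ+) : Prop :=
  ∃ (a : Fin m → ℚ) (b : ℚ), ∀ κ ∈ M, ((f κ : ℕ) : ℚ) = ∑ i, a i * (κ i : ℚ) + b

/-- A datum for a level `0` tree on `M`: a finite tree with lengths of its edges. The nodes of
`shape` are called joints, its edges are called bones. A bone is given by its lower endpoint, i.e.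
by a joint of positive depth. `Virtual` singles out those joints which follow a bone of constant
infinite length; the length of any other bone with lower endpoint `v` is the linear function
`len v`. (`len v` is junk if `v` is virtual or the root.) -/
structure Skeleton {m : ℕ} (M : Set (Fin m → ℤ)) where
  shape : RTree
  finite : Finite shape.Node
  Virtual : shape.Node → Prop
  virtual_pos : ∀ v, Virtual v → 0 < shape.depth v
  virtual_leaf : ∀ v, Virtual v → shape.IsLeaf v
  len : shape.Node → (Fin m → ℤ) → ℕ+
  linear : ∀ v, 0 < shape.depth v → ¬ Virtual v → IsLinearOn M (len v)

namespace Skeleton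

variable {m : ℕ} {M : Set (Fin m → ℤ)} (S : Skeleton M)

/-- The sum of the lengths of the bones on the path from the root to the joint `v`. -/
noncomputable def pathLength (v : S.shape.Node) (κ : Fin m → ℤ) : ℕ :=
  ∑ᶠ w ∈ {w | 0 < S.shape.depth w ∧ Relation.ReflTransGen S.shape.Child w v}, (S.len w κ : ℕ)

open Classical in
/-- The depth of a joint in the tree described by the datum; it is infinite at virtual joints. -/
noncomputable def jointDepth (v : S.shape.Node) (κ : Fin m → ℤ) : ℕ∞ :=
  if S.Virtual v then ⊤ else (S.pathLength v κ : ℕ∞)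

theorem pathLength_child {u v : S.shape.Node} (h : S.shape.Child u v) (κ : Fin m → ℤ) :
    S.pathLength v κ = S.pathLength u κ + S.len v κ := by
  have := S.finite
  have hd := S.shape.depth_child h
  have key : ∀ {a b : S.shape.Node}, Relation.ReflTransGen S.shape.Child a b →
      S.shape.depth a ≤ S.shape.depth b := by
    intro a b hab
    induction hab with
    | refl => exact le_rfl
    | tail _ hc ih => have := S.shape.depth_child hc; omega
  have hset : {w | 0 < S.shape.depth w ∧ Relation.ReflTransGen S.shape.Child w v} =
      insert v {w | 0 < S.shape.depth w ∧ Relation.ReflTransGen S.shape.Child w u} := by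
    ext w
    simp only [Set.mem_ofPred_eq, Set.mem_insert_iff]
    constructor
    · rintro ⟨h0, hw⟩
      rcases Relation.ReflTransGen.cases_tail hw with hw | ⟨c, hc, hcv⟩
      · exact Or.inl hw.symm
      · rw [S.shape.parent_unique hcv h] at hc
        exact Or.inr ⟨h0, hc⟩
    · rintro (rfl | ⟨h0, hw⟩)
      · exact ⟨by omega, .refl⟩
      · exact ⟨h0, hw.tail h⟩
  unfold pathLength
  rw [hset, finsum_mem_insert _ _ (Set.toFinite _), add_comm]
  rintro ⟨-, hv⟩
  have := key hv
  omega

theorem pathLength_root {v : S.shape.Node} (h : S.shape.depth v = 0) (κ : Fin m → ℤ) :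
    S.pathLength v κ = 0 := by
  have hset : {w | 0 < S.shape.depth w ∧ Relation.ReflTransGen S.shape.Child w v} = ∅ := by
    ext w
    simp only [Set.mem_ofPred_eq, Set.mem_empty_iff_false, iff_false, not_and]
    intro h0 hw
    rcases Relation.ReflTransGen.cases_tail hw with hw | ⟨c, hc, hcv⟩
    · rw [hw] at h; omega
    · have := S.shape.depth_child hcv; omega
  rw [pathLength, hset, finsum_mem_empty]

theorem jointDepth_parent {u v : S.shape.Node} (h : S.shape.Child u v) (κ : Fin m → ℤ) :
    S.jointDepth u κ = S.pathLength u κ :=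
  if_neg fun hu => S.virtual_leaf u hu v h

theorem jointDepth_lt {u v : S.shape.Node} (h : S.shape.Child u v) (κ : Fin m → ℤ) :
    S.jointDepth u κ < S.jointDepth v κ := by
  rw [S.jointDepth_parent h, jointDepth]
  split_ifs
  · exact ENat.natCast_lt_top _
  · rw [S.pathLength_child h]
    exact_mod_cast Nat.lt_add_of_pos_right (S.len v κ).pos

/-- The pairs `(v, k)` which are nodes of the tree described by the datum: the root, and, for every
bone `(u, v)` and every `k` with `depth u < k ≤ depth v`, the node of depth `k` on the path that
replaces this bone. If `v` is real, the node with `k = depth v` is the copy of `v`. -/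
def IsNode (κ : Fin m → ℤ) (x : S.shape.Node × ℕ) : Prop :=
  (S.shape.depth x.1 = 0 ∧ x.2 = 0) ∨
    ∃ u, S.shape.Child u x.1 ∧ S.jointDepth u κ < (x.2 : ℕ∞) ∧ (x.2 : ℕ∞) ≤ S.jointDepth x.1 κ

theorem isNode_joint {v : S.shape.Node} {k : ℕ} {κ : Fin m → ℤ}
    (h : S.jointDepth v κ = (k : ℕ∞)) : S.IsNode κ (v, k) := by
  rcases Nat.eq_zero_or_pos (S.shape.depth v) with h0 | h0
  · refine Or.inl ⟨h0, ?_⟩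
    have hv : ¬ S.Virtual v := fun hv => by have := S.virtual_pos v hv; omega
    rw [jointDepth, if_neg hv, S.pathLength_root h0] at h
    exact_mod_cast h.symm
  · obtain ⟨u, hu⟩ := S.shape.exists_parent h0
    exact Or.inr ⟨u, hu, h ▸ S.jointDepth_lt hu κ, h.ge⟩

/-- The tree described by the datum at the parameter `κ`. A node is a child of the preceding node on
the same bone or, at the beginning of a bone `(u, v)`, of the copy of the joint `u`. -/
def tree (κ : Fin m → ℤ) : RTree where
  Node := {x : S.shape.Node × ℕ // S.IsNode κ x}
  Child x y := y.1.2 = x.1.2 + 1 ∧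
    (x.1.1 = y.1.1 ∨ (S.shape.Child x.1.1 y.1.1 ∧ S.jointDepth x.1.1 κ = (x.1.2 : ℕ∞)))
  depth x := x.1.2
  depth_child h := h.1
  exists_parent := by
    rintro ⟨⟨v, k⟩, hv⟩ (hk : 0 < k)
    obtain ⟨k, rfl⟩ := Nat.exists_eq_succ_of_ne_zero hk.ne'
    rcases hv with ⟨-, h⟩ | ⟨u, hu, h1, h2⟩
    · exact absurd h (Nat.succ_ne_zero k)
    · dsimp only at hu h1 h2
      rw [S.jointDepth_parent hu, Nat.cast_lt, Nat.lt_succ_iff_lt_or_eq] at h1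
      rcases h1 with h1 | h1
      · refine ⟨⟨(v, k), Or.inr ⟨u, hu, ?_, le_trans ?_ h2⟩⟩, rfl, Or.inl rfl⟩
        · rw [S.jointDepth_parent hu]
          exact_mod_cast h1
        · exact_mod_cast Nat.le_succ k
      · have hd : S.jointDepth u κ = (k : ℕ∞) := by rw [S.jointDepth_parent hu, h1]
        exact ⟨⟨(u, k), S.isNode_joint hd⟩, rfl, Or.inr ⟨hu, hd⟩⟩
  parent_unique := by
    have aux : ∀ {x y : S.shape.Node × ℕ} {v : S.shape.Node}, x.2 = y.2 → S.IsNode κ x →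
        x.1 = v → S.shape.Child y.1 v → S.jointDepth y.1 κ = (y.2 : ℕ∞) → False := by
      rintro ⟨x, k⟩ ⟨y, l⟩ v (rfl : k = l) hx (rfl : x = v) hc hd
      rcases hx with ⟨h, -⟩ | ⟨u, hu, h1, h2⟩
      · have := S.shape.depth_child hc
        dsimp only at h this
        omega
      · rw [S.shape.parent_unique hu hc] at h1
        exact absurd hd h1.ne
    rintro ⟨x, hx⟩ ⟨y, hy⟩ ⟨z, hz⟩ ⟨h1, h2⟩ ⟨h3, h4⟩
    dsimp only at h1 h2 h3 h4
    have hk : x.2 = y.2 := by omega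
    refine Subtype.ext (Prod.ext ?_ hk)
    rcases h2 with h2 | ⟨h2, h2'⟩ <;> rcases h4 with h4 | ⟨h4, h4'⟩
    · exact h2.trans h4.symm
    · exact (aux hk hx h2 h4 h4').elim
    · exact (aux hk.symm hy h4 h2 h2').elim
    · exact S.shape.parent_unique h2 h4
  root_unique := by
    rintro ⟨⟨v, k⟩, hv⟩ ⟨⟨w, l⟩, hw⟩ (rfl : k = 0) (rfl : l = 0)
    rcases hv with ⟨hv, -⟩ | ⟨u, -, h, -⟩
    · rcases hw with ⟨hw, -⟩ | ⟨u, -, h, -⟩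
      · exact Subtype.ext (Prod.ext (S.shape.root_unique hv hw) rfl)
      · exact absurd h (by simp)
    · exact absurd h (by simp)

/-- For a bone `(u, v)` and a congruence class `c` modulo `ρ`, the set of all `(κ, l) ∈ M × c` with
`depth u < l < depth v` at the parameter `κ`. -/
def boneSet (u v : S.shape.Node) {ρ : ℕ} (c : ZMod ρ) : Set (Fin (m + 1) → ℤ) :=
  {x | ∃ κ ∈ M, ∃ l : ℕ, x = (Fin.snoc κ (l : ℤ) : Fin (m + 1) → ℤ) ∧ (l : ZMod ρ) = c ∧
    S.jointDepth u κ < (l : ℕ∞) ∧ (l : ℕ∞) < S.jointDepth v κ}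

open Classical in
/-- The skeleton at the parameter `κ`, with side branches attached to all its nodes: the side branch
`J v` at the copy of a real joint `v`, and the side branch `E v c`, with parameter `(κ, l)`, at a
node of depth `l ∈ c` strictly inside the bone with lower endpoint `v`. -/
noncomputable def fill {ρ : ℕ} (J : S.shape.Node → PTree m)
    (E : S.shape.Node → ZMod ρ → PTree (m + 1)) (κ : Fin m → ℤ) : RTree :=
  (S.tree κ).attach fun x =>
    if S.jointDepth x.1.1 κ = (x.1.2 : ℕ∞) then J x.1.1 κ
    else E x.1.1 (x.1.2 : ZMod ρ) (Fin.snoc κ (x.1.2 : ℤ) : Fin (m + 1) → ℤ)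

end Skeleton

open Classical in
/-- The tree `F` with `T(ℤ_p) × B w` attached to `w`, for each leaf `w` of `F`. -/
noncomputable def sideBranch (p : ℕ) [Fact p.Prime] (F : RTree) (B : F.Node → RTree) : RTree :=
  F.attach fun w => if F.IsLeaf w then (treeZp p).prod (B w) else RTree.point

/-- `B` is a side branch on `N`, built from a non-empty finite tree and, for each leaf of it, a
side tree which satisfies `P` (to be of level `d` on `N`) and has non-empty values. -/
def IsSideBranch (p : ℕ) [Fact p.Prime] {m : ℕ} (P : PTree m → Prop) (N : Set (Fin m → ℤ))
    (B : PTree m) : Prop :=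
  ∃ (F : RTree) (side : F.Node → PTree m), Finite F.Node ∧ Nonempty F.Node ∧
    (∀ w, F.IsLeaf w → P (side w) ∧ ∀ κ ∈ N, Nonempty (side w κ).Node) ∧
    ∀ κ ∈ N, Nonempty (RTree.Iso (B κ) (sideBranch p F fun w => side w κ))

/-- `IsLevel p d m M T`: the parametrized tree `T`, defined on the definable set `M ⊆ Γ ^ m`, is of
level `d`. -/
def IsLevel (p : ℕ) [Fact p.Prime] : ℕ → (m : ℕ) → Set (Fin m → ℤ) → PTree m → Prop
  | 0, _, M, T => IsDefinableGamma p M ∧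
      ∃ S : Skeleton M, ∀ κ ∈ M, Nonempty (RTree.Iso (T κ) (S.tree κ))
  | d + 1, m, M, T => IsDefinableGamma p M ∧
      ∃ (ρ : ℕ) (S : Skeleton M) (J : S.shape.Node → PTree m)
        (E : S.shape.Node → ZMod ρ → PTree (m + 1)),
        0 < ρ ∧
        (∀ v, 0 < S.shape.depth v → ¬ S.Virtual v → ∀ κ ∈ M, ∀ κ' ∈ M,
          (S.len v κ : ℕ) ≡ S.len v κ' [MOD ρ]) ∧
        (∀ v, ¬ S.Virtual v → IsSideBranch p (IsLevel p d m M) M (J v)) ∧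
        (∀ u v, S.shape.Child u v → ∀ c : ZMod ρ,
          IsSideBranch p (IsLevel p d (m + 1) (S.boneSet u v c)) (S.boneSet u v c) (E v c)) ∧
        ∀ κ ∈ M, Nonempty (RTree.Iso (T κ) (S.fill J E κ))

/-- An unparametrized tree is of level `d` if it is a parametrized tree of level `d` on the
one-point set `Γ ^ 0`. -/
def IsLevelTree (p : ℕ) [Fact p.Prime] (d : ℕ) (T : RTree) : Prop :=
  IsLevel p d 0 Set.univ fun _ => T

end PadicTrees

/-! The proof is an induction on d of a statement with parameters, `HasFamilies`. A parameter κ is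
represented by points w of a torus: for a fixed class c modulo r!, by those w with κ = c + r!·v(w)
(`fiber`). Once r! clears the denominators, linear functions of κ are valuations of Laurent
monomials in w. The claim is that for all large r and all c there are finitely many definable pieces
of an (m + d)-dimensional torus, with piecewise monomial maps to an affine space, that present T(κ)
for every κ in M: over each w the images reach all non-leaf nodes, and two points over w and w' are
congruent modulo p^k if and only if they run through the same node of depth k, provided that w and
w' agree up to a relative error p^(r-k) (`Near`). Allowing w and w' to differ makes the induction
work: the depth on a bone is a parameter of the side tree, but in the assembled set it is carried by
an ordinary coordinate, which is only seen modulo powers of p. One r serves all levels, hence the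
formulation "for all large r".

The skeleton (`Assembly.presents`). There are functions of w whose valuations are the depths of the
joints. A point that belongs to the joint v has, at each non-root ancestor b of v, the function of
the parent of b as coordinate; modulo p^k these coordinates show exactly which bone carries depth k
(`eq_iff_position_congr`). One more coordinate, the scale, has as valuation the depth l at which the
point leaves the skeleton. All coordinates of the side branch are multiplied by it, so they become
visible only after depth l. Scale 0 belongs to the infinite paths at virtual joints.

Side branches (`LocalFamily.Fits.isPresented`). The factor T(ℤ_p) costs one dimension. At a joint
the scale is a function of w, and a new coordinate runs through ℤ_p. On a bone, a single new
coordinate y has to yield both the depth l and the element of ℤ_p. Put N = r!, y = p^q η with η in 1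
+ p^r ℤ_p, and let the scale be p^c' y^N. Then q gives l = c' + Nq, while η^N, together with a digit
from a finite set, describes elements of ℤ_p to any precision (`exists_digit_approx`,
`pdvd_digit_sub_iff`). The N-th power map shrinks distances on 1 + p^r ℤ_p exactly by |N|
(`norm_pow_sub_pow`) and v(N) < r, so y is determined up to a relative error p^(r-k), which is what
`Near` demands of the new parameter.

A side tree of a leafless tree may be a single node, since other branches can continue at its root.
Therefore the induction assumes `LeavesAtRoot`; a single node is presented by a family without
points.

For m = 0 let X be the image of the family. The trees T(X) and T are presented by the same data,
hence isomorphic (`IsPresented.nonempty_iso`). X is definable because the valuation ring and the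
condition on leading terms are (`norm_le_one_iff_exists_pow`, `mem_leadingOne_iff`), and dim X ≤ d
because X is covered by the images of a d-dimensional torus under finitely many monomial maps
(`dim_le_of_monomial`). -/

namespace PadicTrees

/-! ### Ancestors and leaves in rooted trees -/

namespace RTree

variable {T T' : RTree}

theorem Iso.depth_eq (f : Iso T T') (x : T.Node) : T'.depth (f x) = T.depth x := by
  induction hn : T.depth x generalizing x with
  | zero =>
    by_contra h
    obtain ⟨y, hy⟩ := T'.exists_parent (Nat.pos_of_ne_zero h)
    obtain ⟨z, rfl⟩ := f.surjective y
    have := T.depth_child (f.map_rel_iff.1 hy)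
    omega
  | succ n ih =>
    obtain ⟨y, hy⟩ := T.exists_parent (b := x) (by omega)
    have h1 := T.depth_child hy
    rw [T'.depth_child (f.map_rel_iff.2 hy), ih y (by omega)]

theorem Iso.isLeaf_iff (f : Iso T T') (x : T.Node) : T'.IsLeaf (f x) ↔ T.IsLeaf x := by
  constructor
  · intro h w hw
    exact h _ (f.map_rel_iff.2 hw)
  · intro h w hw
    obtain ⟨z, rfl⟩ := f.surjective w
    exact h _ (f.map_rel_iff.1 hw)

/-- No node of positive depth is a leaf. -/
def LeavesAtRoot (T : RTree) : Prop := ∀ v, T.IsLeaf v → T.depth v = 0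

theorem LeavesAtRoot.of_iso (f : Iso T T') (h : T.LeavesAtRoot) : T'.LeavesAtRoot := by
  intro v hv
  obtain ⟨x, rfl⟩ := f.surjective v
  rw [f.depth_eq]
  exact h x ((f.isLeaf_iff x).1 hv)

/-- The parent of a node; the root is its own parent. -/
noncomputable def parent (T : RTree) (x : T.Node) : T.Node :=
  open Classical in if h : 0 < T.depth x then (T.exists_parent h).choose else x

theorem child_parent {x : T.Node} (h : 0 < T.depth x) : T.Child (T.parent x) x := by
  rw [parent, dif_pos h]
  exact (T.exists_parent h).choose_spec

theorem parent_eq {x y : T.Node} (h : T.Child x y) : T.parent y = x :=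
  T.parent_unique (child_parent (by rw [T.depth_child h]; omega)) h

/-- The ancestor of depth `k` of a node of depth at least `k`. -/
noncomputable def anc (T : RTree) (x : T.Node) (k : ℕ) : T.Node := T.parent^[T.depth x - k] x

@[simp] theorem anc_self (x : T.Node) : T.anc x (T.depth x) = x := by simp [anc]

theorem anc_eq_parent (x : T.Node) {k : ℕ} (h : k + 1 ≤ T.depth x) :
    T.anc x k = T.parent (T.anc x (k + 1)) := by
  rw [anc, anc, ← Function.iterate_succ_apply' (f := T.parent)]
  congr 2
  omega

theorem depth_anc (x : T.Node) {k : ℕ} (h : k ≤ T.depth x) : T.depth (T.anc x k) = k := by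
  refine Nat.decreasingInduction' (P := fun k => T.depth (T.anc x k) = k)
    (fun j hj _ ih => ?_) h (by simp)
  have := T.depth_child (child_parent (x := T.anc x (j + 1)) (by omega))
  rw [anc_eq_parent x hj]
  omega

theorem child_anc (x : T.Node) {k : ℕ} (h : k + 1 ≤ T.depth x) :
    T.Child (T.anc x k) (T.anc x (k + 1)) := by
  rw [anc_eq_parent x h]
  exact child_parent (by rw [depth_anc x h]; omega)

theorem anc_child {x y : T.Node} (h : T.Child x y) {k : ℕ} (hk : k ≤ T.depth x) :
    T.anc y k = T.anc x k := by
  have := T.depth_child h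
  refine Nat.decreasingInduction' (P := fun k => T.anc y k = T.anc x k)
    (fun j hj _ ih => ?_) hk ?_
  · rw [anc_eq_parent y (by omega), ih, ← anc_eq_parent x hj]
  · rw [anc_self, anc_eq_parent y (by omega), ← this, anc_self, parent_eq h]

theorem anc_anc (x : T.Node) {j k : ℕ} (hjk : j ≤ k) (hk : k ≤ T.depth x) :
    T.anc (T.anc x k) j = T.anc x j := by
  refine Nat.decreasingInduction' (P := fun j => T.anc (T.anc x k) j = T.anc x j)
    (fun j hj _ ih => ?_) hjk ?_
  · rw [anc_eq_parent _ (by rw [depth_anc x hk]; exact hj), ih, ← anc_eq_parent x (by omega)]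
  · have := anc_self (T.anc x k)
    rwa [depth_anc x hk] at this

/-- `T.IsAnc a v` means that `a` lies on the path from the root to `v`. -/
def IsAnc (T : RTree) (a v : T.Node) : Prop := T.depth a ≤ T.depth v ∧ T.anc v (T.depth a) = a

theorem isAnc_refl (v : T.Node) : T.IsAnc v v := ⟨le_rfl, anc_self v⟩

theorem isAnc_anc (x : T.Node) {k : ℕ} (hk : k ≤ T.depth x) : T.IsAnc (T.anc x k) x := by
  rw [IsAnc, depth_anc x hk]
  exact ⟨hk, rfl⟩

theorem IsAnc.eq_of_depth_eq {a b v : T.Node} (h : T.IsAnc a v) (h' : T.IsAnc b v)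
    (hd : T.depth a = T.depth b) : a = b := by
  rw [← h.2, ← h'.2, hd]

theorem IsAnc.trans {a b c : T.Node} (h : T.IsAnc a b) (h' : T.IsAnc b c) : T.IsAnc a c := by
  refine ⟨h.1.trans h'.1, ?_⟩
  have := anc_anc c h.1 h'.1
  rw [h'.2, h.2] at this
  exact this.symm

theorem IsAnc.of_le {a b v : T.Node} (h : T.IsAnc a v) (h' : T.IsAnc b v)
    (hd : T.depth a ≤ T.depth b) : T.IsAnc a b := by
  refine ⟨hd, ?_⟩
  rw [← h'.2, anc_anc v hd h'.1, h.2]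

theorem isAnc_child {u v : T.Node} (h : T.Child u v) : T.IsAnc u v := by
  have h1 := T.depth_child h
  exact ⟨by omega, by rw [anc_eq_parent v (by omega), ← h1, anc_self, parent_eq h]⟩

theorem IsAnc.eq_or_of_child {a u v : T.Node} (h : T.IsAnc a v) (hc : T.Child u v) :
    a = v ∨ T.IsAnc a u := by
  have h1 := T.depth_child hc
  rcases Nat.lt_or_ge (T.depth a) (T.depth v) with h2 | h2
  · exact Or.inr (h.of_le (isAnc_child hc) (by omega))
  · exact Or.inl (h.eq_of_depth_eq (isAnc_refl v) (le_antisymm h.1 h2))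

theorem isAnc_root {a v : T.Node} (ha : T.depth a = 0) : T.IsAnc a v := by
  refine ⟨by omega, T.root_unique ?_ ha⟩
  rw [ha, depth_anc v (Nat.zero_le _)]

theorem IsAnc.eq_of_isLeaf {a v : T.Node} (h : T.IsAnc a v) (ha : T.IsLeaf a) : a = v := by
  by_contra hne
  have hlt : T.depth a < T.depth v :=
    lt_of_le_of_ne h.1 fun h' => hne (h.eq_of_depth_eq (isAnc_refl v) h')
  have := child_anc v (k := T.depth a) hlt
  rw [h.2] at this
  exact ha _ this

/-- In a finite tree, every node lies above a leaf. -/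
theorem exists_isLeaf (T : RTree) [Finite T.Node] (x : T.Node) :
    ∃ y, T.IsLeaf y ∧ T.IsAnc x y := by
  obtain ⟨y, hy, hmax⟩ := Set.Finite.exists_maximalFor T.depth {y | T.IsAnc x y}
    (Set.toFinite _) ⟨x, isAnc_refl x⟩
  refine ⟨y, fun z hz => ?_, hy⟩
  have h1 := T.depth_child hz
  have := hmax (j := z) (IsAnc.trans hy (isAnc_child hz)) (by omega)
  omega

/-! ### Presentations of trees -/

/-- `IsPresented T w W C R` means that the non-leaf nodes of `T` are described by the elements `a`
of `A`: each of them has an infinite path in `T`, and `R k a b` expresses that the paths of `a` and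
`b` agree at depth `k`, provided that `a` and `b` are comparable at depth `k` in the sense of `C`.
Every non-leaf node lies on the path of an element over any given `b ∈ W`. -/
def IsPresented (T : RTree) {A β : Type} (w : A → β) (W : Set β) (C R : ℕ → A → A → Prop) : Prop :=
  ∃ π : ℕ → A → T.Node, (∀ k a, T.depth (π k a) = k) ∧
    (∀ k a, T.Child (π k a) (π (k + 1) a)) ∧
    (∀ k a b, C k a b → (π k a = π k b ↔ R k a b)) ∧
    ∀ x, ¬ T.IsLeaf x → ∀ b ∈ W, ∃ a, w a = b ∧ π (T.depth x) a = x

section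

variable {A A' β : Type} {w : A → β} {W : Set β} {C R : ℕ → A → A → Prop}

theorem IsPresented.of_iso (f : Iso T T') (h : T.IsPresented w W C R) :
    T'.IsPresented w W C R := by
  obtain ⟨π, h1, h2, h3, h4⟩ := h
  refine ⟨fun k a => f (π k a), fun k a => by rw [f.depth_eq, h1],
    fun k a => f.map_rel_iff.2 (h2 k a), fun k a b hC => ?_, fun x hx b hb => ?_⟩
  · rw [f.injective.eq_iff, h3 k a b hC]
  · obtain ⟨y, rfl⟩ := f.surjective x
    rw [f.isLeaf_iff] at hx
    obtain ⟨a, ha, ha'⟩ := h4 y hx b hb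
    exact ⟨a, ha, by simp only [f.depth_eq, ha']⟩

/-- A right inverse of g selects one preimage of each point. Reflexivity of C and R shows that two
preimages of the same point have the same path, so nothing is lost by the selection. -/
theorem IsPresented.of_surjective {w' : A' → β} {C' R' : ℕ → A' → A' → Prop} (g : A' → A)
    (hg : Function.Surjective g) (hw : ∀ a, w (g a) = w' a)
    (hC : ∀ k a b, C k (g a) (g b) → C' k a b) (hR : ∀ k a b, R k (g a) (g b) ↔ R' k a b)
    (hCr : ∀ k a, C k a a) (hRr : ∀ k a, R k a a) (h : T.IsPresented w' W C' R') :
    T.IsPresented w W C R := by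
  obtain ⟨π, h1, h2, h3, h4⟩ := h
  obtain ⟨s, hs⟩ := hg.hasRightInverse
  refine ⟨fun k a => π k (s a), fun k a => h1 k _, fun k a => h2 k _, fun k a b hab => ?_,
    fun x hx b hb => ?_⟩
  · rw [h3 k _ _ (hC _ _ _ (by rwa [hs, hs])), ← hR, hs, hs]
  · obtain ⟨a, ha, ha'⟩ := h4 x hx b hb
    refine ⟨g a, by rw [hw, ha], ?_⟩
    dsimp only
    rw [← ha', (h3 _ (s (g a)) a (hC _ _ _ (by rw [hs]; exact hCr _ _))).2
      ((hR _ _ _).1 (by rw [hs]; exact hRr _ _))]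
    congr 1
    exact h1 _ _

theorem IsPresented.congr {C' R' : ℕ → A → A → Prop} (h : T.IsPresented w W C R)
    (hC : ∀ k a b, C' k a b → C k a b) (hR : ∀ k a b, C' k a b → (R' k a b ↔ R k a b)) :
    T.IsPresented w W C' R' := by
  obtain ⟨π, h1, h2, h3, h4⟩ := h
  exact ⟨π, h1, h2, fun k a b hab => (h3 k a b (hC k a b hab)).trans (hR k a b hab).symm, h4⟩

/-- Two trees without leaves which are presented in the same way are isomorphic. -/
theorem IsPresented.nonempty_iso (h : T.IsPresented w W C R) (h' : T'.IsPresented w W C R)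
    (hW : W.Nonempty) (hC : ∀ k a b, C k a b) (hT : ∀ x, ¬ T.IsLeaf x) (hT' : ∀ x, ¬ T'.IsLeaf x) :
    Nonempty (Iso T T') := by
  obtain ⟨π, h1, h2, h3, h4⟩ := h
  obtain ⟨π', h1', h2', h3', h4'⟩ := h'
  obtain ⟨b, hb⟩ := hW
  choose s hs hs' using fun x => h4 x (hT x) b hb
  have key : ∀ k a a', π k a = π k a' ↔ π' k a = π' k a' := fun k a a' =>
    (h3 k a a' (hC _ _ _)).trans (h3' k a a' (hC _ _ _)).symm
  -- Both trees identify paths by the same relation R, so the node of T' reached by the chosen path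
  -- does not depend on the choice.
  let f : T.Node → T'.Node := fun x => π' (T.depth x) (s x)
  have hf : ∀ k a, f (π k a) = π' k a := fun k a => by
    have h5 := hs' (π k a)
    rw [h1] at h5
    have := (key _ _ _).1 h5
    simp only [f, h1]
    exact this
  have hfd : ∀ x, T'.depth (f x) = T.depth x := fun x => h1' _ _
  have hinj : Function.Injective f := by
    intro x y hxy
    have hd : T.depth x = T.depth y := by rw [← hfd x, ← hfd y, hxy]
    have hx := hs' x
    have hy := hs' y
    rw [hd] at hx
    refine hx.symm.trans (((key _ _ _).2 ?_).trans hy)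
    rw [← hf, ← hf, hx, hy, hxy]
  have hsurj : Function.Surjective f := by
    intro y
    obtain ⟨a, -, ha⟩ := h4' y (hT' y) b hb
    exact ⟨π (T'.depth y) a, by rw [hf, ha]⟩
  have hchild : ∀ x y, T'.Child (f x) (f y) ↔ T.Child x y := by
    intro x y
    constructor
    · intro hxy
      have hd := T'.depth_child hxy
      rw [hfd, hfd] at hd
      have hy := hs' y
      rw [hd] at hy
      rw [← hy, hf] at hxy
      have := T'.parent_unique hxy (h2' _ _)
      rw [← hf] at this
      rw [hinj this, ← hy, hy]
      conv_rhs => rw [← hy]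
      exact h2 _ _
    · intro hxy
      have hd := T.depth_child hxy
      have hy := hs' y
      rw [hd] at hy
      have hx : x = π (T.depth x) (s y) := T.parent_unique hxy (by
        conv_rhs => rw [← hy]
        exact h2 _ _)
      rw [← hy, hx, hf, hf, h1]
      exact h2' _ _
  exact ⟨⟨Equiv.ofBijective f ⟨hinj, hsurj⟩, fun {x y} => hchild x y⟩⟩

end

/-! ### Presentations of trees with attached trees -/

section

variable {B : T.Node → RTree}

/-- A node of `T` as a node of the tree obtained from `T` by attaching trees. -/
def attachInl (B : T.Node → RTree) (v : T.Node) : (T.attach B).Node := Sum.inl v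

/-- A node of an attached tree as a node of the tree obtained by attaching. -/
def attachInr {v : T.Node} (b : (B v).Node) (hb : 0 < (B v).depth b) : (T.attach B).Node :=
  Sum.inr ⟨v, b, hb⟩

theorem attach_cases {P : (T.attach B).Node → Prop} (h : ∀ v, P (attachInl B v))
    (h' : ∀ v (b : (B v).Node) hb, P (attachInr b hb)) (x : (T.attach B).Node) : P x := by
  rcases x with v | ⟨v, b, hb⟩
  · exact h v
  · exact h' v b hb

@[simp] theorem depth_attachInl (v : T.Node) : (T.attach B).depth (attachInl B v) = T.depth v := rfl

@[simp] theorem depth_attachInr {v : T.Node} (b : (B v).Node) (hb : 0 < (B v).depth b) :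
    (T.attach B).depth (attachInr b hb) = T.depth v + (B v).depth b := rfl

theorem attachInl_injective : Function.Injective (attachInl B) := fun _ _ h => Sum.inl_injective h

theorem attachInl_ne_attachInr {v w : T.Node} (b : (B w).Node) (hb : 0 < (B w).depth b) :
    attachInl B v ≠ attachInr b hb := Sum.inl_ne_inr

theorem attachInr_inj {v : T.Node} {b c : (B v).Node} {hb : 0 < (B v).depth b}
    {hc : 0 < (B v).depth c} : attachInr b hb = attachInr c hc ↔ b = c := by
  constructor
  · intro h
    have h1 := eq_of_heq (Sigma.mk.inj (Sum.inr_injective h)).2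
    exact congrArg Subtype.val h1
  · rintro rfl
    rfl

theorem eq_of_attachInr_eq {v v' : T.Node} {b : (B v).Node} {c : (B v').Node}
    {hb : 0 < (B v).depth b} {hc : 0 < (B v').depth c} (h : attachInr b hb = attachInr c hc) :
    v = v' := congrArg Sigma.fst (Sum.inr_injective h)

theorem child_attachInl {v w : T.Node} (h : T.Child v w) :
    (T.attach B).Child (attachInl B v) (attachInl B w) := .base h

theorem child_attachInl_attachInr {v : T.Node} {b : (B v).Node} (hb : (B v).depth b = 1) :
    (T.attach B).Child (attachInl B v) (attachInr b (by omega)) := .first ⟨b, by omega⟩ hb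

theorem child_attachInr {v : T.Node} {b c : (B v).Node} (hb : 0 < (B v).depth b)
    (hc : 0 < (B v).depth c) (h : (B v).Child b c) :
    (T.attach B).Child (attachInr b hb) (attachInr c hc) := .inner ⟨b, hb⟩ ⟨c, hc⟩ h

theorem isLeaf_attachInr {v : T.Node} {b : (B v).Node} (hb : 0 < (B v).depth b) :
    (T.attach B).IsLeaf (attachInr b hb) ↔ (B v).IsLeaf b := by
  constructor
  · intro h c hc
    exact h _ (child_attachInr hb (by rw [(B v).depth_child hc]; omega) hc)
  · rintro h w hw
    cases hw with
    | inner _ b' hc => exact h _ hc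

theorem isLeaf_attachInl {v : T.Node} :
    (T.attach B).IsLeaf (attachInl B v) ↔
      T.IsLeaf v ∧ ∀ b : (B v).Node, (B v).depth b = 0 → (B v).IsLeaf b := by
  constructor
  · intro h
    refine ⟨fun w hw => h _ (child_attachInl hw), fun b hb c hc => ?_⟩
    have h1 := (B v).depth_child hc
    exact h _ (child_attachInl_attachInr (b := c) (by omega))
  · rintro ⟨h, h'⟩ w hw
    cases hw with
    | base hc => exact h _ hc
    | first b hb =>
      obtain ⟨a, ha⟩ := (B v).exists_parent b.2
      have h1 := (B v).depth_child ha
      exact h' a (by omega) _ ha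

/-- The root of B v is identified with v, which may have other children, so it can be a leaf of B v.
All other nodes keep exactly their children. Hence this property, unlike leaflessness, is inherited
by attached trees. -/
theorem LeavesAtRoot.of_attach (h : (T.attach B).LeavesAtRoot) (v : T.Node) :
    (B v).LeavesAtRoot := by
  intro b hb
  by_contra h0
  have := h _ ((isLeaf_attachInr (Nat.pos_of_ne_zero h0)).2 hb)
  rw [depth_attachInr] at this
  omega

/-- If nothing grew out of v, then v would be a leaf of positive depth. This is the source of points
whose paths run through a given node. -/
theorem LeavesAtRoot.exists_of_isLeaf (h : (T.attach B).LeavesAtRoot) {v : T.Node}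
    (hv : T.IsLeaf v) (h0 : 0 < T.depth v) :
    ∃ b : (B v).Node, (B v).depth b = 0 ∧ ¬ (B v).IsLeaf b := by
  by_contra! hB
  have := h _ (isLeaf_attachInl.2 ⟨hv, hB⟩)
  rw [depth_attachInl] at this
  omega

variable {A β : Type} {w : A → β} {W : Set β} {C R : ℕ → A → A → Prop}

/-- A presentation of the tree obtained from `T` by attaching presented trees `B x`. The path of
`a` follows the path `path a` in `T`, and, if `loc a = some x`, continues in `B x` after `x`. -/
theorem IsPresented.attach (loc : A → Option T.Node) (path : A → ℕ → T.Node)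
    (hdepth : ∀ a k, (∀ x, loc a = some x → k ≤ T.depth x) → T.depth (path a k) = k)
    (hchild : ∀ a k, (∀ x, loc a = some x → k + 1 ≤ T.depth x) →
      T.Child (path a k) (path a (k + 1)))
    (hend : ∀ a x, loc a = some x → path a (T.depth x) = x)
    (hpath : ∀ k a b, C k a b → (∀ x, loc a = some x → k ≤ T.depth x) →
      (∀ x, loc b = some x → k ≤ T.depth x) → (path a k = path b k ↔ R k a b))
    (hsep : ∀ k a b, C k a b → loc a ≠ loc b →
      ¬ ((∀ x, loc a = some x → k ≤ T.depth x) ∧ ∀ x, loc b = some x → k ≤ T.depth x) →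
      ¬ R k a b)
    (hB : ∀ x, (B x).IsPresented (fun a : {a // loc a = some x} => w a.1) W
      (fun i a b => C (T.depth x + i) a.1 b.1) (fun i a b => R (T.depth x + i) a.1 b.1))
    (hsurj : ∀ x, (∀ b : (B x).Node, (B x).depth b = 0 → (B x).IsLeaf b) →
      ¬ (T.attach B).IsLeaf (attachInl B x) → ∀ b ∈ W, ∃ a, w a = b ∧
        (∀ y, loc a = some y → T.depth x ≤ T.depth y) ∧ path a (T.depth x) = x) :
    (T.attach B).IsPresented w W C R := by
  choose ψ h1 h2 h3 h4 using hB
  have hcases : ∀ k a, (∀ x, loc a = some x → k ≤ T.depth x) ∨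
      ∃ x, loc a = some x ∧ T.depth x < k := by
    intro k a
    by_cases h : ∃ x, loc a = some x ∧ T.depth x < k
    · exact Or.inr h
    · push Not at h
      exact Or.inl h
  -- A path is characterized by one equation for the part inside T and one for the part inside the
  -- attached tree; the dependent second component can then be rewritten.
  have hπ : ∀ k a, ∃ y : (T.attach B).Node,
      ((∀ x, loc a = some x → k ≤ T.depth x) → y = attachInl B (path a k)) ∧
      ∀ x (h : loc a = some x) (hk : T.depth x < k),
        y = attachInr (ψ x (k - T.depth x) ⟨a, h⟩) (by rw [h1]; omega) := by
    intro k a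
    rcases hcases k a with h | ⟨x, h, hk⟩
    · exact ⟨_, fun _ => rfl, fun x hx hk => absurd (h x hx) (by omega)⟩
    · refine ⟨attachInr (ψ x (k - T.depth x) ⟨a, h⟩) (by rw [h1]; omega),
        fun h' => absurd (h' x h) (by omega), fun y hy hk' => ?_⟩
      obtain rfl : x = y := Option.some_injective _ (h.symm.trans hy)
      rfl
  choose π hπ1 hπ2 using hπ
  refine ⟨π, fun k a => ?_, fun k a => ?_, fun k a b hC => ?_, ?_⟩
  · rcases hcases k a with h | ⟨x, h, hk⟩
    · rw [hπ1 k a h]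
      exact hdepth a k h
    · rw [hπ2 k a x h hk, depth_attachInr, h1]
      omega
  · rcases hcases (k + 1) a with h | ⟨x, h, hk⟩
    · rw [hπ1 _ a h, hπ1 k a fun x hx => (Nat.le_succ k).trans (h x hx)]
      exact child_attachInl (hchild a k h)
    · rw [hπ2 _ a x h hk]
      by_cases hk' : k ≤ T.depth x
      · have hkx : k = T.depth x := by omega
        have hp : path a k = x := hkx ▸ hend a x h
        rw [hπ1 k a fun y hy => by
          rw [h] at hy
          cases hy
          exact hk', hp]
        exact child_attachInl_attachInr (by rw [h1]; omega)
      · rw [hπ2 k a x h (by omega)]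
        refine child_attachInr _ _ ?_
        have := h2 x (k - T.depth x) ⟨a, h⟩
        rwa [show k + 1 - T.depth x = k - T.depth x + 1 by omega]
  · rcases hcases k a with ha | ⟨x, ha, hka⟩
    · rcases hcases k b with hb | ⟨y, hb, hkb⟩
      · rw [hπ1 k a ha, hπ1 k b hb, ← hpath k a b hC ha hb]
        exact attachInl_injective.eq_iff
      -- One path is still in T and the other has left it: the nodes differ, and `hsep` says that R
      -- fails as well.
      · rw [hπ1 k a ha, hπ2 k b y hb hkb]
        refine iff_of_false (attachInl_ne_attachInr _ _)
          (hsep k a b hC ?_ fun h => absurd (h.2 y hb) (by omega))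
        intro h
        exact absurd (ha y (h.trans hb)) (by omega)
    · rcases hcases k b with hb | ⟨y, hb, hkb⟩
      · rw [hπ1 k b hb, hπ2 k a x ha hka]
        refine iff_of_false (attachInl_ne_attachInr _ _).symm
          (hsep k a b hC ?_ fun h => absurd (h.1 x ha) (by omega))
        intro h
        exact absurd (hb x (h.symm.trans ha)) (by omega)
      · rw [hπ2 k a x ha hka, hπ2 k b y hb hkb]
        by_cases hxy : x = y
        · subst hxy
          have h5 := h3 x (k - T.depth x) ⟨a, ha⟩ ⟨b, hb⟩
          simp only [show T.depth x + (k - T.depth x) = k by omega] at h5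
          rw [← h5 hC]
          exact attachInr_inj
        · refine iff_of_false (fun h => hxy (eq_of_attachInr_eq h))
            (hsep k a b hC ?_ fun h => absurd (h.1 x ha) (by omega))
          rw [ha, hb]
          exact fun h => hxy (Option.some_injective _ h)
  · refine attach_cases (fun x hx b hb => ?_) (fun x c hc hx b hb => ?_)
    · by_cases hroot : ∀ c : (B x).Node, (B x).depth c = 0 → (B x).IsLeaf c
      · obtain ⟨a, ha, hle, hp⟩ := hsurj x hroot hx b hb
        exact ⟨a, ha, by rw [depth_attachInl, hπ1 _ a hle, hp]⟩
      · push Not at hroot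
        obtain ⟨c, hc, hc'⟩ := hroot
        -- A path that continues inside B x passes through x itself.
        obtain ⟨⟨a, hax⟩, ha, -⟩ := h4 x c hc' b hb
        refine ⟨a, ha, ?_⟩
        rw [depth_attachInl, hπ1 _ a fun y hy => (by
          rw [hax] at hy
          cases hy
          exact le_rfl), hend a x hax]
    · rw [isLeaf_attachInr] at hx
      obtain ⟨⟨a, hax⟩, ha, hac⟩ := h4 x c hx b hb
      refine ⟨a, ha, ?_⟩
      rw [depth_attachInr, hπ2 _ a x hax (by omega), attachInr_inj, Nat.add_sub_cancel_left, hac]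

end

end RTree

/-! ### The tree of ℤ_p, products and side branches -/

section

variable {p : ℕ} [Fact p.Prime]

theorem toZModPow_eq_iff (k : ℕ) (x y : ℤ_[p]) :
    PadicInt.toZModPow k x = PadicInt.toZModPow k y ↔ ‖x - y‖ ≤ (p : ℝ) ^ (-(k : ℤ)) := by
  rw [PadicInt.norm_le_pow_iff_mem_span_pow, ← PadicInt.ker_toZModPow, RingHom.mem_ker, map_sub,
    sub_eq_zero]

variable (p) in
/-- The node of depth `k` of `T(ℤ_p)` given by the residue class of `z`. -/
noncomputable def zpNode (k : ℕ) (z : ℤ_[p]) : (treeZp p).Node :=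
  ⟨k, fun _ => PadicInt.toZModPow k z, fun _ => z, trivial, fun _ => rfl⟩

theorem depth_zpNode (k : ℕ) (z : ℤ_[p]) : (treeZp p).depth (zpNode p k z) = k := rfl

theorem zpNode_eq_iff (k : ℕ) (z z' : ℤ_[p]) :
    zpNode p k z = zpNode p k z' ↔ ‖z - z'‖ ≤ (p : ℝ) ^ (-(k : ℤ)) := by
  rw [← toZModPow_eq_iff]
  constructor
  · intro h
    have h1 := eq_of_heq (Sigma.mk.inj h).2
    exact congrFun (congrArg Subtype.val h1) 0
  · intro h
    exact Sigma.ext rfl (heq_of_eq (Subtype.ext (funext fun _ => h)))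

theorem exists_zpNode (x : (treeZp p).Node) : ∃ z, x = zpNode p ((treeZp p).depth x) z := by
  obtain ⟨k, a, y, hy, ha⟩ := x
  refine ⟨y 0, ?_⟩
  have : a = fun _ => PadicInt.toZModPow k (y 0) := funext fun i => by
    rw [← ha i, Subsingleton.elim i 0]
  subst this
  rfl

theorem child_zpNode (k : ℕ) (z : ℤ_[p]) :
    (treeZp p).Child (zpNode p k z) (zpNode p (k + 1) z) := by
  refine .mk _ _ fun i => ?_
  simp only
  rw [← RingHom.comp_apply, PadicInt.zmod_cast_comp_toZModPow k (k + 1) (Nat.le_succ k)]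

namespace RTree

variable {T : RTree}

variable (T) in
/-- The node of a product of trees given by a pair of nodes of equal depth. -/
def prodMk {T' : RTree} (z : T'.Node) (x : T.Node) (h : T'.depth z = T.depth x) :
    (T'.prod T).Node := ⟨(z, x), h⟩

/-- Only T matters, because every node of T(ℤ_p) has a child. -/
theorem isLeaf_prodMk (z : (treeZp p).Node) (x : T.Node) (hx : (treeZp p).depth z = T.depth x) :
    ((treeZp p).prod T).IsLeaf (prodMk T z x hx) ↔ T.IsLeaf x := by
  constructor
  · intro h y hy
    obtain ⟨z', hz'⟩ := exists_zpNode z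
    refine h (prodMk T (zpNode p ((treeZp p).depth z + 1) z') y ?_) ⟨?_, hy⟩
    · rw [T.depth_child hy, depth_zpNode, hx]
    · have := child_zpNode ((treeZp p).depth z) z'
      rwa [← hz'] at this
  · intro h y hy
    exact h _ hy.2

theorem prodMk_eq_iff {T' : RTree} {z z' : T'.Node} {x x' : T.Node} {h h'} :
    prodMk T z x h = prodMk T z' x' h' ↔ z = z' ∧ x = x' := by
  constructor
  · intro e
    exact Prod.mk.inj (Subtype.mk.inj e)
  · rintro ⟨rfl, rfl⟩
    rfl

theorem LeavesAtRoot.of_prod (h : ((treeZp p).prod T).LeavesAtRoot) : T.LeavesAtRoot := by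
  intro x hx
  exact h (prodMk T (zpNode p (T.depth x) 0) x rfl) ((isLeaf_prodMk _ _ _).2 hx)

variable {A A' β β' : Type} {w : A → β} {W : Set β} {C : ℕ → A → A → Prop}
  {w' : A' → β'} {W' : Set β'} {C' R' : ℕ → A' → A' → Prop}

/-- The order of quantifiers in `hs` is dictated by the bones: there the base point b' of the side
tree is determined by the coordinate that also encodes z. So b' is fixed first, and then every point
over b' must lift to a point whose ζ approximates z. -/
theorem IsPresented.prod (h : T.IsPresented w' W' C' R') (ζ : A → ℤ_[p]) (q : A → A')
    (hC : ∀ (k : ℕ) a b, C k a b → ‖ζ a - ζ b‖ ≤ (p : ℝ) ^ (-(k : ℤ)) → C' k (q a) (q b))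
    (hs : ∀ b ∈ W, ∀ (k : ℕ) z, ∃ b' ∈ W', ∀ a', w' a' = b' →
      ∃ a, w a = b ∧ q a = a' ∧ ‖ζ a - z‖ ≤ (p : ℝ) ^ (-(k : ℤ))) :
    ((treeZp p).prod T).IsPresented w W C
      (fun k a b => ‖ζ a - ζ b‖ ≤ (p : ℝ) ^ (-(k : ℤ)) ∧ R' k (q a) (q b)) := by
  obtain ⟨π, h1, h2, h3, h4⟩ := h
  refine ⟨fun k a => prodMk T (zpNode p k (ζ a)) (π k (q a)) (by rw [depth_zpNode, h1]),
    fun k a => rfl, fun k a => ⟨child_zpNode _ _, h2 _ _⟩, fun k a b hab => ?_, ?_⟩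
  · rw [prodMk_eq_iff, zpNode_eq_iff]
    exact and_congr_right fun hz => h3 k _ _ (hC k a b hab hz)
  · suffices H : ∀ z x h, ¬ ((treeZp p).prod T).IsLeaf (prodMk T z x h) → ∀ b ∈ W, ∃ a, w a = b ∧
        zpNode p (T.depth x) (ζ a) = z ∧ π (T.depth x) (q a) = x by
      rintro ⟨⟨z, x⟩, hx⟩ hl b hb
      obtain ⟨a, ha, ha1, ha2⟩ := H z x hx hl b hb
      rw [← hx] at ha1 ha2
      exact ⟨a, ha, prodMk_eq_iff.2 ⟨ha1, ha2⟩⟩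
    intro z x hx hl b hb
    rw [isLeaf_prodMk] at hl
    obtain ⟨z', hz'⟩ := exists_zpNode z
    obtain ⟨b', hb', hs'⟩ := hs b hb (T.depth x) z'
    obtain ⟨a', ha', hx'⟩ := h4 x hl b' hb'
    obtain ⟨a, ha, rfl, haz⟩ := hs' a' ha'
    refine ⟨a, ha, ?_, hx'⟩
    rw [hz', hx, zpNode_eq_iff]
    exact haz

/-- A presentation of a side branch, built from presentations of the side trees. -/
theorem IsPresented.sideBranch {F : RTree} [Finite F.Node] {side : F.Node → RTree}
    (hl : (PadicTrees.sideBranch p F side).LeavesAtRoot)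
    {A β : Type} {w : A → β} {W : Set β} {C R : ℕ → A → A → Prop}
    (leaf : A → F.Node) (hleaf : ∀ a, F.IsLeaf (leaf a)) (ζ : A → ℤ_[p])
    {A' β' : F.Node → Type} {w' : ∀ f, A' f → β' f} {W' : ∀ f, Set (β' f)}
    {C' R' : ∀ f, ℕ → A' f → A' f → Prop}
    (hside : ∀ f, F.IsLeaf f → (side f).IsPresented (w' f) (W' f) (C' f) (R' f))
    (q : ∀ f, {a // leaf a = f} → A' f)
    (hR1 : ∀ i a b, C i a b → leaf a ≠ leaf b → (R i a b ↔ i ≤ F.depth (leaf a) ∧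
      i ≤ F.depth (leaf b) ∧ F.anc (leaf a) i = F.anc (leaf b) i))
    (hR2 : ∀ i a b, C i a b → leaf a = leaf b → i ≤ F.depth (leaf a) → R i a b)
    (hR3 : ∀ f (l : ℕ) (a b : {a // leaf a = f}), C (F.depth f + l) a b →
      (R (F.depth f + l) a b ↔ ‖ζ a - ζ b‖ ≤ (p : ℝ) ^ (-(l : ℤ)) ∧ R' f l (q f a) (q f b)))
    (hC : ∀ f (l : ℕ) (a b : {a // leaf a = f}), C (F.depth f + l) a b →
      ‖ζ a - ζ b‖ ≤ (p : ℝ) ^ (-(l : ℤ)) → C' f l (q f a) (q f b))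
    (hs : ∀ f, F.IsLeaf f → ∀ b ∈ W, ∀ (l : ℕ) z, ∃ b' ∈ W' f, ∀ a', w' f a' = b' →
      ∃ a : {a // leaf a = f}, w a = b ∧ q f a = a' ∧ ‖ζ a - z‖ ≤ (p : ℝ) ^ (-(l : ℤ))) :
    (PadicTrees.sideBranch p F side).IsPresented w W C R := by
  unfold PadicTrees.sideBranch at hl ⊢
  have hB : ∀ x : F.Node,
      (open Classical in if F.IsLeaf x then (treeZp p).prod (side x) else point).IsPresented
        (fun a : {a // some (leaf a) = some x} => w a.1) W
        (fun i a b => C (F.depth x + i) a.1 b.1) (fun i a b => R (F.depth x + i) a.1 b.1) := by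
    intro x
    by_cases hx : F.IsLeaf x
    · rw [if_pos hx]
      refine IsPresented.congr (C := fun i a b => C (F.depth x + i) a.1 b.1)
        ((hside x hx).prod (fun a => ζ a.1) (fun a => q x ⟨a.1, Option.some_injective _ a.2⟩)
          (fun l a b hab => hC x l ⟨a.1, Option.some_injective _ a.2⟩
            ⟨b.1, Option.some_injective _ b.2⟩ hab) fun b hb l z => ?_) (fun _ _ _ h => h)
          fun l a b hab => hR3 x l ⟨a.1, Option.some_injective _ a.2⟩
            ⟨b.1, Option.some_injective _ b.2⟩ hab
      obtain ⟨b', hb', h⟩ := hs x hx b hb l z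
      refine ⟨b', hb', fun a' ha' => ?_⟩
      obtain ⟨⟨a, rfl⟩, h1, h2, h3⟩ := h a' ha'
      exact ⟨⟨a, rfl⟩, h1, h2, h3⟩
    -- Points are located at leaves of F only, so there are none at x; the one-point tree needs
    -- none.
    · rw [if_neg hx]
      have he : ∀ a : {a // some (leaf a) = some x}, False := fun a =>
        hx (Option.some_injective _ a.2 ▸ hleaf a.1)
      exact ⟨fun k a => (he a).elim, fun k a => (he a).elim, fun k a => (he a).elim,
        fun k a => (he a).elim, fun y hy => absurd (fun z hz => hz) hy⟩
  refine IsPresented.attach (fun a => some (leaf a)) (fun a k => F.anc (leaf a) k)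
    (fun a k h => depth_anc _ (h _ rfl)) (fun a k h => child_anc _ (h _ rfl)) ?_ ?_ ?_ hB ?_
  · rintro a _ ⟨⟩
    exact anc_self _
  · intro k a b hab ha hb
    by_cases h : leaf a = leaf b
    · exact iff_of_true (by rw [h]) (hR2 k a b hab h (ha _ rfl))
    · rw [hR1 k a b hab h]
      exact ⟨fun h' => ⟨ha _ rfl, hb _ rfl, h'⟩, fun h' => h'.2.2⟩
  · intro k a b hab hne hk hR
    rw [hR1 k a b hab fun h => hne (congrArg some h)] at hR
    refine hk ⟨?_, ?_⟩
    · rintro _ ⟨⟩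
      exact hR.1
    · rintro _ ⟨⟩
      exact hR.2.1
  · intro x hroot hx b hb
    -- A path through x is found at a leaf f of F above x: if the product attached to f did not
    -- continue, f would be a leaf of positive depth, or x = f would be a leaf of the whole tree.
    obtain ⟨f, hf, hxf⟩ := F.exists_isLeaf x
    have hfr : ∃ b, (open Classical in if F.IsLeaf f then (treeZp p).prod (side f)
        else point).depth b = 0 ∧ ¬ (open Classical in if F.IsLeaf f then (treeZp p).prod (side f)
        else point).IsLeaf b := by
      by_cases h0 : 0 < F.depth f
      · exact hl.exists_of_isLeaf hf h0
      · have : x = f := F.root_unique (by have := hxf.1; omega) (by omega)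
        subst this
        exact absurd (isLeaf_attachInl.2 ⟨hf, hroot⟩) hx
    obtain ⟨c, -, hc⟩ := hfr
    obtain ⟨π, -, -, -, h4⟩ := hB f
    obtain ⟨⟨a, haf⟩, ha, -⟩ := h4 c hc b hb
    have haf' := Option.some_injective _ haf
    refine ⟨a, ha, ?_, ?_⟩
    · rintro _ ⟨⟩
      rw [haf']
      exact hxf.1
    · rw [haf', hxf.2]

end RTree

end

/-! ### Divisibility by powers of p in ℚ_p -/

section

variable {p : ℕ} [hp : Fact p.Prime]

/-- `PDvd k x` means that `x` is divisible by `p ^ k` in `ℚ_p`. -/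
def PDvd (k : ℤ) (x : ℚ_[p]) : Prop := ‖x‖ ≤ (p : ℝ) ^ (-k)

theorem one_lt_cast_prime (p : ℕ) [hp : Fact p.Prime] : (1 : ℝ) < p := by
  exact_mod_cast hp.1.one_lt

theorem cast_prime_pos (p : ℕ) [Fact p.Prime] : (0 : ℝ) < p :=
  zero_lt_one.trans (one_lt_cast_prime p)

namespace PDvd

variable {k l : ℤ} {x y : ℚ_[p]}

theorem zero (k : ℤ) : PDvd k (0 : ℚ_[p]) := by
  rw [PDvd, norm_zero]
  exact (zpow_pos (cast_prime_pos p) _).le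

theorem add (hx : PDvd k x) (hy : PDvd k y) : PDvd k (x + y) :=
  (Padic.nonarchimedean x y).trans (max_le hx hy)

theorem neg (hx : PDvd k x) : PDvd k (-x) := by
  rwa [PDvd, norm_neg]

theorem sub (hx : PDvd k x) (hy : PDvd k y) : PDvd k (x - y) := by
  rw [sub_eq_add_neg]
  exact hx.add hy.neg

theorem sub_comm (h : PDvd k (x - y)) : PDvd k (y - x) := by
  rw [← neg_sub]
  exact h.neg

theorem trans {z : ℚ_[p]} (h : PDvd k (x - y)) (h' : PDvd k (y - z)) : PDvd k (x - z) := by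
  rw [← sub_add_sub_cancel x y z]
  exact h.add h'

theorem mono (hx : PDvd k x) (h : l ≤ k) : PDvd l x :=
  le_trans hx (zpow_le_zpow_right₀ (one_lt_cast_prime p).le (by omega))

theorem mul (hx : PDvd k x) (hy : PDvd l y) : PDvd (k + l) (x * y) := by
  rw [PDvd, norm_mul, neg_add, zpow_add₀ (cast_prime_pos p).ne']
  exact mul_le_mul hx hy (norm_nonneg _) (zpow_pos (cast_prime_pos p) _).le

theorem mul_iff (hx : ‖x‖ = (p : ℝ) ^ (-l)) : PDvd (l + k) (x * y) ↔ PDvd k y := by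
  rw [PDvd, PDvd, norm_mul, neg_add, zpow_add₀ (cast_prime_pos p).ne', hx]
  exact mul_le_mul_iff_right₀ (zpow_pos (cast_prime_pos p) _)

theorem of_norm_eq (hx : ‖x‖ = (p : ℝ) ^ (-l)) (h : k ≤ l) : PDvd k x :=
  mono (k := l) hx.le h

theorem iff_of_norm_eq (hx : ‖x‖ = (p : ℝ) ^ (-l)) : PDvd k x ↔ k ≤ l := by
  rw [PDvd, hx, zpow_le_zpow_iff_right₀ (one_lt_cast_prime p)]
  omega

theorem iff_of_sub (h : PDvd k (x - y)) : PDvd k x ↔ PDvd k y := by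
  constructor
  · intro hx
    have := hx.sub h
    rwa [sub_sub_cancel] at this
  · intro hy
    have := h.add hy
    rwa [sub_add_cancel] at this

theorem zero_iff : PDvd 0 x ↔ ‖x‖ ≤ 1 := by
  rw [PDvd, neg_zero, zpow_zero]

theorem zero_mul (hx : PDvd 0 x) (hy : PDvd k y) : PDvd k (x * y) := by
  have := hx.mul hy
  rwa [zero_add] at this

theorem mul_zero (hx : PDvd k x) (hy : PDvd 0 y) : PDvd k (x * y) := by
  have := hx.mul hy
  rwa [add_zero] at this

theorem natCast (n : ℕ) : PDvd 0 (n : ℚ_[p]) := by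
  rw [zero_iff]
  exact_mod_cast Padic.norm_int_le_one (p := p) n

theorem one : PDvd 0 (1 : ℚ_[p]) := by exact_mod_cast natCast (p := p) 1

theorem pow (hx : PDvd 0 x) (n : ℕ) : PDvd 0 (x ^ n) := by
  rw [zero_iff] at hx ⊢
  rw [norm_pow]
  exact pow_le_one₀ (norm_nonneg _) hx

end PDvd

variable (p) in
theorem norm_prime_pow (k : ℕ) : ‖(p : ℚ_[p]) ^ k‖ = (p : ℝ) ^ (-(k : ℤ)) := Padic.norm_p_pow k

theorem norm_eq_zpow_iff {x : ℚ_[p]} {l : ℤ} :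
    ‖x‖ = (p : ℝ) ^ (-l) ↔ x ≠ 0 ∧ x.valuation = l := by
  constructor
  · intro h
    have hx : x ≠ 0 := by
      rintro rfl
      rw [norm_zero] at h
      exact (zpow_pos (cast_prime_pos p) _).ne h
    rw [Padic.norm_eq_zpow_neg_valuation hx] at h
    have := zpow_right_injective₀ (cast_prime_pos p) (one_lt_cast_prime p).ne' h
    exact ⟨hx, by omega⟩
  · rintro ⟨hx, rfl⟩
    exact Padic.norm_eq_zpow_neg_valuation hx

theorem natCast_eq_of_pdvd_sub {e s s' : ℕ} (hs : s < p ^ e) (hs' : s' < p ^ e)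
    (h : PDvd e ((s : ℚ_[p]) - (s' : ℚ_[p]))) : s = s' := by
  have h1 : ‖(((s : ℤ) - s' : ℤ) : ℚ_[p])‖ ≤ (p : ℝ) ^ (-(e : ℤ)) := by
    rw [Int.cast_sub, Int.cast_natCast, Int.cast_natCast]
    exact h
  rw [Padic.norm_int_le_pow_iff_dvd] at h1
  have h2 := Int.eq_zero_of_abs_lt_dvd h1 (by
    have h3 : (s : ℤ) < (p : ℤ) ^ e := by exact_mod_cast hs
    have h4 : (s' : ℤ) < (p : ℤ) ^ e := by exact_mod_cast hs'
    rw [abs_lt]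
    omega)
  omega

/-! ### Elements with the same leading term -/

/-- `x` and `y` are non-zero, have the same absolute value, and their quotient has distance at most
`δ` from `1`. -/
def RelClose (δ : ℝ) (x y : ℚ_[p]) : Prop := ‖x‖ = ‖y‖ ∧ y ≠ 0 ∧ ‖x - y‖ ≤ δ * ‖y‖

namespace RelClose

variable {δ : ℝ} {x y x' y' : ℚ_[p]}

theorem mul (h : RelClose δ x y) (h' : RelClose δ x' y') : RelClose δ (x * x') (y * y') := by
  refine ⟨by rw [norm_mul, norm_mul, h.1, h'.1], mul_ne_zero h.2.1 h'.2.1, ?_⟩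
  have : x * x' - y * y' = x * (x' - y') + (x - y) * y' := by ring
  rw [this]
  refine (Padic.nonarchimedean _ _).trans (max_le ?_ ?_)
  · rw [norm_mul, norm_mul, h.1, ← mul_assoc, mul_comm δ, mul_assoc]
    exact mul_le_mul_of_nonneg_left h'.2.2 (norm_nonneg _)
  · rw [norm_mul, norm_mul, ← mul_assoc]
    exact mul_le_mul_of_nonneg_right h.2.2 (norm_nonneg _)

theorem inv (h : RelClose δ x y) : RelClose δ x⁻¹ y⁻¹ := by
  have hy := norm_pos_iff.2 h.2.1
  have hx : x ≠ 0 := norm_pos_iff.1 (h.1 ▸ hy)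
  refine ⟨by rw [norm_inv, norm_inv, h.1], inv_ne_zero h.2.1, ?_⟩
  have h1 : x⁻¹ - y⁻¹ = (y - x) * (x⁻¹ * y⁻¹) := by
    have := h.2.1
    field_simp
  rw [h1, norm_mul, norm_mul, norm_sub_rev, norm_inv, norm_inv, h.1]
  calc ‖x - y‖ * (‖y‖⁻¹ * ‖y‖⁻¹) ≤ δ * ‖y‖ * (‖y‖⁻¹ * ‖y‖⁻¹) :=
        mul_le_mul_of_nonneg_right h.2.2 (by positivity)
    _ = δ * ‖y‖⁻¹ := by
        field_simp

theorem refl (hδ : 0 ≤ δ) (hx : x ≠ 0) : RelClose δ x x :=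
  ⟨rfl, hx, by rw [sub_self, norm_zero]; positivity⟩

theorem zpow (hδ : 0 ≤ δ) (h : RelClose δ x y) (n : ℤ) : RelClose δ (x ^ n) (y ^ n) := by
  have hpow : ∀ n : ℕ, RelClose δ (x ^ n) (y ^ n) := by
    intro n
    induction n with
    | zero => simpa using refl hδ one_ne_zero
    | succ n ih =>
      rw [pow_succ, pow_succ]
      exact ih.mul h
  obtain ⟨n, rfl | rfl⟩ := n.eq_nat_or_neg
  · simpa using hpow n
  · simpa using (hpow n).inv

theorem prod {ι : Type*} (hδ : 0 ≤ δ) (s : Finset ι) {f g : ι → ℚ_[p]}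
    (h : ∀ i ∈ s, RelClose δ (f i) (g i)) : RelClose δ (∏ i ∈ s, f i) (∏ i ∈ s, g i) := by
  classical
  induction s using Finset.induction_on with
  | empty => simpa using refl hδ one_ne_zero
  | insert a s ha ih =>
    rw [Finset.prod_insert ha, Finset.prod_insert ha]
    exact (h a (Finset.mem_insert_self _ _)).mul
      (ih fun i hi => h i (Finset.mem_insert_of_mem hi))

end RelClose

/-! ### Positions in a finite tree -/

/-- The point of `ℚ_p ^ S` whose coordinates at the non-root ancestors `a` of `v` are `t a`, and
whose other coordinates are zero. -/
noncomputable def position (S : RTree) (t : S.Node → ℚ_[p]) (v : S.Node) : S.Node → ℚ_[p] :=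
  open Classical in fun a => if 0 < S.depth a ∧ S.IsAnc a v then t a else 0

/-- Here a and a' are the joints reached at depth k on the way to v and v'. If the positions are
congruent, the coordinate at a, which is not divisible by p^k, must also occur for v', so a lies on
the path to v'. It cannot lie beyond a', where all coordinates are divisible. By symmetry a = a'.
Conversely, up to a the coordinates agree by `htt`, and beyond a they vanish modulo p^k. -/
theorem eq_iff_position_congr {S : RTree} {t t' : S.Node → ℚ_[p]} {k : ℤ} {v v' a a' : S.Node}
    (hav : S.IsAnc a v) (hav' : S.IsAnc a' v')
    (htt : ∀ b, 0 < S.depth b → PDvd k (t b - t' b))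
    (ha : 0 < S.depth a → ¬ PDvd k (t a)) (ha' : 0 < S.depth a' → ¬ PDvd k (t a'))
    (hb : ∀ b, S.depth a < S.depth b → S.IsAnc a b → PDvd k (t b))
    (hb' : ∀ b, S.depth a' < S.depth b → S.IsAnc a' b → PDvd k (t b)) :
    a = a' ↔ ∀ b, PDvd k (position S t v b - position S t' v' b) := by
  classical
  -- One half of the converse, stated for arbitrary data so that it can be applied with the two
  -- sides exchanged.
  have key : ∀ {v v' a a' : S.Node} {t t' : S.Node → ℚ_[p]}, S.IsAnc a v → S.IsAnc a' v' →
      (0 < S.depth a → ¬ PDvd k (t a)) →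
      (∀ b, S.depth a' < S.depth b → S.IsAnc a' b → PDvd k (t b)) →
      (∀ b, PDvd k (position S t v b - position S t' v' b)) → S.IsAnc a v' ∧
        S.depth a ≤ S.depth a' := by
    intro v v' a a' t t' hav hav' ha hb' h
    rcases Nat.eq_zero_or_pos (S.depth a) with h0 | h0
    · exact ⟨RTree.isAnc_root h0, by omega⟩
    · have h1 : S.IsAnc a v' := by
        by_contra hn
        have := h a
        rw [position, position, if_pos ⟨h0, hav⟩, if_neg fun h => hn h.2, sub_zero] at this
        exact ha h0 this
      refine ⟨h1, ?_⟩
      by_contra hlt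
      exact ha h0 (hb' a (by omega) (hav'.of_le h1 (by omega)))
  constructor
  · rintro rfl b
    by_cases hbv : 0 < S.depth b ∧ S.IsAnc b v <;> by_cases hbv' : 0 < S.depth b ∧ S.IsAnc b v'
    · rw [position, position, if_pos hbv, if_pos hbv']
      exact htt b hbv.1
    · rw [position, position, if_pos hbv, if_neg hbv', sub_zero]
      have hlt : S.depth a < S.depth b := by
        by_contra hle
        exact hbv' ⟨hbv.1, (hbv.2.of_le hav (by omega)).trans hav'⟩
      exact hb b hlt (hav.of_le hbv.2 hlt.le)
    · rw [position, position, if_neg hbv, if_pos hbv', zero_sub]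
      have hlt : S.depth a < S.depth b := by
        by_contra hle
        exact hbv ⟨hbv'.1, (hbv'.2.of_le hav' (by omega)).trans hav⟩
      exact ((PDvd.iff_of_sub (htt b hbv'.1)).1 (hb b hlt (hav'.of_le hbv'.2 hlt.le))).neg
    · rw [position, position, if_neg hbv, if_neg hbv', sub_zero]
      exact PDvd.zero k
  · intro h
    obtain ⟨h1, h2⟩ := key hav hav' ha hb' h
    obtain ⟨h3, h4⟩ := key (t := t') (t' := t) hav' hav
      (fun h0 => by rw [← PDvd.iff_of_sub (htt a' h0)]; exact ha' h0)
      (fun b hlt hab => (PDvd.iff_of_sub (htt b (by omega))).1 (hb b hlt hab))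
      fun b => (h b).sub_comm
    exact h1.eq_of_depth_eq hav' (le_antisymm h2 h4)

/-- The distances of the constant positions of the nodes of a finite tree. -/
theorem constPosition_congr {F : RTree} {f f' : F.Node} (i : ℕ) (hi : i ≤ F.depth f)
    (hi' : i ≤ F.depth f') :
    F.anc f i = F.anc f' i ↔ ∀ b, PDvd (p := p) i
      (position F (fun a => (p : ℚ_[p]) ^ (F.depth a - 1)) f b -
        position F (fun a => (p : ℚ_[p]) ^ (F.depth a - 1)) f' b) := by
  -- The exponent is one less than the depth because p^(depth a - 1) has to be non-zero modulo p^i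
  -- exactly when depth a ≤ i.
  refine eq_iff_position_congr (RTree.isAnc_anc f hi) (RTree.isAnc_anc f' hi') ?_ ?_ ?_ ?_ ?_
  · intro b _
    rw [sub_self]
    exact PDvd.zero _
  all_goals simp only [PDvd.iff_of_norm_eq (norm_prime_pow p _), RTree.depth_anc, hi, hi']
  all_goals intros; omega

/-! ### Powers of elements close to `1` -/

theorem pdvd_pow_sub_one {r : ℤ} (hr : 0 ≤ r) {x : ℚ_[p]} (hx : PDvd r (x - 1)) (n : ℕ) :
    PDvd r (x ^ n - 1) := by
  have hx0 : PDvd 0 x := by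
    have := (hx.mono hr).add PDvd.one
    rwa [sub_add_cancel] at this
  induction n with
  | zero => simpa using PDvd.zero r
  | succ n ih =>
    have : x ^ (n + 1) - 1 = x * (x ^ n - 1) + (x - 1) := by ring
    rw [this]
    exact (hx0.zero_mul ih).add hx

theorem pdvd_sum {ι : Type*} (s : Finset ι) {k : ℤ} {f : ι → ℚ_[p]}
    (h : ∀ i ∈ s, PDvd k (f i)) : PDvd k (∑ i ∈ s, f i) := by
  classical
  induction s using Finset.induction_on with
  | empty => simpa using PDvd.zero k
  | insert a s ha ih =>
    rw [Finset.sum_insert ha]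
    exact (h a (Finset.mem_insert_self _ _)).add
      (ih fun i hi => h i (Finset.mem_insert_of_mem hi))

theorem norm_natCast_eq {N : ℕ} (hN : N ≠ 0) :
    ‖(N : ℚ_[p])‖ = (p : ℝ) ^ (-(padicValNat p N : ℤ)) := by
  rw [norm_eq_zpow_iff]
  exact ⟨by exact_mod_cast hN, by rw [Padic.valuation_natCast]⟩

/-- On `1 + p ^ r ℤ_p`, the `N`-th power map multiplies distances by `|N|`, if `r > v(N)`. -/
theorem norm_pow_sub_pow {N r : ℕ} (hN : N ≠ 0) (hr : padicValNat p N < r) {x y : ℚ_[p]}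
    (hx : PDvd r (x - 1)) (hy : PDvd r (y - 1)) :
    ‖x ^ N - y ^ N‖ = (p : ℝ) ^ (-(padicValNat p N : ℤ)) * ‖x - y‖ := by
  -- All N summands of (x^N - y^N)/(x - y) are congruent to 1 modulo p^r, so the sum is congruent to
  -- N; as v(N) < r, it has the norm of N.
  have h1 : PDvd r (∑ i ∈ Finset.range N, x ^ i * y ^ (N - 1 - i) - (N : ℚ_[p])) := by
    have : (N : ℚ_[p]) = ∑ i ∈ Finset.range N, 1 := by simp
    rw [this, ← Finset.sum_sub_distrib]
    refine pdvd_sum _ fun i _ => ?_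
    have h2 := pdvd_pow_sub_one (Int.natCast_nonneg r) hx i
    have h3 := pdvd_pow_sub_one (Int.natCast_nonneg r) hy (N - 1 - i)
    have h4 : PDvd 0 (x ^ i) := by
      have := (h2.mono (Int.natCast_nonneg r)).add PDvd.one
      rwa [sub_add_cancel] at this
    have : x ^ i * y ^ (N - 1 - i) - 1 = x ^ i * (y ^ (N - 1 - i) - 1) + (x ^ i - 1) := by ring
    rw [this]
    exact (h4.zero_mul h3).add h2
  have h2 : ‖∑ i ∈ Finset.range N, x ^ i * y ^ (N - 1 - i)‖ = ‖(N : ℚ_[p])‖ := by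
    refine Padic.norm_eq_of_norm_sub_lt_right (lt_of_le_of_lt h1 ?_)
    rw [norm_natCast_eq hN]
    exact zpow_lt_zpow_right₀ (one_lt_cast_prime p) (by omega)
  rw [← geom_sum₂_mul, norm_mul, h2, norm_natCast_eq hN]

/-- Every `p`-adic integer is approximated by `(η ^ N - 1) / p ^ (r + v(N))` for some
`η ∈ 1 + p ^ r ℤ_p`. -/
theorem exists_pow_approx {N r : ℕ} (hN : N ≠ 0) (hr : padicValNat p N < r) (m : ℕ) (z : ℤ_[p]) :
    ∃ η : ℚ_[p], PDvd r (η - 1) ∧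
      PDvd (r + padicValNat p N + m) (η ^ N - 1 - (p : ℚ_[p]) ^ (r + padicValNat p N) * (z : ℚ_[p])) := by
  set ν := padicValNat p N with hν
  let η : ℤ_[p] → ℚ_[p] := fun a => 1 + (p : ℚ_[p]) ^ r * (a : ℚ_[p])
  have hint : ∀ a : ℤ_[p], PDvd 0 (a : ℚ_[p]) := fun a => PDvd.zero_iff.2 a.2
  have hη : ∀ a, PDvd r (η a - 1) := fun a => by
    simp only [η, add_sub_cancel_left]
    exact PDvd.mul_zero (norm_prime_pow p r).le (hint a)
  have hηη : ∀ a b, ‖η a - η b‖ = (p : ℝ) ^ (-(r : ℤ)) * ‖a - b‖ := fun a b => by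
    have : η a - η b = (p : ℚ_[p]) ^ r * ((a - b : ℤ_[p]) : ℚ_[p]) := by
      simp only [η, PadicInt.coe_sub]
      ring
    rw [this, norm_mul, norm_prime_pow, PadicInt.norm_def]
  have hp0 : (p : ℚ_[p]) ≠ 0 := by exact_mod_cast hp.1.ne_zero
  have hf : ∀ a : ℤ_[p], ∃ b : ℤ_[p], η a ^ N - 1 = (p : ℚ_[p]) ^ (r + ν) * (b : ℚ_[p]) := by
    intro a
    have h1 : ‖(η a ^ N - 1) / (p : ℚ_[p]) ^ (r + ν)‖ ≤ 1 := by
      have h2 := norm_pow_sub_pow hN hr (hη a) (y := 1) (by rw [sub_self]; exact PDvd.zero _)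
      rw [one_pow] at h2
      have h3 := hηη a 0
      simp only [η, PadicInt.coe_zero, mul_zero, add_zero, sub_zero] at h3
      rw [norm_div, h2, h3, norm_prime_pow, ← mul_assoc, ← zpow_add₀ (cast_prime_pos p).ne']
      rw [show (-(ν : ℤ) + -(r : ℤ)) = -((r + ν : ℕ) : ℤ) by push_cast; ring, mul_comm,
        mul_div_assoc, div_self (zpow_pos (cast_prime_pos p) _).ne', mul_one]
      exact a.norm_le_one
    refine ⟨⟨_, h1⟩, ?_⟩
    field_simp
  choose f hf using hf
  have hff : ∀ a b, ‖f a - f b‖ = ‖a - b‖ := by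
    intro a b
    have h1 := norm_pow_sub_pow hN hr (hη a) (hη b)
    rw [hηη] at h1
    have h2 : η a ^ N - η b ^ N = (p : ℚ_[p]) ^ (r + ν) * ((f a - f b : ℤ_[p]) : ℚ_[p]) := by
      rw [PadicInt.coe_sub, mul_sub, ← hf, ← hf]
      ring
    rw [h2, norm_mul, norm_prime_pow, ← PadicInt.norm_def, ← mul_assoc,
      ← zpow_add₀ (cast_prime_pos p).ne'] at h1
    rw [show -((r + ν : ℕ) : ℤ) = -(ν : ℤ) + -(r : ℤ) by push_cast; ring] at h1
    exact mul_left_cancel₀ (zpow_pos (cast_prime_pos p) _).ne' h1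
  -- The map f preserves distances, so it induces an injection of the finite ring ℤ/p^m into itself,
  -- which is then surjective. This replaces an appeal to completeness.
  let g : ZMod (p ^ m) → ZMod (p ^ m) := fun a => PadicInt.toZModPow m (f (a.val : ℤ_[p]))
  have hg : Function.Injective g := by
    intro a b hab
    simp only [g] at hab
    rw [toZModPow_eq_iff, hff, ← toZModPow_eq_iff, map_natCast,
      map_natCast, ZMod.natCast_zmod_val, ZMod.natCast_zmod_val] at hab
    exact hab
  obtain ⟨a, ha⟩ := Finite.surjective_of_injective hg (PadicInt.toZModPow m z)
  simp only [g] at ha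
  rw [toZModPow_eq_iff] at ha
  refine ⟨η (a.val : ℤ_[p]), hη _, ?_⟩
  rw [hf, ← mul_sub, ← PadicInt.coe_sub]
  have := (PDvd.mul_iff (k := m) (y := ((f (a.val : ℤ_[p]) - z : ℤ_[p]) : ℚ_[p]))
    (norm_prime_pow p (r + ν))).2 ha
  push_cast at this ⊢
  exact this

theorem pdvd_div_prime_pow {x : ℚ_[p]} {j : ℕ} {k : ℤ} :
    PDvd k (x / (p : ℚ_[p]) ^ j) ↔ PDvd (j + k) x := by
  have hp0 : (p : ℚ_[p]) ≠ 0 := by exact_mod_cast hp.1.ne_zero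
  rw [← PDvd.mul_iff (norm_prime_pow p j), mul_div_cancel₀ _ (pow_ne_zero _ hp0)]

/-- A digit `s` and an element `ε` of `1 + p ^ K ℤ_p` together describe an element
`s + (ε - 1) / p ^ j` of `ℤ_p`, if `s < p ^ (K - j)`. -/
theorem pdvd_digit_sub_iff {K j s s' l : ℕ} {ε ε' : ℚ_[p]} (hs : s < p ^ (K - j))
    (hs' : s' < p ^ (K - j)) (hε : PDvd K (ε - 1)) (hε' : PDvd K (ε' - 1)) :
    PDvd l ((s : ℚ_[p]) + (ε - 1) / (p : ℚ_[p]) ^ j -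
        ((s' : ℚ_[p]) + (ε' - 1) / (p : ℚ_[p]) ^ j)) ↔
      PDvd (j + l) (ε - ε') ∧ PDvd l ((s : ℚ_[p]) - (s' : ℚ_[p])) := by
  have hεε : PDvd K (ε - ε') := hε.trans hε'.sub_comm
  have h1 : ((s : ℚ_[p]) + (ε - 1) / (p : ℚ_[p]) ^ j -
      ((s' : ℚ_[p]) + (ε' - 1) / (p : ℚ_[p]) ^ j)) =
      (s - s') + (ε - ε') / (p : ℚ_[p]) ^ j := by ring
  rw [h1]
  constructor
  · intro h
    -- If j ≤ K and l ≤ K - j, the part with ε is divisible by p^l anyway; for larger l, the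
    -- congruence modulo p^(K - j) first forces equal digits. The subtraction is truncated: for K <
    -- j the first case means l = 0, and in the second both digits are 0.
    by_cases hl : l ≤ K - j
    · by_cases hl0 : l = 0
      · subst hl0
        have h2 : PDvd ((0 : ℕ) : ℤ) ((s : ℚ_[p]) - (s' : ℚ_[p])) :=
          (PDvd.natCast s).sub (PDvd.natCast s')
        refine ⟨?_, h2⟩
        have := h.sub h2
        rw [add_sub_cancel_left] at this
        exact pdvd_div_prime_pow.1 this
      · have h2 : PDvd (j + l) (ε - ε') := hεε.mono (by omega)
        refine ⟨h2, ?_⟩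
        have := h.sub (pdvd_div_prime_pow.2 h2)
        rwa [add_sub_cancel_right] at this
    · have h2 : PDvd ((K - j : ℕ) : ℤ) ((ε - ε') / (p : ℚ_[p]) ^ j) ∨ K < j := by
        by_cases hKj : K < j
        · exact Or.inr hKj
        · exact Or.inl (pdvd_div_prime_pow.2 (hεε.mono (by omega)))
      have hss : s = s' := by
        rcases h2 with h2 | h2
        · have := (h.mono (l := ((K - j : ℕ) : ℤ)) (by omega)).sub h2
          rw [add_sub_cancel_right] at this
          exact natCast_eq_of_pdvd_sub hs hs' this
        · rw [Nat.sub_eq_zero_of_le h2.le, pow_zero] at hs hs'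
          omega
      subst hss
      rw [sub_self, zero_add] at h
      exact ⟨pdvd_div_prime_pow.1 h, by rw [sub_self]; exact PDvd.zero _⟩
  · rintro ⟨h2, h3⟩
    exact h3.add (pdvd_div_prime_pow.2 h2)

/-- The digit is the residue of z modulo p^e, where e = r + v(N) - j. The remainder is p^e z', and
p^(j + e) z' is approximated by η^N - 1. -/
theorem exists_digit_approx {N r j : ℕ} (hN : N ≠ 0) (hr : padicValNat p N < r)
    (hj : j ≤ r + padicValNat p N) (l : ℕ) (z : ℤ_[p]) :
    ∃ s < p ^ (r + padicValNat p N - j), ∃ η : ℚ_[p], PDvd r (η - 1) ∧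
      PDvd l ((s : ℚ_[p]) + (η ^ N - 1) / (p : ℚ_[p]) ^ j - (z : ℚ_[p])) := by
  set e := r + padicValNat p N - j with he
  have hp0 : (p : ℚ_[p]) ≠ 0 := by exact_mod_cast hp.1.ne_zero
  obtain ⟨z', hz'⟩ := Ideal.mem_span_singleton'.1 (PadicInt.appr_spec e z)
  obtain ⟨η, hη, h⟩ := exists_pow_approx hN hr l z'
  refine ⟨z.appr e, PadicInt.appr_lt z e, η, hη, ?_⟩
  have hz : (z : ℚ_[p]) = (z.appr e : ℕ) + (z' : ℚ_[p]) * (p : ℚ_[p]) ^ e := by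
    have := congrArg (fun x : ℤ_[p] => (x : ℚ_[p])) hz'
    push_cast at this
    rw [this]
    ring
  have h1 : (z.appr e : ℚ_[p]) + (η ^ N - 1) / (p : ℚ_[p]) ^ j - (z : ℚ_[p]) =
      (η ^ N - 1 - (p : ℚ_[p]) ^ (r + padicValNat p N) * (z' : ℚ_[p])) / (p : ℚ_[p]) ^ j := by
    rw [hz, show r + padicValNat p N = j + e by omega, pow_add]
    field_simp
    ring
  rw [h1, pdvd_div_prime_pow]
  exact h.mono (by omega)

end

/-! ### Definable sets and functions -/

section

open FirstOrder FirstOrder.Language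

variable {p : ℕ} [hp : Fact p.Prime] {α β : Type}

attribute [local instance] FirstOrder.Ring.compatibleRingOfRing

/-- Definability of subsets of `ℚ_p ^ α`. -/
def IsDef (X : Set (α → ℚ_[p])) : Prop :=
  Set.Definable Set.univ FirstOrder.Language.ring X

/-- Definability of functions on `ℚ_p ^ α`. -/
def IsDefFun (f : (α → ℚ_[p]) → ℚ_[p]) : Prop :=
  Set.DefinableFun FirstOrder.Language.ring Set.univ f

namespace IsDef

variable {X Y : Set (α → ℚ_[p])}

theorem inter (hX : IsDef X) (hY : IsDef Y) : IsDef (X ∩ Y) := Set.Definable.inter hX hY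

theorem union (hX : IsDef X) (hY : IsDef Y) : IsDef (X ∪ Y) := Set.Definable.union hX hY

theorem compl (hX : IsDef X) : IsDef Xᶜ := Set.Definable.compl hX

theorem iUnion {ι : Type*} [Finite ι] {f : ι → Set (α → ℚ_[p])} (h : ∀ i, IsDef (f i)) :
    IsDef (⋃ i, f i) := by
  unfold IsDef
  exact Set.definable_iUnion_of_finite h

theorem iInter {ι : Type*} [Finite ι] {f : ι → Set (α → ℚ_[p])} (h : ∀ i, IsDef (f i)) :
    IsDef (⋂ i, f i) := by
  unfold IsDef
  exact Set.definable_iInter_of_finite h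

theorem preimage_comp (f : α → β) (hX : IsDef X) :
    IsDef ((fun g : β → ℚ_[p] => g ∘ f) ⁻¹' X) := Set.Definable.preimage_comp f hX

theorem exists_of_finite [Finite β] {S : Set ((α ⊕ β) → ℚ_[p])} (hS : IsDef S) :
    IsDef {v : α → ℚ_[p] | ∃ u : β → ℚ_[p], Sum.elim v u ∈ S} :=
  Set.Definable.exists_of_finite hS

theorem preimage_map [Finite β] {F : β → (α → ℚ_[p]) → ℚ_[p]} (hF : ∀ i, IsDefFun (F i))
    {S : Set (β → ℚ_[p])} (hS : IsDef S) : IsDef {v | (fun i => F i v) ∈ S} :=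
  Set.Definable.preimage_map (F := fun v i => F i v) hF hS

/-- A projection along one coordinate. -/
theorem exists_one {S : Set ((α ⊕ Unit) → ℚ_[p])} (hS : IsDef S) :
    IsDef {v : α → ℚ_[p] | ∃ y : ℚ_[p], Sum.elim v (fun _ => y) ∈ S} := by
  convert exists_of_finite hS using 1
  ext v
  exact ⟨fun ⟨y, h⟩ => ⟨_, h⟩, fun ⟨u, h⟩ => ⟨u (), h⟩⟩

end IsDef

namespace IsDefFun

variable {f g : (α → ℚ_[p]) → ℚ_[p]}

theorem proj (i : α) : IsDefFun (fun v : α → ℚ_[p] => v i) := by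
  unfold IsDefFun
  exact Set.DefinableFun.proj _

theorem const (c : ℚ_[p]) : IsDefFun (fun _ : α → ℚ_[p] => c) := by
  unfold IsDefFun
  exact FirstOrder.Language.definableFun_const _ _ trivial

theorem setOf_eq (hf : IsDefFun f) (hg : IsDefFun g) : IsDef {v | f v = g v} :=
  Set.DefinableFun.ofPred_eq hf hg

theorem comp [Finite β] {f : (β → ℚ_[p]) → ℚ_[p]} (hf : IsDefFun f)
    {F : β → (α → ℚ_[p]) → ℚ_[p]} (hF : ∀ i, IsDefFun (F i)) :
    IsDefFun (fun v => f fun i => F i v) :=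
  Set.DefinableFun.comp (g := fun v i => F i v) hF hf

theorem reindex [Finite α] (hf : IsDefFun f) (ψ : α → β) :
    IsDefFun (fun v : β → ℚ_[p] => f (v ∘ ψ)) := hf.comp fun i => proj (ψ i)

theorem ite {P : (α → ℚ_[p]) → Prop} [DecidablePred P] (hP : IsDef {v | P v}) (hf : IsDefFun f)
    (hg : IsDefFun g) : IsDefFun (fun v => if P v then f v else g v) :=
  Set.DefinableFun.ite hP hf hg

theorem mul (hf : IsDefFun f) (hg : IsDefFun g) : IsDefFun (fun v => f v * g v) := by
  have h : IsDefFun (fun v : Fin 2 → ℚ_[p] => v 0 * v 1) := by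
    have := Set.DefinableFun.of_empty (A := Set.univ)
      (Set.DefinableFun.fun_symbol (M := ℚ_[p]) FirstOrder.Ring.mulFunc)
    unfold IsDefFun
    convert this using 2 with v
    simp
  exact h.comp (F := ![f, g]) (fun i => by fin_cases i <;> assumption)

theorem add (hf : IsDefFun f) (hg : IsDefFun g) : IsDefFun (fun v => f v + g v) := by
  have h : IsDefFun (fun v : Fin 2 → ℚ_[p] => v 0 + v 1) := by
    have := Set.DefinableFun.of_empty (A := Set.univ)
      (Set.DefinableFun.fun_symbol (M := ℚ_[p]) FirstOrder.Ring.addFunc)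
    unfold IsDefFun
    convert this using 2 with v
    simp
  exact h.comp (F := ![f, g]) (fun i => by fin_cases i <;> assumption)

theorem sub (hf : IsDefFun f) (hg : IsDefFun g) : IsDefFun (fun v => f v - g v) := by
  have := hf.add ((const (-1)).mul hg)
  simpa [sub_eq_add_neg] using this

theorem pow (hf : IsDefFun f) (n : ℕ) : IsDefFun (fun v => f v ^ n) := by
  induction n with
  | zero => simpa using const 1
  | succ n ih =>
    simp only [pow_succ]
    exact ih.mul hf

theorem inv (hf : IsDefFun f) : IsDefFun (fun v => (f v)⁻¹) := by
  have h : IsDefFun (fun v : Unit → ℚ_[p] => (v ())⁻¹) := by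
    change IsDef _
    have h1 : IsDef {w : Option Unit → ℚ_[p] | w (some ()) * w none = 1} :=
      setOf_eq ((proj _).mul (proj _)) (const 1)
    -- The convention 0⁻¹ = 0 adds one point to the graph.
    have h2 : IsDef ({w : Option Unit → ℚ_[p] | w (some ()) = 0} ∩ {w | w none = 0}) :=
      (setOf_eq (proj _) (const 0)).inter (setOf_eq (proj _) (const 0))
    convert h1.union h2 using 1
    ext w
    simp only [Function.tupleGraph, Set.mem_union, Set.mem_inter_iff, Set.mem_ofPred_eq,
      Function.comp]
    by_cases hw : w (some ()) = 0
    · simp [hw, eq_comm]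
    · rw [inv_eq_iff_eq_inv, eq_comm (b := (w none)⁻¹)]
      constructor
      · intro h
        left
        rw [← h]
        refine inv_mul_cancel₀ fun h0 => hw ?_
        rw [← h, h0, inv_zero]
      · rintro (h | h)
        · exact inv_eq_of_mul_eq_one_left h
        · exact absurd h.1 hw
  exact h.comp (F := fun _ => f) (fun _ => hf)

theorem zpow (hf : IsDefFun f) (n : ℤ) : IsDefFun (fun v => f v ^ n) := by
  obtain ⟨n, rfl | rfl⟩ := n.eq_nat_or_neg
  · simpa using hf.pow n
  · simpa using (hf.pow n).inv

theorem prod {ι : Type*} (s : Finset ι) {f : ι → (α → ℚ_[p]) → ℚ_[p]}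
    (hf : ∀ i, IsDefFun (f i)) : IsDefFun (fun v => ∏ i ∈ s, f i v) := by
  classical
  induction s using Finset.induction_on with
  | empty => simpa using const 1
  | insert a s ha ih =>
    simp only [Finset.prod_insert ha]
    exact (hf a).mul ih

end IsDefFun

/-! ### Definability of the valuation -/

/-- The valuation ring is definable: `x ∈ ℤ_p` if and only if `1 + p x ^ (p + 1)` is a `p + 1`-st
power. -/
theorem norm_le_one_iff_exists_pow (x : ℚ_[p]) :
    ‖x‖ ≤ 1 ↔ ∃ y : ℚ_[p], y ^ (p + 1) = 1 + p * x ^ (p + 1) := by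
  constructor
  · intro hx
    let x' : ℤ_[p] := ⟨x, hx⟩
    let F : Polynomial ℤ_[p] := Polynomial.X ^ (p + 1) - Polynomial.C (1 + p * x' ^ (p + 1))
    have hF1 : F.aeval (1 : ℤ_[p]) = -(p * x' ^ (p + 1)) := by simp [F]
    have hF2 : F.derivative.aeval (1 : ℤ_[p]) = p + 1 := by
     
      simp [F, -map_pow]
    have hpx : ‖(p : ℤ_[p]) * x' ^ (p + 1)‖ < 1 :=
      PadicInt.mem_nonunits.1 (Ideal.mul_mem_right _ (IsLocalRing.maximalIdeal ℤ_[p])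
        PadicInt.p_nonunit)
    have hp1 : ‖(p : ℤ_[p]) + 1‖ = 1 := by
      rw [PadicInt.norm_add_eq_max_of_ne, norm_one, max_eq_right]
      · exact PadicInt.norm_le_one _
      · rw [norm_one]
        exact (PadicInt.mem_nonunits.1 PadicInt.p_nonunit).ne
    -- Modulo p, the polynomial has the root 1, and its derivative there is the unit p + 1.
    obtain ⟨z, hz, -⟩ := hensels_lemma (F := F) (a := (1 : ℤ_[p])) (by
      rw [hF1, hF2, hp1, norm_neg]
      simpa using hpx)
    refine ⟨z, ?_⟩
    have : z ^ (p + 1) - (1 + p * x' ^ (p + 1)) = 0 := by simpa [F] using hz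
    rw [sub_eq_zero] at this
    have h := congrArg (fun x : ℤ_[p] => (x : ℚ_[p])) this
    push_cast at h
    exact h
  · rintro ⟨y, hy⟩
    by_contra hx
    push Not at hx
    have hx0 : x ≠ 0 := by
      rintro rfl
      rw [norm_zero] at hx
      linarith
    have hxv := Padic.norm_eq_zpow_neg_valuation hx0
    have hv : x.valuation < 0 := by
      by_contra hv
      have := (Padic.norm_le_one_iff_val_nonneg x).2 (by omega)
      linarith
    have h1 : ‖(p : ℚ_[p]) * x ^ (p + 1)‖ = (p : ℝ) ^ (-(1 + (p + 1) * x.valuation)) := by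
      rw [norm_mul, norm_pow, hxv, Padic.norm_p, ← zpow_natCast, ← zpow_mul, ← zpow_neg_one,
        ← zpow_add₀ (cast_prime_pos p).ne']
      congr 1
      push_cast
      ring
    have hp2 : (2 : ℤ) ≤ p := by exact_mod_cast hp.1.two_le
    have h2 : 1 < ‖(p : ℚ_[p]) * x ^ (p + 1)‖ := by
      rw [h1]
      refine one_lt_zpow₀ (one_lt_cast_prime p) ?_
      nlinarith
    have h3 : ‖y ^ (p + 1)‖ = (p : ℝ) ^ (-(1 + (p + 1) * x.valuation)) := by
      rw [hy, Padic.add_eq_max_of_ne (by rw [norm_one]; exact h2.ne), norm_one,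
        max_eq_right h2.le, h1]
    rw [norm_eq_zpow_iff, Padic.valuation_pow] at h3
    have h4 := h3.2
    push_cast at h4
    -- For |x| > 1 the term p x^(p+1) dominates, so y^(p+1) has valuation 1 + (p + 1) v(x), which is
    -- not a multiple of p + 1.
    have h5 : ((p : ℤ) + 1) ∣ 1 :=
      ⟨y.valuation - x.valuation, by linear_combination -h4⟩
    have := Int.le_of_dvd one_pos h5
    omega

theorem isDef_norm_le_one {f : (α → ℚ_[p]) → ℚ_[p]} [Finite α] (hf : IsDefFun f) :
    IsDef {v | ‖f v‖ ≤ 1} := by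
  have h : IsDef {w : (α ⊕ Unit) → ℚ_[p] | w (Sum.inr ()) ^ (p + 1) =
      1 + p * f (w ∘ Sum.inl) ^ (p + 1)} :=
    IsDefFun.setOf_eq ((IsDefFun.proj _).pow _)
      ((IsDefFun.const 1).add ((IsDefFun.const _).mul ((hf.reindex Sum.inl).pow _)))
  convert h.exists_one using 1
  ext v
  exact norm_le_one_iff_exists_pow (f v)

theorem isDef_norm_le_norm {f g : (α → ℚ_[p]) → ℚ_[p]} [Finite α] (hf : IsDefFun f)
    (hg : IsDefFun g) : IsDef {v | ‖f v‖ ≤ ‖g v‖} := by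
  have h1 : IsDef ({v | ‖f v * (g v)⁻¹‖ ≤ 1} ∩ {v | g v = 0}ᶜ) :=
    (isDef_norm_le_one (hf.mul hg.inv)).inter (hg.setOf_eq (IsDefFun.const 0)).compl
  have h2 : IsDef {v | f v = 0} := hf.setOf_eq (IsDefFun.const 0)
  convert h1.union h2 using 1
  ext v
  simp only [Set.mem_union, Set.mem_inter_iff, Set.mem_ofPred_eq, Set.mem_compl_iff]
  by_cases hg0 : g v = 0
  · simp [hg0]
  · have h3 : ‖f v * (g v)⁻¹‖ ≤ 1 ↔ ‖f v‖ ≤ ‖g v‖ := by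
      rw [norm_mul, norm_inv, ← div_eq_mul_inv, div_le_one (norm_pos_iff.2 hg0)]
    rw [h3]
    constructor
    · exact fun h => Or.inl ⟨h, hg0⟩
    · rintro (h | h)
      · exact h.1
      · rw [h, norm_zero]
        exact norm_nonneg _

theorem isDef_norm_eq_norm {f g : (α → ℚ_[p]) → ℚ_[p]} [Finite α] (hf : IsDefFun f)
    (hg : IsDefFun g) : IsDef {v | ‖f v‖ = ‖g v‖} := by
  convert (isDef_norm_le_norm hf hg).inter (isDef_norm_le_norm hg hf) using 1
  ext v
  exact le_antisymm_iff

/-- The elements `y ≠ 0` with leading coefficient `1` modulo `p ^ r`. -/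
def leadingOne (p r : ℕ) [Fact p.Prime] : Set ℚ_[p] :=
  {y | y ≠ 0 ∧ PDvd r (y / (p : ℚ_[p]) ^ y.valuation - 1)}

/-- Let φ be the order of the unit group of ℤ/p^r. By Euler's theorem every non-zero φ-th power has
leading coefficient 1 modulo p^r; its valuation is a multiple of φ, and the factor p^i supplies the
other valuations. The right-hand side no longer mentions p^v(y), which makes it a first-order
condition. -/
theorem mem_leadingOne_iff {r : ℕ} (hr : 0 < r) (y : ℚ_[p]) :
    y ∈ leadingOne p r ↔ y ≠ 0 ∧ ∃ i : Fin (p ^ r).totient, ∃ z : ℚ_[p],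
      ‖y - p ^ (i : ℕ) * z ^ (p ^ r).totient‖ ≤ ‖(p : ℚ_[p]) ^ r * y‖ := by
  have hp0 : (p : ℚ_[p]) ≠ 0 := by exact_mod_cast hp.1.ne_zero
  have hφ : 0 < (p ^ r).totient := Nat.totient_pos.2 (pow_pos hp.1.pos _)
  set φ := (p ^ r).totient
  have key : ∀ {y : ℚ_[p]} (hy : y ≠ 0) (x : ℚ_[p]),
      ‖y - x‖ ≤ ‖(p : ℚ_[p]) ^ r * y‖ ↔ PDvd r (x / y - 1) := by
    intro y hy x
    have h1 : y - x = -(y * (x / y - 1)) := by field_simp; ring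
    rw [h1, norm_neg, norm_mul, norm_mul, norm_prime_pow, mul_comm _ ‖y‖, PDvd]
    exact mul_le_mul_iff_right₀ (norm_pos_iff.2 hy)
  have inv_close : ∀ {x : ℚ_[p]}, PDvd r (x - 1) → PDvd r (x⁻¹ - 1) := by
    intro x hx
    have hx1 : ‖x‖ = ‖(1 : ℚ_[p])‖ := Padic.norm_eq_of_norm_sub_lt_right (lt_of_le_of_lt hx (by
      rw [norm_one]
      exact zpow_lt_one_of_neg₀ (one_lt_cast_prime p) (by omega)))
    rw [norm_one] at hx1
    have hx0 : x ≠ 0 := norm_pos_iff.1 (by rw [hx1]; exact one_pos)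
    have : x⁻¹ - 1 = x⁻¹ * -(x - 1) := by field_simp; ring
    rw [this]
    exact PDvd.zero_mul (PDvd.zero_iff.2 (by rw [norm_inv, hx1, inv_one])) hx.neg
  refine and_congr_right fun hy => ?_
  constructor
  · intro h
    -- Division of v(y) by φ with remainder i; the witness p^q then gives p^i (p^q)^φ = p^v(y).
    obtain ⟨q, i, hi, hv⟩ : ∃ (q : ℤ) (i : ℕ), i < φ ∧ y.valuation = i + φ * q := by
      have hφ' : (0 : ℤ) < φ := by exact_mod_cast hφ
      refine ⟨y.valuation / φ, (y.valuation % φ).toNat, ?_, ?_⟩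
      · have := Int.emod_lt_of_pos y.valuation hφ'
        omega
      · rw [Int.toNat_of_nonneg (Int.emod_nonneg _ hφ'.ne')]
        exact (Int.emod_add_mul_ediv _ _).symm
    refine ⟨⟨i, hi⟩, (p : ℚ_[p]) ^ q, ?_⟩
    rw [key hy]
    have h1 : (p : ℚ_[p]) ^ i * ((p : ℚ_[p]) ^ q) ^ φ = (p : ℚ_[p]) ^ y.valuation := by
      rw [← zpow_natCast, ← zpow_natCast, ← zpow_mul, ← zpow_add₀ hp0, hv, mul_comm q]
    dsimp only
    rw [h1, ← inv_div]
    exact inv_close h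
  · rintro ⟨i, z, h⟩
    rw [key hy] at h
    have hz0 : z ≠ 0 := by
      rintro rfl
      rw [zero_pow hφ.ne', mul_zero, zero_div, zero_sub, PDvd, norm_neg, norm_one] at h
      exact absurd h (not_le.2 (zpow_lt_one_of_neg₀ (one_lt_cast_prime p) (by omega)))
    obtain ⟨u, hu⟩ : ∃ u : ℤ_[p]ˣ, z = u * (p : ℚ_[p]) ^ z.valuation := by
      have h1 : ‖z / (p : ℚ_[p]) ^ z.valuation‖ = 1 := by
        rw [norm_div, Padic.norm_eq_zpow_neg_valuation hz0, Padic.norm_p_zpow,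
          div_self (zpow_pos (cast_prime_pos p) _).ne']
      refine ⟨PadicInt.mkUnits h1, ?_⟩
      rw [PadicInt.mkUnits_eq, div_mul_cancel₀ _ (zpow_ne_zero _ hp0)]
    -- Euler's theorem for the unit part u of z.
    have hu1 : PDvd r ((u : ℚ_[p]) ^ φ - 1) := by
      have h1 : (PadicInt.toZModPow r) ((u : ℤ_[p]) ^ φ) = PadicInt.toZModPow r 1 := by
        have := ZMod.pow_totient (Units.map (PadicInt.toZModPow (p := p) r).toMonoidHom u)
        have h2 := congrArg Units.val this
        rw [map_pow, map_one]
        exact h2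
      rw [toZModPow_eq_iff, PadicInt.norm_def] at h1
      push_cast at h1
      exact h1
    have hx : (p : ℚ_[p]) ^ (i : ℕ) * z ^ φ =
        (u : ℚ_[p]) ^ φ * (p : ℚ_[p]) ^ (i + φ * z.valuation) := by
      rw [zpow_add₀ hp0, mul_comm (φ : ℤ), zpow_mul, zpow_natCast, zpow_natCast]
      conv_lhs => rw [hu]
      ring
    have hun : ‖((u : ℤ_[p]) : ℚ_[p])‖ = 1 := PadicInt.norm_units u
    have hxn : ‖(p : ℚ_[p]) ^ (i : ℕ) * z ^ φ‖ = ‖y‖ := by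
      have h2 : ‖(p : ℚ_[p]) ^ (i : ℕ) * z ^ φ / y‖ = ‖(1 : ℚ_[p])‖ :=
        Padic.norm_eq_of_norm_sub_lt_right (lt_of_le_of_lt h (by
          rw [norm_one]
          exact zpow_lt_one_of_neg₀ (one_lt_cast_prime p) (by omega)))
      rw [norm_div, norm_one, div_eq_one_iff_eq (norm_pos_iff.2 hy).ne'] at h2
      exact h2
    have hv : y.valuation = i + φ * z.valuation := by
      rw [hx, norm_mul, norm_pow, hun, one_pow, one_mul,
        Padic.norm_p_zpow] at hxn
      exact (norm_eq_zpow_iff.1 hxn.symm).2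
    have h3 := (inv_close h).mul_zero (PDvd.pow (PDvd.zero_iff.2 (u : ℤ_[p]).2) φ)
    have h4 := h3.add hu1
    convert h4 using 1
    rw [hx, ← hv]
    have := zpow_ne_zero y.valuation hp0
    field_simp
    ring

theorem isDef_leadingOne {r : ℕ} (hr : 0 < r) {f : (α → ℚ_[p]) → ℚ_[p]} [Finite α]
    (hf : IsDefFun f) : IsDef {v | f v ∈ leadingOne p r} := by
  have h : ∀ i : ℕ, IsDef {w : (α ⊕ Unit) → ℚ_[p] |
      ‖f (w ∘ Sum.inl) - p ^ i * w (Sum.inr ()) ^ (p ^ r).totient‖ ≤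
        ‖(p : ℚ_[p]) ^ r * f (w ∘ Sum.inl)‖} := fun i =>
    isDef_norm_le_norm ((hf.reindex Sum.inl).sub
      ((IsDefFun.const _).mul ((IsDefFun.proj _).pow _)))
      ((IsDefFun.const _).mul (hf.reindex Sum.inl))
  convert (hf.setOf_eq (IsDefFun.const 0)).compl.inter
    (IsDef.iUnion fun i : Fin (p ^ r).totient => (h i).exists_one) using 1
  ext v
  simp only [Set.mem_ofPred_eq, mem_leadingOne_iff hr, Set.mem_inter_iff, Set.mem_compl_iff,
    Set.mem_iUnion]
  rfl

end

/-! ### Dimension of images of monomial maps -/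

section Dimension

open MvPolynomial

variable {K : Type} [Field K]

/-- Incomparability: along an integral homomorphism, strict inclusions of primes stay strict under
contraction. -/
theorem ringKrullDim_le_of_isIntegral {A B : Type*} [CommRing A] [CommRing B] (f : A →+* B)
    (hf : f.IsIntegral) : ringKrullDim B ≤ ringKrullDim A := by
  algebraize [f]
  refine Order.krullDim_le_of_strictMono (PrimeSpectrum.comap f) fun P Q hPQ => ?_
  exact Ideal.IsIntegral.comap_lt_comap (R := A) hPQ

/-- By Noether normalization the quotient is integral over a polynomial ring in s variables. This
ring embeds into B through the quotient, so s is at most the transcendence degree of B. -/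
theorem ringKrullDim_quotient_le_trdeg {n d : ℕ} {B : Type} [CommRing B] [IsDomain B] [Algebra K B]
    (hB : Algebra.trdeg K B ≤ d) (φ : MvPolynomial (Fin n) K →ₐ[K] B) :
    ringKrullDim (MvPolynomial (Fin n) K ⧸ RingHom.ker φ) ≤ d := by
  obtain ⟨s, -, g, hg, hint⟩ := exists_integral_inj_algHom_of_quotient (RingHom.ker φ)
    (RingHom.ker_ne_top _)
  have h1 : Algebra.trdeg K (MvPolynomial (Fin s) K) ≤ Algebra.trdeg K B :=
    trdeg_le_of_injective ((Ideal.kerLiftAlg φ).comp g)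
      ((Ideal.kerLiftAlg_injective φ).comp hg)
  rw [MvPolynomial.trdeg_of_isDomain] at h1
  have h2 : s ≤ d := by
    have := h1.trans hB
    simpa using this
  refine (ringKrullDim_le_of_isIntegral g.toRingHom hint).trans ?_
  rw [MvPolynomial.ringKrullDim_of_isNoetherianRing, ringKrullDim_eq_zero_of_field, zero_add]
  simpa using h2

/-- The smallest prime of a chain over I contains a finite intersection of ideals P i, hence one of
them, and then the whole chain lies over that P i. -/
theorem ringKrullDim_quotient_le_of_iInf_le {R ι : Type*} [CommRing R] [Finite ι] {P : ι → Ideal R}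
    [∀ i, (P i).IsPrime] {I : Ideal R} (hI : ⨅ i, P i ≤ I) {d : WithBot ℕ∞}
    (hP : ∀ i, ringKrullDim (R ⧸ P i) ≤ d) : ringKrullDim (R ⧸ I) ≤ d := by
  cases nonempty_fintype ι
  rw [ringKrullDim_quotient]
  refine iSup_le fun s => ?_
  have hs : ⨅ i, P i ≤ (s.head : PrimeSpectrum R).asIdeal := hI.trans s.head.2
  obtain ⟨i, hi⟩ : ∃ i, P i ≤ (s.head : PrimeSpectrum R).asIdeal := by
    rw [← Finset.inf_univ_eq_iInf, Ideal.IsPrime.inf_le' inferInstance] at hs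
    obtain ⟨i, -, hi⟩ := hs
    exact ⟨i, hi⟩
  refine le_trans ?_ (hP i)
  rw [ringKrullDim_quotient]
  let s' : LTSeries (PrimeSpectrum.zeroLocus (R := R) (P i)) :=
    { length := s.length
      toFun := fun k => ⟨(s k).1, hi.trans (s.monotone (Fin.zero_le k))⟩
      step := fun k => s.step k }
  exact le_iSup (fun s : LTSeries _ => (s.length : WithBot ℕ∞)) s'

/-- The ring of Laurent polynomials in `d` variables. -/
abbrev LaurentRing (K : Type) [Field K] (d : ℕ) : Type :=
  Localization.Away (∏ j : Fin d, (X j : MvPolynomial (Fin d) K))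

theorem prod_X_ne_zero (d : ℕ) : ∏ j : Fin d, (X j : MvPolynomial (Fin d) K) ≠ 0 :=
  Finset.prod_ne_zero_iff.2 fun _ _ => X_ne_zero _

instance (d : ℕ) : IsDomain (LaurentRing K d) :=
  IsLocalization.isDomain_localization (powers_le_nonZeroDivisors_of_noZeroDivisors
    (prod_X_ne_zero d))

/-- A localization of a domain is algebraic over it. -/
theorem trdeg_laurentRing (d : ℕ) : Algebra.trdeg K (LaurentRing K d) ≤ d := by
  have hle : Submonoid.powers (∏ j : Fin d, (X j : MvPolynomial (Fin d) K)) ≤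
      nonZeroDivisors _ := powers_le_nonZeroDivisors_of_noZeroDivisors (prod_X_ne_zero d)
  have hinj := IsLocalization.injective (LaurentRing K d) hle
  have : FaithfulSMul (MvPolynomial (Fin d) K) (LaurentRing K d) :=
    (faithfulSMul_iff_algebraMap_injective _ _).2 hinj
  have h := trdeg_add_eq K (MvPolynomial (Fin d) K) (A := LaurentRing K d)
  have : Algebra.IsAlgebraic (MvPolynomial (Fin d) K) (LaurentRing K d) :=
    IsLocalization.isAlgebraic _ (Submonoid.powers (∏ j : Fin d, (X j : MvPolynomial (Fin d) K)))
  rw [trdeg_eq_zero_iff.2 this, add_zero, MvPolynomial.trdeg_of_isDomain] at h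
  rw [← h]
  simp

theorem isUnit_laurentX {d : ℕ} (j : Fin d) :
    IsUnit (algebraMap (MvPolynomial (Fin d) K) (LaurentRing K d) (X j)) :=
  isUnit_of_dvd_unit (map_dvd _ (Finset.dvd_prod_of_mem _ (Finset.mem_univ j)))
    (IsLocalization.Away.algebraMap_isUnit (S := LaurentRing K d)
      (∏ j : Fin d, (X j : MvPolynomial (Fin d) K)))

/-- The homomorphism of rings of functions given by a monomial map from a torus. -/
noncomputable def monomialHom {n d : ℕ} (c : Fin n → K) (e : Fin n → Fin d → ℤ) :
    MvPolynomial (Fin n) K →ₐ[K] LaurentRing K d :=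
  aeval fun i => algebraMap K (LaurentRing K d) (c i) *
    ((∏ j, (isUnit_laurentX (K := K) j).unit ^ e i j : (LaurentRing K d)ˣ) : LaurentRing K d)

/-- Since all σ i are non-zero, evaluation at σ extends to the Laurent ring, and evaluation at the
image point factors through `monomialHom`. -/
theorem aeval_eq_zero_of_mem_ker {n d : ℕ} (c : Fin n → K) (e : Fin n → Fin d → ℤ)
    {f : MvPolynomial (Fin n) K} (hf : f ∈ RingHom.ker (monomialHom c e)) {σ : Fin d → K}
    (hσ : ∀ i, σ i ≠ 0) : aeval (fun i => c i * ∏ j, σ j ^ e i j) f = 0 := by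
  have hu : IsUnit (aeval σ (∏ j : Fin d, (X j : MvPolynomial (Fin d) K))) := by
    rw [map_prod, isUnit_iff_ne_zero]
    simpa [Finset.prod_ne_zero_iff] using hσ
  let ev : LaurentRing K d →+* K := IsLocalization.Away.lift
    (∏ j : Fin d, (X j : MvPolynomial (Fin d) K)) (g := (aeval σ).toRingHom) hu
  have hev : ∀ f, ev (algebraMap (MvPolynomial (Fin d) K) (LaurentRing K d) f) = aeval σ f :=
    fun f => IsLocalization.Away.lift_eq _ hu f
  have hX : ∀ j, Units.map ev.toMonoidHom (isUnit_laurentX (K := K) j).unit =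
      Units.mk0 (σ j) (hσ j) := by
    intro j
    ext
    change ev (algebraMap _ _ (X j)) = σ j
    rw [hev, aeval_X]
  have hcomp : ev.comp (monomialHom c e).toRingHom =
      (aeval fun i => c i * ∏ j, σ j ^ e i j : MvPolynomial (Fin n) K →ₐ[K] K).toRingHom := by
    refine MvPolynomial.ringHom_ext (fun a => ?_) fun i => ?_
    · change ev (monomialHom c e (C a)) = aeval _ (C a)
      rw [← MvPolynomial.algebraMap_eq, AlgHom.commutes, AlgHom.commutes,
        IsScalarTower.algebraMap_apply K (MvPolynomial (Fin d) K) (LaurentRing K d), hev,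
        AlgHom.commutes]
    · change ev (monomialHom c e (X i)) = aeval _ (X i)
      rw [monomialHom, aeval_X, aeval_X, map_mul,
        IsScalarTower.algebraMap_apply K (MvPolynomial (Fin d) K) (LaurentRing K d), hev,
        AlgHom.commutes]
      congr 1
      have : ev ((∏ j, (isUnit_laurentX (K := K) j).unit ^ e i j : (LaurentRing K d)ˣ) :
          LaurentRing K d) = ((Units.map ev.toMonoidHom
            (∏ j, (isUnit_laurentX (K := K) j).unit ^ e i j) : Kˣ) : K) := rfl
      rw [this, map_prod]
      simp only [map_zpow, hX]
      simp
  have := RingHom.congr_fun hcomp f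
  change ev (monomialHom c e f) = aeval _ f at this
  rw [← this, RingHom.mem_ker.1 hf, map_zero]

end Dimension

/-! ### Monomial and tame functions, and the dimension of their images -/

section

variable {p : ℕ} [hp : Fact p.Prime] {α β : Type} [Fintype α] [Fintype β]

/-- Functions given by Laurent monomials with coefficients. -/
def IsMonomial (g : (α → ℚ_[p]) → ℚ_[p]) : Prop :=
  ∃ (c : ℚ_[p]) (e : α → ℤ), ∀ σ : α → ℚ_[p], (∀ i, σ i ≠ 0) → g σ = c * ∏ i, σ i ^ e i

namespace IsMonomial

variable {f g : (α → ℚ_[p]) → ℚ_[p]}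

theorem const (c : ℚ_[p]) : IsMonomial (fun _ : α → ℚ_[p] => c) := ⟨c, 0, by simp⟩

theorem mul (hf : IsMonomial f) (hg : IsMonomial g) : IsMonomial (fun σ => f σ * g σ) := by
  obtain ⟨c, e, h⟩ := hf
  obtain ⟨c', e', h'⟩ := hg
  refine ⟨c * c', e + e', fun σ hσ => ?_⟩
  simp only [Pi.add_apply, zpow_add₀ (hσ _), Finset.prod_mul_distrib, h σ hσ, h' σ hσ]
  ring

theorem proj_zpow (i : α) (n : ℤ) : IsMonomial (fun σ : α → ℚ_[p] => σ i ^ n) := by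
  classical
  refine ⟨1, Pi.single i n, fun σ _ => ?_⟩
  rw [one_mul, Finset.prod_eq_single i]
  · simp
  · intro j _ hj
    simp [Pi.single_eq_of_ne hj]
  · simp

theorem prod {ι : Type*} (s : Finset ι) {f : ι → (α → ℚ_[p]) → ℚ_[p]}
    (hf : ∀ i, IsMonomial (f i)) : IsMonomial (fun σ => ∏ i ∈ s, f i σ) := by
  classical
  induction s using Finset.induction_on with
  | empty => simpa using const 1
  | insert a s ha ih =>
    simp only [Finset.prod_insert ha]
    exact (hf a).mul ih

theorem reindex (hf : IsMonomial f) (ψ : α → β) : IsMonomial (fun σ : β → ℚ_[p] => f (σ ∘ ψ)) := by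
  obtain ⟨c, e, h⟩ := hf
  obtain ⟨c', e', h'⟩ := (const c).mul
    (prod Finset.univ fun i => proj_zpow (p := p) (ψ i) (e i))
  exact ⟨c', e', fun σ hσ => (h _ fun i => hσ _).trans (h' σ hσ)⟩

end IsMonomial

/-- A polynomial in the kernels of all the finitely many monomial homomorphisms vanishes on X. Each
kernel is prime, and its quotient embeds into a Laurent ring of transcendence degree at most d. -/
theorem dim_le_of_monomial {n d : ℕ} {X : Set (Fin n → ℚ_[p])}
    {G : Set (Fin n → (Fin d → ℚ_[p]) → ℚ_[p])} (hG : G.Finite)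
    (hmon : ∀ g ∈ G, ∀ i, IsMonomial (g i))
    (hX : ∀ x ∈ X, ∃ g ∈ G, ∃ σ : Fin d → ℚ_[p], (∀ i, σ i ≠ 0) ∧ ∀ i, x i = g i σ) :
    dim p X ≤ d := by
  have : Finite G := hG
  choose c e h using fun (g : G) i => hmon g.1 g.2 i
  let P : G → Ideal (MvPolynomial (Fin n) (AlgebraicClosure ℚ_[p])) := fun g =>
    RingHom.ker (monomialHom (fun i => algebraMap ℚ_[p] (AlgebraicClosure ℚ_[p]) (c g i)) (e g))
  have hP : ∀ g, (P g).IsPrime := fun g => RingHom.ker_isPrime _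
  refine ringKrullDim_quotient_le_of_iInf_le (P := P) (fun f hf => ?_) fun g =>
    ringKrullDim_quotient_le_trdeg (trdeg_laurentRing d) _
  rw [MvPolynomial.mem_vanishingIdeal_iff]
  rintro _ ⟨x, hx, rfl⟩
  obtain ⟨g, hg, σ, hσ, hxσ⟩ := hX x hx
  have h1 := aeval_eq_zero_of_mem_ker _ _ ((Submodule.mem_iInf _).1 hf ⟨g, hg⟩)
    (σ := fun i => algebraMap ℚ_[p] (AlgebraicClosure ℚ_[p]) (σ i))
    fun i => by simpa using hσ i
  convert h1 using 3
  funext i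
  dsimp only
  rw [hxσ, show g i σ = _ from h ⟨g, hg⟩ i σ hσ]
  simp

/-- Definable functions which on the torus are piecewise given by finitely many Laurent
monomials. -/
def IsTame (f : (α → ℚ_[p]) → ℚ_[p]) : Prop :=
  IsDefFun f ∧ ∃ G : Set ((α → ℚ_[p]) → ℚ_[p]), G.Finite ∧ (∀ g ∈ G, IsMonomial g) ∧
    ∀ σ, (∀ i, σ i ≠ 0) → ∃ g ∈ G, f σ = g σ

namespace IsTame

variable {f g : (α → ℚ_[p]) → ℚ_[p]}

theorem of_isMonomial (hf : IsDefFun f) (h : IsMonomial f) : IsTame f :=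
  ⟨hf, {f}, Set.finite_singleton f, by simpa using h, by simp⟩

theorem const (c : ℚ_[p]) : IsTame (fun _ : α → ℚ_[p] => c) :=
  of_isMonomial (IsDefFun.const c) (IsMonomial.const c)

theorem proj (i : α) : IsTame (fun σ : α → ℚ_[p] => σ i) :=
  of_isMonomial (IsDefFun.proj i) (by simpa using IsMonomial.proj_zpow (p := p) i 1)

theorem monomial (c : ℚ_[p]) (e : α → ℤ) : IsTame (fun σ : α → ℚ_[p] => c * ∏ i, σ i ^ e i) :=
  of_isMonomial ((IsDefFun.const c).mul (IsDefFun.prod _ fun i => (IsDefFun.proj i).zpow _))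
    ⟨c, e, fun _ _ => rfl⟩

theorem mul (hf : IsTame f) (hg : IsTame g) : IsTame (fun σ => f σ * g σ) := by
  obtain ⟨hf, G, hG, hGm, h⟩ := hf
  obtain ⟨hg, G', hG', hGm', h'⟩ := hg
  refine ⟨hf.mul hg, Set.image2 (fun f g σ => f σ * g σ) G G', hG.image2 _ hG', ?_, ?_⟩
  · rintro _ ⟨a, ha, b, hb, rfl⟩
    exact (hGm a ha).mul (hGm' b hb)
  · intro σ hσ
    obtain ⟨a, ha, ha'⟩ := h σ hσ
    obtain ⟨b, hb, hb'⟩ := h' σ hσ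
    exact ⟨_, ⟨a, ha, b, hb, rfl⟩, by simp only [ha', hb']⟩

theorem pow (hf : IsTame f) (n : ℕ) : IsTame (fun σ => f σ ^ n) := by
  induction n with
  | zero => simpa using const (p := p) (α := α) 1
  | succ n ih =>
    simp only [pow_succ]
    exact ih.mul hf

theorem reindex (hf : IsTame f) (ψ : α → β) : IsTame (fun σ : β → ℚ_[p] => f (σ ∘ ψ)) := by
  obtain ⟨hf, G, hG, hGm, h⟩ := hf
  refine ⟨hf.reindex ψ, (fun g σ => g (σ ∘ ψ)) '' G, hG.image _, ?_, ?_⟩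
  · rintro _ ⟨a, ha, rfl⟩
    exact (hGm a ha).reindex ψ
  · intro σ hσ
    obtain ⟨a, ha, ha'⟩ := h (σ ∘ ψ) fun i => hσ _
    exact ⟨_, ⟨a, ha, rfl⟩, ha'⟩

theorem ite {P : (α → ℚ_[p]) → Prop} [DecidablePred P] (hP : IsDef {v | P v}) (hf : IsTame f)
    (hg : IsTame g) : IsTame (fun v => if P v then f v else g v) := by
  obtain ⟨hf, G, hG, hGm, h⟩ := hf
  obtain ⟨hg, G', hG', hGm', h'⟩ := hg
  refine ⟨hf.ite hP hg, G ∪ G', hG.union hG', ?_, ?_⟩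
  · rintro a (ha | ha)
    · exact hGm a ha
    · exact hGm' a ha
  · intro σ hσ
    dsimp only
    split_ifs
    · obtain ⟨a, ha, ha'⟩ := h σ hσ
      exact ⟨a, Or.inl ha, ha'⟩
    · obtain ⟨a, ha, ha'⟩ := h' σ hσ
      exact ⟨a, Or.inr ha, ha'⟩

end IsTame

end

/-! ### Nodes of the tree described by a skeleton -/

namespace Skeleton

open RTree

variable {m : ℕ} {M : Set (Fin m → ℤ)} (S : Skeleton M) {κ : Fin m → ℤ}

theorem pathLength_mono {u v : S.shape.Node} (h : S.shape.IsAnc u v) (κ : Fin m → ℤ) :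
    S.pathLength u κ ≤ S.pathLength v κ := by
  induction hn : S.shape.depth v generalizing v with
  | zero =>
    have := h.1
    rw [S.shape.root_unique (a := u) (b := v) (by omega) hn]
  | succ n ih =>
    have hc := child_parent (T := S.shape) (x := v) (by omega)
    have hd := S.shape.depth_child hc
    rcases h.eq_or_of_child hc with rfl | h'
    · exact le_rfl
    · have := ih h' (by omega)
      have h2 := S.pathLength_child hc κ
      omega

theorem not_virtual_of_child {u v : S.shape.Node} (h : S.shape.Child u v) : ¬ S.Virtual u :=
  fun hu => S.virtual_leaf u hu v h

theorem not_virtual_parent {v : S.shape.Node} (h : 0 < S.shape.depth v) :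
    ¬ S.Virtual (S.shape.parent v) := S.not_virtual_of_child (child_parent h)

variable {S}

theorem IsNode.parent_lt {s : S.shape.Node} {k : ℕ} (h : S.IsNode κ (s, k))
    (h0 : 0 < S.shape.depth s) : S.pathLength (S.shape.parent s) κ < k := by
  rcases h with ⟨h, -⟩ | ⟨u, hu, h, -⟩
  · dsimp only at h
    omega
  · rw [S.jointDepth_parent hu] at h
    rw [parent_eq hu]
    exact_mod_cast h

theorem IsNode.le {s : S.shape.Node} {k : ℕ} (h : S.IsNode κ (s, k)) (hs : ¬ S.Virtual s) :
    k ≤ S.pathLength s κ := by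
  rcases h with ⟨-, h⟩ | ⟨u, hu, -, h⟩
  · dsimp only at h
    omega
  · dsimp only at h
    rw [jointDepth, if_neg hs] at h
    exact_mod_cast h

theorem isNode_of_lt {s : S.shape.Node} {k : ℕ} (h0 : 0 < S.shape.depth s)
    (h1 : S.pathLength (S.shape.parent s) κ < k) (h2 : (k : ℕ∞) ≤ S.jointDepth s κ) :
    S.IsNode κ (s, k) := by
  refine Or.inr ⟨_, child_parent h0, ?_, h2⟩
  rw [S.jointDepth_parent (child_parent h0)]
  exact_mod_cast h1

theorem isNode_pathLength {s : S.shape.Node} (hs : ¬ S.Virtual s) :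
    S.IsNode κ (s, S.pathLength s κ) :=
  S.isNode_joint (by rw [jointDepth, if_neg hs])

/-- This makes the coordinates of all joints beyond the bone at depth k vanish modulo p^k. -/
theorem IsNode.le_parent {s b : S.shape.Node} {k : ℕ} (h : S.IsNode κ (s, k))
    (hlt : S.shape.depth s < S.shape.depth b) (hsb : S.shape.IsAnc s b) :
    k ≤ S.pathLength (S.shape.parent b) κ := by
  have hc := child_parent (T := S.shape) (x := b) (by omega)
  rcases hsb.eq_or_of_child hc with rfl | h'
  · omega
  · refine (h.le fun hs => ?_).trans (S.pathLength_mono h' κ)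
    have := hsb.eq_of_isLeaf (S.virtual_leaf s hs)
    subst this
    omega

/-- The bones on the way to v cover disjoint ranges of depths. -/
theorem IsNode.eq_of_isAnc {s s' v : S.shape.Node} {k : ℕ} (h : S.IsNode κ (s, k))
    (h' : S.IsNode κ (s', k)) (hs : S.shape.IsAnc s v) (hs' : S.shape.IsAnc s' v) : s = s' := by
  have key : ∀ {s s' : S.shape.Node}, S.IsNode κ (s, k) → S.IsNode κ (s', k) →
      S.shape.IsAnc s v → S.shape.IsAnc s' v → ¬ S.shape.depth s < S.shape.depth s' := by
    intro s s' h h' hs hs' hlt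
    have h1 := h.le_parent hlt (hs.of_le hs' hlt.le)
    have h2 := h'.parent_lt (by omega)
    omega
  have h1 := key h h' hs hs'
  have h2 := key h' h hs' hs
  exact hs.eq_of_depth_eq hs' (by omega)

theorem isAnc_joint_anc {y : (S.tree κ).Node} {k : ℕ} (hk : k ≤ (S.tree κ).depth y) :
    S.shape.IsAnc ((S.tree κ).anc y k).1.1 y.1.1 := by
  refine Nat.decreasingInduction' (P := fun k => S.shape.IsAnc ((S.tree κ).anc y k).1.1 y.1.1)
    (fun j hj _ ih => ?_) hk (by rw [anc_self]; exact isAnc_refl _)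
  obtain ⟨-, h | ⟨h, -⟩⟩ := child_anc y (k := j) hj
  · rw [h]
    exact ih
  · exact (isAnc_child h).trans ih

theorem isLeaf_tree {v : S.shape.Node} (hv : S.shape.IsLeaf v) (hv' : ¬ S.Virtual v)
    (h : S.IsNode κ (v, S.pathLength v κ)) : (S.tree κ).IsLeaf ⟨_, h⟩ := by
  rintro ⟨⟨s, k⟩, hs⟩ ⟨h1, h2 | ⟨h2, -⟩⟩
  · dsimp only at h1 h2
    subst h2
    have := hs.le hv'
    omega
  · exact hv _ h2

end Skeleton

/-! ### Families of points -/

section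

variable {p : ℕ} [hp : Fact p.Prime] {m d : ℕ} {ι : Type}

/-- The points `w` of the torus for which `κ = c + r! v(w)`. -/
def fiber (p r : ℕ) [Fact p.Prime] {m : ℕ} (c κ : Fin m → ℤ) : Set (Fin m → ℚ_[p]) :=
  {w | ∀ i, w i ≠ 0 ∧ κ i = c i + (r.factorial : ℤ) * (w i).valuation}

/-- The relation `|w i - w' i| ≤ p ^ (r - k) |w i|`, for all `i`. -/
def Near (p r k : ℕ) [Fact p.Prime] {m : ℕ} (w w' : Fin m → ℚ_[p]) : Prop :=
  ∀ i, RelClose ((p : ℝ) ^ ((r : ℤ) - k)) (w i) (w' i)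

theorem Near.mono {r k l : ℕ} {w w' : Fin m → ℚ_[p]} (h : Near p r k w w') (hl : l ≤ k) :
    Near p r l w w' := fun i => by
  obtain ⟨h1, h2, h3⟩ := h i
  refine ⟨h1, h2, h3.trans (mul_le_mul_of_nonneg_right ?_ (norm_nonneg _))⟩
  exact zpow_le_zpow_right₀ (one_lt_cast_prime p).le (by omega)

theorem Near.refl {r k : ℕ} {c κ : Fin m → ℤ} {w : Fin m → ℚ_[p]} (hw : w ∈ fiber p r c κ) :
    Near p r k w w := fun i => RelClose.refl (zpow_pos (cast_prime_pos p) _).le (hw i).1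

/-- A finite family of definable sets in an `(m + d)`-dimensional torus, with tame maps to a space
`ℚ_p ^ ι`, almost all coordinates of which are zero. -/
structure Family (p m d : ℕ) [Fact p.Prime] (ι : Type) where
  Piece : Type
  finite : Finite Piece
  dom : Piece → Set (Fin m ⊕ Fin d → ℚ_[p])
  isDef_dom : ∀ P, IsDef (dom P)
  ne_zero : ∀ {P σ}, σ ∈ dom P → ∀ i, σ i ≠ 0
  val : Piece → ι → (Fin m ⊕ Fin d → ℚ_[p]) → ℚ_[p]
  isTame_val : ∀ P i, IsTame (val P i)
  support_finite : {i | ∃ P, val P i ≠ fun _ => 0}.Finite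

namespace Family

/-- The points of a family over `fiber p r c κ`. -/
structure Pt (𝓕 : Family p m d ι) (r : ℕ) (c κ : Fin m → ℤ) where
  piece : 𝓕.Piece
  coord : Fin m ⊕ Fin d → ℚ_[p]
  mem : coord ∈ 𝓕.dom piece
  base_mem : (fun i => coord (Sum.inl i)) ∈ fiber p r c κ

variable {𝓕 : Family p m d ι} {r : ℕ} {c κ : Fin m → ℤ}

/-- The point of `fiber p r c κ` below a point of a family. -/
def Pt.base (a : 𝓕.Pt r c κ) : Fin m → ℚ_[p] := fun i => a.coord (Sum.inl i)

/-- The point of `ℚ_p ^ ι` given by a point of a family. -/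
def Pt.value (a : 𝓕.Pt r c κ) (i : ι) : ℚ_[p] := 𝓕.val a.piece i a.coord

variable (𝓕 r c κ) in
/-- The images in `ℚ_p ^ ι` of the points of `𝓕` over `fiber p r c κ` lie in `ℤ_p ^ ι` and present
the tree `T`. -/
def Presents (T : RTree) : Prop :=
  (∀ (a : 𝓕.Pt r c κ) i, PDvd 0 (a.value i)) ∧
    T.IsPresented (fun a : 𝓕.Pt r c κ => a.base) (fiber p r c κ)
      (fun k a b => Near p r k a.base b.base) (fun k a b => ∀ i, PDvd k (a.value i - b.value i))

/-- Reindexing the coordinates of a family. -/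
def reindex (𝓕 : Family p m d ι) {ι' : Type} (e : ι' ≃ ι) : Family p m d ι' where
  Piece := 𝓕.Piece
  finite := 𝓕.finite
  dom := 𝓕.dom
  isDef_dom := 𝓕.isDef_dom
  ne_zero := 𝓕.ne_zero
  val P i := 𝓕.val P (e i)
  isTame_val P i := 𝓕.isTame_val P (e i)
  support_finite := Set.Finite.preimage (f := e) e.injective.injOn 𝓕.support_finite

theorem Presents.reindex {T : RTree} (h : 𝓕.Presents r c κ T) {ι' : Type} (e : ι' ≃ ι) :
    (𝓕.reindex e).Presents r c κ T := by
  let g : 𝓕.Pt r c κ → (𝓕.reindex e).Pt r c κ := fun a => ⟨a.piece, a.coord, a.mem, a.base_mem⟩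
  have hg : Function.Surjective g := fun a => ⟨⟨a.piece, a.coord, a.mem, a.base_mem⟩, rfl⟩
  refine ⟨fun a i => h.1 ⟨a.piece, a.coord, a.mem, a.base_mem⟩ (e i), ?_⟩
  refine RTree.IsPresented.of_surjective g hg (fun a => rfl) (fun k a b h => h)
    (fun k a b => ?_) (fun k a => Near.refl a.base_mem) (fun k a i => ?_) h.2
  · exact e.forall_congr_left (p := fun i => PDvd k ((g a).value i - (g b).value i)) |>.trans
      (by simp [g, Pt.value, Family.reindex])
  · rw [sub_self]
    exact PDvd.zero _

/-- The family without points. -/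
def empty : Family p m d ι where
  Piece := Empty
  finite := inferInstance
  dom := Empty.elim
  isDef_dom := fun P => P.elim
  ne_zero := fun {P} => P.elim
  val := Empty.elim
  isTame_val := fun P => P.elim
  support_finite := by simp

end Family

/-! ### The valuations of the joints -/

/-- A relative error p^(r-k) in a quantity of valuation D is harmless modulo p^k only if D ≥ r. For
each of the finitely many smaller D, the function is replaced by the constant p^D, which has no
error; the case distinction is definable. -/
theorem exists_tame_normalization {α : Type} [Fintype α] {t : (α → ℚ_[p]) → ℚ_[p]} (ht : IsTame t)
    (n : ℕ) : ∃ τ : (α → ℚ_[p]) → ℚ_[p], IsTame τ ∧ ∀ w,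
      (τ w = t w ∧ ∀ D < n, ‖t w‖ ≠ ‖(p : ℚ_[p]) ^ D‖) ∨
        ∃ D < n, ‖t w‖ = ‖(p : ℚ_[p]) ^ D‖ ∧ τ w = (p : ℚ_[p]) ^ D := by
  classical
  induction n with
  | zero => exact ⟨t, ht, fun w => Or.inl ⟨rfl, fun D hD => absurd hD (Nat.not_lt_zero D)⟩⟩
  | succ n ih =>
    obtain ⟨τ, hτ, h⟩ := ih
    refine ⟨_, (IsTame.const ((p : ℚ_[p]) ^ n)).ite (isDef_norm_eq_norm ht.1
      (IsDefFun.const ((p : ℚ_[p]) ^ n))) hτ, fun w => ?_⟩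
    split_ifs with hw
    · exact Or.inr ⟨n, n.lt_succ_self, hw, rfl⟩
    · rcases h w with ⟨h1, h2⟩ | ⟨D, hD, h1, h2⟩
      · refine Or.inl ⟨h1, fun D hD => ?_⟩
        rcases Nat.lt_succ_iff_lt_or_eq.1 hD with hD | rfl
        · exact h2 D hD
        · exact hw
      · exact Or.inr ⟨D, by omega, h1, h2⟩

theorem Skeleton.exists_linear_pathLength {M : Set (Fin m → ℤ)} (S : Skeleton M)
    {v : S.shape.Node} (hv : ¬ S.Virtual v) : ∃ (a : Fin m → ℚ) (b : ℚ), ∀ κ ∈ M,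
      (S.pathLength v κ : ℚ) = ∑ i, a i * (κ i : ℚ) + b := by
  induction hn : S.shape.depth v generalizing v with
  | zero => exact ⟨0, 0, fun κ _ => by simp [S.pathLength_root hn]⟩
  | succ n ih =>
    have hc := RTree.child_parent (T := S.shape) (x := v) (by omega)
    have hd := S.shape.depth_child hc
    obtain ⟨a, b, h⟩ := ih (S.not_virtual_of_child hc) (by omega)
    obtain ⟨a', b', h'⟩ := S.linear v (by omega) hv
    refine ⟨a + a', b + b', fun κ hκ => ?_⟩
    rw [S.pathLength_child hc, Nat.cast_add, h κ hκ, h' κ hκ]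
    simp only [Pi.add_apply, add_mul, Finset.sum_add_distrib]
    ring

theorem prod_zpow_eq_zpow_sum {α : Type*} {x : ℝ} (hx : x ≠ 0) (s : Finset α) (f : α → ℤ) :
    ∏ i ∈ s, x ^ f i = x ^ ∑ i ∈ s, f i := by
  classical
  induction s using Finset.induction_on with
  | empty => simp
  | insert a s ha ih => rw [Finset.prod_insert ha, Finset.sum_insert ha, zpow_add₀ hx, ih]

/-- A monomial whose valuation is the value of a given linear function. -/
theorem exists_monomial_of_linear (a : Fin m → ℚ) (b : ℚ) : ∀ᶠ r : ℕ in Filter.atTop,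
    ∀ c : Fin m → ℤ, ∃ (B : ℤ) (A : Fin m → ℤ), ∀ κ : Fin m → ℤ, ∀ D : ℕ,
      (D : ℚ) = ∑ i, a i * (κ i : ℚ) + b → ∀ w ∈ fiber p r c κ,
        ‖(p : ℚ_[p]) ^ B * ∏ i, w i ^ A i‖ = (p : ℝ) ^ (-(D : ℤ)) := by
  -- Then every denominator divides r!, and the exponents a_i r! are integers.
  have hev : ∀ᶠ r : ℕ in Filter.atTop, ∀ i, (a i).den ≤ r :=
    Filter.eventually_all.2 fun i => Filter.eventually_ge_atTop _
  filter_upwards [hev] with r hr c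
  have hA : ∀ i, ∃ A : ℤ, (A : ℚ) = a i * (r.factorial : ℚ) := by
    intro i
    obtain ⟨q, hq⟩ := Nat.dvd_factorial (a i).den_pos (hr i)
    refine ⟨(a i).num * q, ?_⟩
    rw [hq]
    push_cast
    rw [← mul_assoc, Rat.mul_den_eq_num]
  choose A hA using hA
  refine ⟨⌊b + ∑ i, a i * (c i : ℚ)⌋, A, fun κ D hD w hw => ?_⟩
  -- As soon as there is a point over c at all, the constant term is an integer; the floor only
  -- provides a value in the other case.
  have hB : ((D - ∑ i, A i * (w i).valuation : ℤ) : ℚ) = b + ∑ i, a i * (c i : ℚ) := by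
    push_cast
    rw [hD]
    have : ∀ i, a i * (κ i : ℚ) = a i * (c i : ℚ) + (A i : ℚ) * ((w i).valuation : ℚ) := by
      intro i
      rw [hA, (hw i).2]
      push_cast
      ring
    simp only [this, Finset.sum_add_distrib]
    ring
  rw [← hB, Int.floor_intCast, norm_mul, norm_prod, norm_zpow, Padic.norm_p]
  have hi : ∀ i, ‖w i ^ A i‖ = (p : ℝ) ^ (-(A i * (w i).valuation)) := by
    intro i
    rw [norm_zpow, Padic.norm_eq_zpow_neg_valuation (hw i).1, ← zpow_mul]
    congr 1
    ring
  have hprod : ∏ i, ‖w i ^ A i‖ = (p : ℝ) ^ (-∑ i, A i * (w i).valuation) := by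
    simp only [hi]
    rw [← Finset.sum_neg_distrib, prod_zpow_eq_zpow_sum (cast_prime_pos p).ne']
  rw [hprod, inv_zpow', ← zpow_add₀ (cast_prime_pos p).ne']
  congr 1
  ring

/-- Tame functions whose valuations are the depths of a joint of a skeleton, compatible with
approximations. -/
theorem Skeleton.exists_scale {M : Set (Fin m → ℤ)} (S : Skeleton M) {v : S.shape.Node}
    (hv : ¬ S.Virtual v) : ∀ᶠ r : ℕ in Filter.atTop, ∀ c : Fin m → ℤ,
      ∃ τ : (Fin m → ℚ_[p]) → ℚ_[p], IsTame τ ∧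
        (∀ κ ∈ M, ∀ w ∈ fiber p r c κ, ‖τ w‖ = (p : ℝ) ^ (-(S.pathLength v κ : ℤ))) ∧
        ∀ κ ∈ M, ∀ w ∈ fiber p r c κ, ∀ w' ∈ fiber p r c κ, ∀ k, Near p r k w w' →
          PDvd k (τ w - τ w') := by
  obtain ⟨a, b, hab⟩ := S.exists_linear_pathLength hv
  filter_upwards [exists_monomial_of_linear (p := p) a b] with r hr c
  obtain ⟨B, A, h⟩ := hr c
  obtain ⟨τ, hτ, h'⟩ := exists_tame_normalization
    (IsTame.monomial (p := p) ((p : ℚ_[p]) ^ B) A) r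
  have hn : ∀ κ ∈ M, ∀ w ∈ fiber p r c κ,
      ‖(p : ℚ_[p]) ^ B * ∏ i, w i ^ A i‖ = (p : ℝ) ^ (-(S.pathLength v κ : ℤ)) :=
    fun κ hκ w hw => h κ _ (hab κ hκ) w hw
  -- The threshold of the normalization is r itself, matching the loss p^r in `Near`.
  have hD : ∀ κ ∈ M, ∀ w ∈ fiber p r c κ,
      (τ w = (p : ℚ_[p]) ^ B * ∏ i, w i ^ A i ∧ r ≤ S.pathLength v κ) ∨
        τ w = (p : ℚ_[p]) ^ S.pathLength v κ ∧ S.pathLength v κ < r := by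
    intro κ hκ w hw
    rcases h' w with ⟨h1, h2⟩ | ⟨D, hD, h1, h2⟩
    · refine Or.inl ⟨h1, ?_⟩
      by_contra hlt
      exact h2 (S.pathLength v κ) (by omega) (by rw [hn κ hκ w hw, norm_prime_pow])
    · rw [hn κ hκ w hw, norm_prime_pow] at h1
      have := zpow_right_injective₀ (cast_prime_pos p) (one_lt_cast_prime p).ne' h1
      have hDe : D = S.pathLength v κ := by omega
      subst hDe
      exact Or.inr ⟨h2, hD⟩
  refine ⟨τ, hτ, fun κ hκ w hw => ?_, fun κ hκ w hw w' hw' k hk => ?_⟩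
  · rcases hD κ hκ w hw with ⟨h1, -⟩ | ⟨h1, -⟩
    · rw [h1, hn κ hκ w hw]
    · rw [h1, norm_prime_pow]
  · rcases hD κ hκ w hw with ⟨h1, h2⟩ | ⟨h1, h2⟩ <;>
      rcases hD κ hκ w' hw' with ⟨h3, h4⟩ | ⟨h3, h4⟩
    · have hδ : (0 : ℝ) ≤ (p : ℝ) ^ ((r : ℤ) - k) := (zpow_pos (cast_prime_pos p) _).le
      have hc := (RelClose.refl (p := p) hδ (x := (p : ℚ_[p]) ^ B) (by
        have : (p : ℚ_[p]) ≠ 0 := by exact_mod_cast hp.1.ne_zero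
        exact zpow_ne_zero _ this)).mul
        (RelClose.prod hδ Finset.univ fun i _ => (hk i).zpow hδ (A i))
      -- The absolute error is p^(r-k-D), at most p^(-k) because D ≥ r here.
      have h5 := hc.2.2
      rw [hn κ hκ w' hw', ← zpow_add₀ (cast_prime_pos p).ne'] at h5
      rw [h1, h3]
      exact h5.trans (zpow_le_zpow_right₀ (one_lt_cast_prime p).le (by omega))
    · omega
    · omega
    · rw [h1, h3, sub_self]
      exact PDvd.zero _

end

/-! ### Assembling a family along a skeleton -/

section

open RTree

variable {p : ℕ} [hp : Fact p.Prime] {m d r : ℕ} {M : Set (Fin m → ℤ)} {S : Skeleton M}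
  {c κ : Fin m → ℤ}

/-- The data for a family that presents a tree obtained from the tree of a skeleton by attaching
trees to its nodes: functions `τ v` with the valuations of the joints, and finitely many families,
each belonging to a joint, with functions `scale` whose valuations select the nodes. -/
structure Assembly (p d r : ℕ) [Fact p.Prime] {m : ℕ} {M : Set (Fin m → ℤ)} (S : Skeleton M)
    (c : Fin m → ℤ) where
  Ix : Type
  finite : Finite Ix
  joint : Ix → S.shape.Node
  fam : Ix → Family p m d ℕ
  scale : Ix → (Fin m ⊕ Fin d → ℚ_[p]) → ℚ_[p]
  isTame_scale : ∀ i, IsTame (scale i)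
  τ : S.shape.Node → (Fin m → ℚ_[p]) → ℚ_[p]
  isTame_τ : ∀ v, IsTame (τ v)
  norm_τ : ∀ v, ¬ S.Virtual v → ∀ κ ∈ M, ∀ w ∈ fiber p r c κ,
    ‖τ v w‖ = (p : ℝ) ^ (-(S.pathLength v κ : ℤ))
  τ_near : ∀ v, ¬ S.Virtual v → ∀ κ ∈ M, ∀ w ∈ fiber p r c κ, ∀ w' ∈ fiber p r c κ, ∀ k,
    Near p r k w w' → PDvd k (τ v w - τ v w')

namespace Assembly

variable (A : Assembly p d r S c)

/-- The index set of the pieces of the assembled family. -/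
abbrev Piece : Type := {v // S.Virtual v} ⊕ Σ i, (A.fam i).Piece

/-- The joint to which a piece of the assembled family belongs. -/
def jointOf : A.Piece → S.shape.Node := Sum.elim (fun v => v.1) fun x => A.joint x.1

/-- The scale of a piece of the assembled family. -/
noncomputable def scaleOf : A.Piece → (Fin m ⊕ Fin d → ℚ_[p]) → ℚ_[p] :=
  Sum.elim (fun _ _ => 0) fun x => A.scale x.1

/-- The unscaled coordinates of a piece of the assembled family. -/
noncomputable def innerOf : A.Piece → ℕ → (Fin m ⊕ Fin d → ℚ_[p]) → ℚ_[p] :=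
  Sum.elim (fun _ _ _ => 0) fun x => (A.fam x.1).val x.2

/-- The functions which give the positions of the joints. -/
noncomputable def offset (w : Fin m → ℚ_[p]) (v : S.shape.Node) : ℚ_[p] := A.τ (S.shape.parent v) w

theorem isTame_position (v b : S.shape.Node) : IsTame fun σ : Fin m ⊕ Fin d → ℚ_[p] =>
    position S.shape (A.offset fun i => σ (Sum.inl i)) v b := by
  unfold position
  split_ifs
  · exact (A.isTame_τ _).reindex Sum.inl
  · exact IsTame.const 0

/-- The assembled family. -/
noncomputable def family : Family p m d (S.shape.Node ⊕ Unit ⊕ ℕ) where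
  Piece := A.Piece
  finite := by
    have := S.finite
    have := A.finite
    have := fun i => (A.fam i).finite
    infer_instance
  -- At a virtual joint there is one path over each w, so the piece is the whole torus; its values
  -- depend on w only.
  dom := Sum.elim (fun _ => {σ | ∀ i, σ i ≠ 0}) fun x => (A.fam x.1).dom x.2
  isDef_dom := by
    rintro (v | x)
    · have : {σ : Fin m ⊕ Fin d → ℚ_[p] | ∀ i, σ i ≠ 0} = ⋂ i, {σ | σ i = 0}ᶜ := by
        ext σ
        simp
      rw [Sum.elim_inl, this]
      exact IsDef.iInter fun i => ((IsDefFun.proj i).setOf_eq (IsDefFun.const 0)).compl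
    · exact (A.fam x.1).isDef_dom x.2
  ne_zero := by
    rintro (v | x) σ h i
    · exact h i
    · exact (A.fam x.1).ne_zero h i
  -- The position selects the way through the skeleton, the valuation of the scale the node where it
  -- is left, and the factor in front of the inner coordinates shifts them by the depth of that
  -- node.
  val P := Sum.elim (fun b σ => position S.shape (A.offset fun i => σ (Sum.inl i)) (A.jointOf P) b)
    (Sum.elim (fun _ => A.scaleOf P) fun n σ => A.scaleOf P σ * A.innerOf P n σ)
  isTame_val := by
    have hs : ∀ P, IsTame (A.scaleOf P) := by
      rintro (v | x)
      · exact IsTame.const 0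
      · exact A.isTame_scale x.1
    rintro P (b | _ | n)
    · exact A.isTame_position _ b
    · exact hs P
    · refine (hs P).mul ?_
      rcases P with v | x
      · exact IsTame.const 0
      · exact (A.fam x.1).isTame_val x.2 n
  support_finite := by
    have := S.finite
    have := A.finite
    refine Set.Finite.subset (((Set.finite_range Sum.inl).union (Set.finite_range
      (fun _ : Unit => Sum.inr (Sum.inl ())))).union ((Set.finite_iUnion fun i =>
        (A.fam i).support_finite).image fun n => Sum.inr (Sum.inr n))) ?_
    rintro (b | _ | n) ⟨P, hP⟩
    · exact Or.inl (Or.inl ⟨b, rfl⟩)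
    · exact Or.inl (Or.inr ⟨(), rfl⟩)
    · refine Or.inr ⟨n, ?_, rfl⟩
      rcases P with v | x
      · exact absurd (funext fun σ => zero_mul _) hP
      · refine Set.mem_iUnion.2 ⟨x.1, x.2, fun h => hP (funext fun σ => ?_)⟩
        have := congrFun h σ
        change A.scale x.1 σ * (A.fam x.1).val x.2 n σ = 0
        rw [this, mul_zero]

/-- The conditions under which the assembled family presents the tree obtained from `S.tree κ` by
attaching the trees `B x`. -/
structure Fits (κ : Fin m → ℤ) (B : (S.tree κ).Node → RTree) : Prop where
  exists_node : ∀ i (a : (A.fam i).Pt r c κ), ∃ l : ℕ,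
    ‖A.scale i a.coord‖ = (p : ℝ) ^ (-(l : ℤ)) ∧ S.IsNode κ (A.joint i, l)
  integral : ∀ i (a : (A.fam i).Pt r c κ) n, PDvd 0 (a.value n)
  -- All points at x come from one family, so congruences beyond x are congruences within that
  -- family.
  presents : ∀ x : (S.tree κ).Node, ∃ i, A.joint i = x.1.1 ∧
    (∀ i' (a : (A.fam i').Pt r c κ), A.joint i' = x.1.1 →
      ‖A.scale i' a.coord‖ = (p : ℝ) ^ (-(x.1.2 : ℤ)) → i' = i) ∧
    (B x).IsPresented (fun a : {a : (A.fam i).Pt r c κ //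
        ‖A.scale i a.coord‖ = (p : ℝ) ^ (-(x.1.2 : ℤ))} => a.1.base) (fiber p r c κ)
      (fun k a b => Near p r (x.1.2 + k) a.1.base b.1.base)
      (fun k a b => PDvd ((x.1.2 + k : ℕ) : ℤ) (A.scale i a.1.coord - A.scale i b.1.coord) ∧
        ∀ n, PDvd k (a.1.value n - b.1.value n))

variable {A} {B : (S.tree κ).Node → RTree}

/-- A point of one of the given families as a point of the assembled family. -/
def ofPt (i : A.Ix) (a : (A.fam i).Pt r c κ) : A.family.Pt r c κ :=
  ⟨Sum.inr ⟨i, a.piece⟩, a.coord, a.mem, a.base_mem⟩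

/-- The point of the assembled family that belongs to a virtual joint. -/
noncomputable def ofVirtual (v : S.shape.Node) (hv : S.Virtual v) (w : Fin m → ℚ_[p])
    (hw : w ∈ fiber p r c κ) : A.family.Pt r c κ :=
  ⟨Sum.inl ⟨v, hv⟩, Sum.elim w fun _ => 1, by
    rintro (i | i)
    · exact (hw i).1
    · exact one_ne_zero, hw⟩

/-- The congruence modulo `p ^ k` of two points of the assembled family. -/
theorem cong_iff {k : ℕ} {a b : A.family.Pt r c κ} :
    (∀ i, PDvd (k : ℤ) (a.value i - b.value i)) ↔
      (∀ j, PDvd (k : ℤ) (position S.shape (A.offset a.base) (A.jointOf a.piece) j -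
        position S.shape (A.offset b.base) (A.jointOf b.piece) j)) ∧
      PDvd (k : ℤ) (A.scaleOf a.piece a.coord - A.scaleOf b.piece b.coord) ∧
      ∀ n, PDvd (k : ℤ) (A.scaleOf a.piece a.coord * A.innerOf a.piece n a.coord -
        A.scaleOf b.piece b.coord * A.innerOf b.piece n b.coord) := by
  rw [Sum.forall, Sum.forall]
  exact and_congr_right fun _ => and_congr_left fun _ => ⟨fun h => h (), fun h _ => h⟩

/-- Two nodes of equal depth on the paths to two joints agree if and only if the positions of these
joints are congruent. -/
theorem node_eq_iff (hκ : κ ∈ M) {k : ℕ} {s s' v v' : S.shape.Node} (hs : S.IsNode κ (s, k))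
    (hs' : S.IsNode κ (s', k)) (hv : S.shape.IsAnc s v) (hv' : S.shape.IsAnc s' v')
    {w w' : Fin m → ℚ_[p]} (hw : w ∈ fiber p r c κ) (hw' : w' ∈ fiber p r c κ)
    (hk : Near p r k w w') :
    s = s' ↔ ∀ j, PDvd (k : ℤ) (position S.shape (A.offset w) v j -
      position S.shape (A.offset w') v' j) := by
  have hn : ∀ b, 0 < S.shape.depth b → ‖A.offset w b‖ =
      (p : ℝ) ^ (-(S.pathLength (S.shape.parent b) κ : ℤ)) := fun b hb =>
    A.norm_τ _ (S.not_virtual_parent hb) κ hκ w hw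
  refine eq_iff_position_congr hv hv' (fun b hb => A.τ_near _ (S.not_virtual_parent hb) κ hκ w hw w'
    hw' k hk) ?_ ?_ ?_ ?_
  · intro h0
    rw [PDvd.iff_of_norm_eq (hn s h0)]
    have := hs.parent_lt h0
    omega
  · intro h0
    rw [PDvd.iff_of_norm_eq (hn s' h0)]
    have := hs'.parent_lt h0
    omega
  · intro b hlt hb
    rw [PDvd.iff_of_norm_eq (hn b (by omega))]
    exact_mod_cast hs.le_parent hlt hb
  · intro b hlt hb
    rw [PDvd.iff_of_norm_eq (hn b (by omega))]
    exact_mod_cast hs'.le_parent hlt hb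

/-- The location of a point is the node where its path leaves the skeleton; it is `none` for the
points of virtual joints, whose paths never leave. -/
theorem Fits.exists_loc (hF : A.Fits κ B) (a : A.family.Pt r c κ) :
    ∃ o : Option (S.tree κ).Node, (∀ x, o = some x → x.1.1 = A.jointOf a.piece ∧
      ‖A.scaleOf a.piece a.coord‖ = (p : ℝ) ^ (-(x.1.2 : ℤ))) ∧
      (o = none → S.Virtual (A.jointOf a.piece) ∧ A.scaleOf a.piece a.coord = 0) := by
  obtain ⟨P | ⟨i, P⟩, σ, h, h'⟩ := a
  · exact ⟨none, by simp, fun _ => ⟨P.2, rfl⟩⟩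
  · obtain ⟨l, hl, hl'⟩ := hF.exists_node i ⟨P, σ, h, h'⟩
    refine ⟨some ⟨_, hl'⟩, ?_, by simp⟩
    rintro _ ⟨⟩
    exact ⟨rfl, hl⟩

theorem exists_path (v : S.shape.Node) (o : Option (S.tree κ).Node)
    (ho : ∀ x, o = some x → x.1.1 = v) (hv : o = none → S.Virtual v) :
    ∃ q : ℕ → (S.tree κ).Node, (∀ k, (∀ x, o = some x → k ≤ x.1.2) →
        (q k).1.2 = k ∧ S.shape.IsAnc (q k).1.1 v) ∧
      (∀ k, (∀ x, o = some x → k + 1 ≤ x.1.2) → (S.tree κ).Child (q k) (q (k + 1))) ∧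
      (∀ x, o = some x → q x.1.2 = x) := by
  rcases o with _ | x
  · have hv' := hv rfl
    have h0 := S.virtual_pos v hv'
    -- These nodes run up the infinite bone of v, and `y k` is deeper than k; its ancestor of depth
    -- k is the required node, and successive choices are compatible.
    let y : ℕ → (S.tree κ).Node := fun k => ⟨(v, S.pathLength (S.shape.parent v) κ + 1 + k),
      Skeleton.isNode_of_lt h0 (by omega) (by rw [Skeleton.jointDepth, if_pos hv']; exact le_top)⟩
    have hy : ∀ k, (S.tree κ).Child (y k) (y (k + 1)) := fun k => ⟨rfl, Or.inl rfl⟩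
    have hyd : ∀ k, k < (S.tree κ).depth (y k) := fun k => by
      change k < S.pathLength (S.shape.parent v) κ + 1 + k
      omega
    refine ⟨fun k => (S.tree κ).anc (y k) k, fun k _ => ⟨depth_anc (y k) (hyd k).le,
      Skeleton.isAnc_joint_anc (y := y k) (hyd k).le⟩, fun k _ => ?_, by simp⟩
    dsimp only
    rw [← anc_child (hy k) (hyd k).le]
    exact child_anc (y (k + 1)) (hyd (k + 1)).le
  · obtain rfl := ho x rfl
    refine ⟨fun k => (S.tree κ).anc x k, fun k hk => ?_, fun k hk => child_anc x (hk x rfl), ?_⟩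
    · exact ⟨depth_anc x (hk x rfl), Skeleton.isAnc_joint_anc (y := x) (hk x rfl)⟩
    · rintro _ ⟨⟩
      exact anc_self (T := S.tree κ) x

/-- The tree obtained by attaching trees to the nodes of a skeleton is presented by the assembled
family. -/
theorem presents (hκ : κ ∈ M) (hF : A.Fits κ B) (hl : ((S.tree κ).attach B).LeavesAtRoot) :
    A.family.Presents r c κ ((S.tree κ).attach B) := by
  have := S.finite
  choose loc hloc hloc' using fun a => hF.exists_loc a
  choose path hpath hchild hend using fun a : A.family.Pt r c κ =>
    exists_path (A.jointOf a.piece) (loc a) (fun x hx => (hloc a x hx).1) fun h => (hloc' a h).1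
  have hint : ∀ (a : A.family.Pt r c κ) n, PDvd 0 (A.innerOf a.piece n a.coord) := by
    rintro ⟨P | ⟨i, P⟩, σ, h, h'⟩ n
    · exact PDvd.zero 0
    · exact hF.integral i ⟨P, σ, h, h'⟩ n
  have hscale : ∀ (a : A.family.Pt r c κ) (k : ℕ), (∀ x, loc a = some x → k ≤ x.1.2) →
      PDvd k (A.scaleOf a.piece a.coord) := by
    intro a k hk
    rcases hla : loc a with _ | x
    · rw [(hloc' a hla).2]
      exact PDvd.zero _
    · exact PDvd.of_norm_eq (hloc a x hla).2 (by exact_mod_cast hk x hla)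
  have hN : ∀ (x : (S.tree κ).Node) k, x.1.2 = k → S.IsNode κ (x.1.1, k) := by
    rintro ⟨x, hx⟩ _ rfl
    exact hx
  -- As long as both paths are in the skeleton, the scales and the scaled coordinates vanish modulo
  -- p^k, so the positions decide.
  have hpeq : ∀ (k : ℕ) (a b : A.family.Pt r c κ), Near p r k a.base b.base →
      (∀ x, loc a = some x → k ≤ x.1.2) → (∀ x, loc b = some x → k ≤ x.1.2) →
      (path a k = path b k ↔ ∀ i, PDvd (k : ℤ) (a.value i - b.value i)) := by
    intro k a b hab ha hb
    obtain ⟨ha1, ha2⟩ := hpath a k ha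
    obtain ⟨hb1, hb2⟩ := hpath b k hb
    rw [cong_iff]
    rw [← node_eq_iff (w := a.base) (w' := b.base) hκ (hN _ k ha1) (hN _ k hb1) ha2 hb2
      a.base_mem b.base_mem hab]
    constructor
    · intro h
      refine ⟨by rw [h], (hscale a k ha).sub (hscale b k hb), fun n => ?_⟩
      exact ((hscale a k ha).mul_zero (hint a n)).sub ((hscale b k hb).mul_zero (hint b n))
    · rintro ⟨h, -⟩
      exact Subtype.ext (Prod.ext h (ha1.trans hb1.symm))
  have hpos : ∀ (a : A.family.Pt r c κ) j,
      PDvd 0 (position S.shape (A.offset a.base) (A.jointOf a.piece) j) := by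
    intro a j
    unfold position
    split_ifs with hj
    · exact PDvd.of_norm_eq (A.norm_τ _ (S.not_virtual_parent hj.1) κ hκ _ a.base_mem) (by omega)
    · exact PDvd.zero 0
  -- The scale of a has valuation l < k, which every element congruent to it modulo p^k shares. So b
  -- leaves the skeleton at depth l too, and congruence modulo p^l shows that it does so at the same
  -- node.
  have hsep : ∀ (k : ℕ) (a b : A.family.Pt r c κ) x, Near p r k a.base b.base →
      loc a ≠ loc b → loc a = some x → x.1.2 < k →
      ¬ ∀ i, PDvd (k : ℤ) (a.value i - b.value i) := by
    intro k a b x hab hne hx hxk hR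
    have h1 := (cong_iff.1 hR).2.1
    have h2 := (hloc a x hx).2
    have h3 : ‖A.scaleOf b.piece b.coord‖ = (p : ℝ) ^ (-(x.1.2 : ℤ)) := by
      rw [← h2]
      refine Padic.norm_eq_of_norm_sub_lt_right ?_
      rw [h2, norm_sub_rev]
      exact lt_of_le_of_lt h1 (zpow_lt_zpow_right₀ (one_lt_cast_prime p) (by omega))
    rcases hlb : loc b with _ | y
    · rw [(hloc' b hlb).2, norm_zero] at h3
      exact (zpow_pos (cast_prime_pos p) _).ne h3
    · have h4 := (hloc b y hlb).2
      rw [h3] at h4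
      have h5 := zpow_right_injective₀ (cast_prime_pos p) (one_lt_cast_prime p).ne' h4
      have h6 : x.1.2 = y.1.2 := by omega
      have h7 := (hpeq x.1.2 a b (hab.mono hxk.le) (fun z hz => by
        rw [hx] at hz
        cases hz
        exact le_rfl) (fun z hz => by
        rw [hlb] at hz
        cases hz
        exact h6.le)).2 fun i => (hR i).mono (by omega)
      rw [hend a x hx, h6, hend b y hlb] at h7
      exact hne (by rw [hx, hlb, h7])
  refine ⟨fun a => ?_, ?_⟩
  · rintro (j | _ | n)
    · exact hpos a j
    · exact hscale a 0 fun _ _ => Nat.zero_le _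
    · exact (hscale a 0 fun _ _ => Nat.zero_le _).mul_zero (hint a n)
  have hBx : ∀ x, (B x).IsPresented (fun a : {a : A.family.Pt r c κ // loc a = some x} => a.1.base)
      (fiber p r c κ) (fun k a b => Near p r (x.1.2 + k) a.1.base b.1.base)
      (fun k a b => ∀ i, PDvd ((x.1.2 + k : ℕ) : ℤ) (a.1.value i - b.1.value i)) := by
    intro x
    obtain ⟨i, hi, huniq, hpres⟩ := hF.presents x
    have hgl : ∀ a : (A.fam i).Pt r c κ, ‖A.scale i a.coord‖ = (p : ℝ) ^ (-(x.1.2 : ℤ)) →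
        loc (ofPt i a) = some x := by
      intro a ha
      rcases hla : loc (ofPt i a) with _ | y
      · have h1 : A.scale i a.coord = 0 := (hloc' _ hla).2
        rw [h1, norm_zero] at ha
        exact ((zpow_pos (cast_prime_pos p) _).ne ha).elim
      · obtain ⟨h1, h2⟩ := hloc _ y hla
        change ‖A.scale i a.coord‖ = _ at h2
        rw [ha] at h2
        have h5 := zpow_right_injective₀ (cast_prime_pos p) (one_lt_cast_prime p).ne' h2
        have h6 : x.1.2 = y.1.2 := by omega
        exact congrArg some (Subtype.ext (Prod.ext (h1.trans hi) h6.symm))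
    let g : {a : (A.fam i).Pt r c κ // ‖A.scale i a.coord‖ = (p : ℝ) ^ (-(x.1.2 : ℤ))} →
        {a : A.family.Pt r c κ // loc a = some x} := fun a => ⟨ofPt i a.1, hgl a.1 a.2⟩
    have hg : Function.Surjective g := by
      rintro ⟨⟨P | ⟨i', P⟩, σ, h, h'⟩, hx⟩
      · have h2 := (hloc _ x hx).2
        change ‖(0 : ℚ_[p])‖ = _ at h2
        rw [norm_zero] at h2
        exact ((zpow_pos (cast_prime_pos p) _).ne h2).elim
      · obtain ⟨h1, h2⟩ := hloc _ x hx
        obtain rfl := huniq i' ⟨P, σ, h, h'⟩ h1.symm h2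
        exact ⟨⟨⟨P, σ, h, h'⟩, h2⟩, rfl⟩
    refine IsPresented.of_surjective (C' := fun k a b => Near p r (x.1.2 + k) a.1.base b.1.base)
      (R' := fun k a b => ∀ i, PDvd ((x.1.2 + k : ℕ) : ℤ) ((g a).1.value i - (g b).1.value i))
      g hg (fun a => rfl) (fun k a b h => h) (fun k a b => Iff.rfl)
      (fun k a => Near.refl a.1.base_mem) (fun k a i => by rw [sub_self]; exact PDvd.zero _)
      (hpres.congr (fun k a b h => h) fun k a b hab => ?_)
    rw [cong_iff]
    have hposeq : ∀ j, PDvd ((x.1.2 + k : ℕ) : ℤ)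
        (position S.shape (A.offset a.1.base) (A.joint i) j -
          position S.shape (A.offset b.1.base) (A.joint i) j) := by
      intro j
      unfold position
      split_ifs with hj
      · exact A.τ_near _ (S.not_virtual_parent hj.1) κ hκ _ a.1.base_mem _ b.1.base_mem _ hab
      · rw [sub_self]
        exact PDvd.zero _
    -- When the scales agree modulo p^(l+k), exchanging them changes the products by multiples of
    -- p^(l+k); the common factor of valuation l then cancels.
    have hmul : ∀ n, PDvd ((x.1.2 + k : ℕ) : ℤ) (A.scale i a.1.coord - A.scale i b.1.coord) →
        (PDvd ((x.1.2 + k : ℕ) : ℤ) (A.scale i a.1.coord * a.1.value n -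
          A.scale i b.1.coord * b.1.value n) ↔ PDvd (k : ℤ) (a.1.value n - b.1.value n)) := by
      intro n hs
      rw [← PDvd.mul_iff (k := k) (y := a.1.value n - b.1.value n) a.2, ← Nat.cast_add]
      refine PDvd.iff_of_sub ?_
      have : A.scale i a.1.coord * a.1.value n - A.scale i b.1.coord * b.1.value n -
          A.scale i a.1.coord * (a.1.value n - b.1.value n) =
          (A.scale i a.1.coord - A.scale i b.1.coord) * b.1.value n := by ring
      rw [this]
      exact hs.mul_zero (hF.integral i b.1 n)
    constructor
    · rintro ⟨-, h2, h3⟩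
      exact ⟨h2, fun n => (hmul n h2).1 (h3 n)⟩
    · rintro ⟨h2, h3⟩
      exact ⟨hposeq, h2, fun n => (hmul n h2).2 (h3 n)⟩
  refine IsPresented.attach loc path (fun a k hk => (hpath a k hk).1) hchild hend hpeq ?_ hBx ?_
  · intro k a b hab hne hk
    rcases Classical.em (∀ x, loc a = some x → k ≤ x.1.2) with ha | ha
    · have hb : ¬ ∀ x, loc b = some x → k ≤ x.1.2 := fun hb => hk ⟨ha, hb⟩
      push Not at hb
      obtain ⟨x, hx, hxk⟩ := hb
      intro hR
      refine hsep k b a x (fun i => ?_) hne.symm hx hxk fun i => (hR i).sub_comm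
      obtain ⟨h1, h2, h3⟩ := hab i
      exact ⟨h1.symm, norm_pos_iff.1 (h1 ▸ norm_pos_iff.2 h2), by rw [norm_sub_rev, h1]; exact h3⟩
    · push Not at ha
      obtain ⟨x, hx, hxk⟩ := ha
      exact hsep k a b x hab hne hx hxk
  · intro x hroot hx w hw
    -- The node x lies on the way to a leaf v of the skeleton. If v is virtual, its infinite path
    -- passes x. If v is real, the tree attached there must continue, because a node of positive
    -- depth is not a leaf.
    obtain ⟨v, hv, hxv⟩ := S.shape.exists_isLeaf x.1.1
    have hpx : ∀ a : A.family.Pt r c κ, A.jointOf a.piece = v →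
        (∀ y, loc a = some y → x.1.2 ≤ y.1.2) → path a x.1.2 = x := by
      intro a ha hle
      obtain ⟨h1, h2⟩ := hpath a x.1.2 hle
      rw [ha] at h2
      exact Subtype.ext (Prod.ext ((hN _ _ h1).eq_of_isAnc (hN x _ rfl) h2 hxv) h1)
    by_cases hvv : S.Virtual v
    · have hnone : loc (ofVirtual (A := A) v hvv w hw) = none := by
        rcases hla : loc (ofVirtual (A := A) v hvv w hw) with _ | y
        · rfl
        · have h2 := (hloc _ y hla).2
          change ‖(0 : ℚ_[p])‖ = _ at h2
          rw [norm_zero] at h2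
          exact ((zpow_pos (cast_prime_pos p) _).ne h2).elim
      have hle : ∀ y, loc (ofVirtual (A := A) v hvv w hw) = some y → x.1.2 ≤ y.1.2 := by
        intro y hy
        rw [hnone] at hy
        cases hy
      exact ⟨_, rfl, hle, hpx _ rfl hle⟩
    · let y : (S.tree κ).Node := ⟨_, Skeleton.isNode_pathLength hvv⟩
      have hyl : (S.tree κ).IsLeaf y := Skeleton.isLeaf_tree hv hvv _
      have hxy : x.1.2 ≤ y.1.2 := by
        have hxs : ¬ S.Virtual x.1.1 := fun h => by
          have := hxv.eq_of_isLeaf (S.virtual_leaf _ h)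
          exact hvv (this ▸ h)
        have hx2 : S.IsNode κ (x.1.1, x.1.2) := x.2
        exact (hx2.le hxs).trans (S.pathLength_mono hxv κ)
      obtain ⟨e, -, he⟩ : ∃ e : (B y).Node, (B y).depth e = 0 ∧ ¬ (B y).IsLeaf e := by
        by_cases h0 : 0 < (S.tree κ).depth y
        · exact hl.exists_of_isLeaf hyl h0
        · have h1 : (S.tree κ).depth y = 0 := by omega
          have h2 : (S.tree κ).depth x = 0 := by
            have : (S.tree κ).depth x ≤ (S.tree κ).depth y := hxy
            omega
          have h3 := (S.tree κ).root_unique h2 h1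
          rw [h3] at hroot hx
          exact absurd (isLeaf_attachInl.2 ⟨hyl, hroot⟩) hx
      obtain ⟨π, -, -, -, h4⟩ := hBx y
      obtain ⟨⟨a, hay⟩, ha, -⟩ := h4 e he w hw
      have hle : ∀ z, loc a = some z → x.1.2 ≤ z.1.2 := by
        intro z hz
        rw [hay] at hz
        cases hz
        exact hxy
      exact ⟨a, ha, hle, hpx a (hloc a y hay).1.symm hle⟩

end Assembly

end

/-! ### Families for side branches -/

section

open RTree

variable {p : ℕ} [hp : Fact p.Prime] {m m' d r : ℕ} {F : RTree} {c κ : Fin m → ℤ}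

/-- The data for a family that presents a side branch with underlying finite tree `F`: families
for the side trees, and digits which describe, together with a function `scale`, the elements of
`ℤ_p`. -/
structure LocalFamily (p m m' d : ℕ) [Fact p.Prime] (F : RTree) where
  finite_tree : Finite F.Node
  ψ : Fin m' ⊕ Fin d → Fin m ⊕ Fin (d + 1)
  Ix : F.Node → Type
  finite : ∀ f, Finite (Ix f)
  digit : ∀ f, Ix f → (Fin m ⊕ Fin (d + 1) → ℚ_[p]) → ℚ_[p]
  isTame_digit : ∀ f s, IsTame (digit f s)
  fam : F.Node → Family p m' d ℕ
  isLeaf : ∀ f, Nonempty (fam f).Piece → F.IsLeaf f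
  dom : Set (Fin m ⊕ Fin (d + 1) → ℚ_[p])
  isDef_dom : IsDef dom
  ne_zero : ∀ σ ∈ dom, ∀ i, σ i ≠ 0

namespace LocalFamily

variable (L : LocalFamily p m m' d F)

/-- The family that presents a side branch, with coordinates indexed by `F.Node ⊕ Option ℕ`. -/
noncomputable def rawFamily : Family p m (d + 1) (F.Node ⊕ Option ℕ) where
  Piece := Σ f, L.Ix f × (L.fam f).Piece
  finite := by
    have := L.finite_tree
    have := L.finite
    have := fun f => (L.fam f).finite
    infer_instance
  dom P := {σ | σ ∈ L.dom ∧ σ ∘ L.ψ ∈ (L.fam P.1).dom P.2.2}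
  isDef_dom P := L.isDef_dom.inter (((L.fam P.1).isDef_dom P.2.2).preimage_comp L.ψ)
  ne_zero h := L.ne_zero _ h.1
  -- The factor p^(depth f) keeps the digit and the inner coordinates invisible until the leaf f is
  -- reached; below that depth the constant position in F decides.
  val P := Sum.elim
    (fun b _ => position F (fun a => (p : ℚ_[p]) ^ (F.depth a - 1)) P.1 b) fun o =>
      o.elim (fun σ => (p : ℚ_[p]) ^ F.depth P.1 * L.digit P.1 P.2.1 σ) fun n σ =>
        (p : ℚ_[p]) ^ F.depth P.1 * (L.fam P.1).val P.2.2 n (σ ∘ L.ψ)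
  isTame_val := by
    rintro P (b | _ | n)
    · exact IsTame.const _
    · exact (IsTame.const _).mul (L.isTame_digit _ _)
    · exact (IsTame.const _).mul (((L.fam P.1).isTame_val P.2.2 n).reindex L.ψ)
  support_finite := by
    have := L.finite_tree
    refine Set.Finite.subset (((Set.finite_range Sum.inl).union (Set.finite_range
      (fun _ : Unit => Sum.inr none))).union ((Set.finite_iUnion fun i =>
        (L.fam i).support_finite).image fun n => Sum.inr (some n))) ?_
    rintro (b | _ | n) ⟨P, hP⟩
    · exact Or.inl (Or.inl ⟨b, rfl⟩)
    · exact Or.inl (Or.inr ⟨(), rfl⟩)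
    · refine Or.inr ⟨n, ?_, rfl⟩
      refine Set.mem_iUnion.2 ⟨P.1, P.2.2, fun h => hP (funext fun σ => ?_)⟩
      change (p : ℚ_[p]) ^ F.depth P.1 * (L.fam P.1).val P.2.2 n (σ ∘ L.ψ) = 0
      rw [h, mul_zero]

theorem nonempty_equiv (L : LocalFamily p m m' d F) : Nonempty (ℕ ≃ F.Node ⊕ Option ℕ) := by
  have := L.finite_tree
  exact nonempty_equiv_of_countable

/-- The family that presents a side branch. -/
noncomputable def family : Family p m (d + 1) ℕ := L.rawFamily.reindex L.nonempty_equiv.some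

variable {L}

/-- The leaf of `F` to which a point belongs. -/
def leaf (a : L.family.Pt r c κ) : F.Node := a.piece.1

/-- The digit of a point. -/
noncomputable def digitOf (a : L.family.Pt r c κ) : ℚ_[p] :=
  L.digit a.piece.1 a.piece.2.1 a.coord

/-- The coordinates of a point that come from the families of the side trees. -/
def innerOf (a : L.family.Pt r c κ) (n : ℕ) : ℚ_[p] :=
  (L.fam a.piece.1).val a.piece.2.2 n (a.coord ∘ L.ψ)

theorem value_cases {P : F.Node ⊕ Option ℕ → Prop} :
    (∀ n, P (L.nonempty_equiv.some n)) ↔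
      (∀ b, P (Sum.inl b)) ∧ P (Sum.inr none) ∧ ∀ n, P (Sum.inr (some n)) := by
  refine (L.nonempty_equiv.some.forall_congr_right (q := P)).trans ?_
  rw [Sum.forall, Option.forall]

theorem cong_iff {k : ℤ} {a b : L.family.Pt r c κ} :
    (∀ n, PDvd k (a.value n - b.value n)) ↔
      (∀ j, PDvd (p := p) k (position F (fun a => (p : ℚ_[p]) ^ (F.depth a - 1)) (leaf a) j -
        position F (fun a => (p : ℚ_[p]) ^ (F.depth a - 1)) (leaf b) j)) ∧
      PDvd k ((p : ℚ_[p]) ^ F.depth (leaf a) * digitOf a -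
        (p : ℚ_[p]) ^ F.depth (leaf b) * digitOf b) ∧
      ∀ n, PDvd k ((p : ℚ_[p]) ^ F.depth (leaf a) * innerOf a n -
        (p : ℚ_[p]) ^ F.depth (leaf b) * innerOf b n) :=
  value_cases (L := L) (P := fun i => PDvd k (L.rawFamily.val a.piece i a.coord -
    L.rawFamily.val b.piece i b.coord))

/-- The points of the torus over `fiber p r c κ` where the function `scale` has valuation `l`. -/
def At (L : LocalFamily p m m' d F) (r : ℕ) (c κ : Fin m → ℤ)
    (scale : (Fin m ⊕ Fin (d + 1) → ℚ_[p]) → ℚ_[p]) (l : ℕ) (σ : Fin m ⊕ Fin (d + 1) → ℚ_[p]) :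
    Prop :=
  σ ∈ L.dom ∧ (fun i => σ (Sum.inl i)) ∈ fiber p r c κ ∧ ‖scale σ‖ = (p : ℝ) ^ (-(l : ℤ))

/-- The conditions under which the family presents the side branch with the given side trees. -/
structure Fits (L : LocalFamily p m m' d F) (r : ℕ) (c κ : Fin m → ℤ) (c' κ' : Fin m' → ℤ)
    (scale : (Fin m ⊕ Fin (d + 1) → ℚ_[p]) → ℚ_[p]) (l : ℕ) (side : F.Node → RTree)
    (ζ : ∀ f, L.Ix f → (Fin m ⊕ Fin (d + 1) → ℚ_[p]) → ℚ_[p]) : Prop where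
  depth_le : ∀ f, F.depth f ≤ r
  presents : ∀ f, F.IsLeaf f → (L.fam f).Presents r c' κ' (side f)
  base_mem : ∀ σ, L.At r c κ scale l σ → (fun i => σ (L.ψ (Sum.inl i))) ∈ fiber p r c' κ'
  integral_digit : ∀ σ, L.At r c κ scale l σ → ∀ f s, PDvd 0 (L.digit f s σ)
  integral_zeta : ∀ σ, L.At r c κ scale l σ → ∀ f s, PDvd 0 (ζ f s σ)
  -- Inside F the scales must not separate points. The bound i ≤ r suffices because F has depth at
  -- most r.
  scale_near : ∀ σ σ', L.At r c κ scale l σ → L.At r c κ scale l σ' → ∀ i ≤ r,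
    Near p r (l + i) (fun i => σ (Sum.inl i)) (fun i => σ' (Sum.inl i)) →
      PDvd ((l + i : ℕ) : ℤ) (scale σ - scale σ')
  -- The element ζ of ℤ_p need not be a coordinate: it is encoded jointly by the scale and the
  -- digit.
  zeta_iff : ∀ σ σ', L.At r c κ scale l σ → L.At r c κ scale l σ' → ∀ f s s' k,
    Near p r (l + (F.depth f + k)) (fun i => σ (Sum.inl i)) (fun i => σ' (Sum.inl i)) →
      (PDvd ((l + (F.depth f + k) : ℕ) : ℤ) (scale σ - scale σ') ∧
        PDvd k (L.digit f s σ - L.digit f s' σ') ↔ PDvd k (ζ f s σ - ζ f s' σ'))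
  near : ∀ σ σ', L.At r c κ scale l σ → L.At r c κ scale l σ' → ∀ f s s' k,
    Near p r (l + (F.depth f + k)) (fun i => σ (Sum.inl i)) (fun i => σ' (Sum.inl i)) →
      PDvd k (ζ f s σ - ζ f s' σ') →
      Near p r k (fun i => σ (L.ψ (Sum.inl i))) (fun i => σ' (L.ψ (Sum.inl i)))
  -- The approximation of z fixes the parameter point b of the side tree, and all points over b must
  -- then be available.
  exists_zeta : ∀ f, ∀ w ∈ fiber p r c κ, ∀ (k : ℕ) (z : ℤ_[p]), ∃ b ∈ fiber p r c' κ',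
    ∀ σ' : Fin m' ⊕ Fin d → ℚ_[p], (∀ i, σ' i ≠ 0) → (fun i => σ' (Sum.inl i)) = b →
      ∃ σ s, L.At r c κ scale l σ ∧ σ ∘ L.ψ = σ' ∧ (fun i => σ (Sum.inl i)) = w ∧
        PDvd k (ζ f s σ - (z : ℚ_[p]))

variable {c' κ' : Fin m' → ℤ} {scale : (Fin m ⊕ Fin (d + 1) → ℚ_[p]) → ℚ_[p]} {l : ℕ}
  {side : F.Node → RTree} {ζ : ∀ f, L.Ix f → (Fin m ⊕ Fin (d + 1) → ℚ_[p]) → ℚ_[p]}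

theorem at_coord (a : L.family.Pt r c κ) (ha : ‖scale a.coord‖ = (p : ℝ) ^ (-(l : ℤ))) :
    L.At r c κ scale l a.coord := ⟨a.mem.1, a.base_mem, ha⟩

/-- The point of the family of a side tree below a point. -/
def Fits.inner (h : L.Fits r c κ c' κ' scale l side ζ) (a : L.family.Pt r c κ)
    (ha : ‖scale a.coord‖ = (p : ℝ) ^ (-(l : ℤ))) (f : F.Node) (hf : leaf a = f) :
    (L.fam f).Pt r c' κ' :=
  ⟨hf ▸ a.piece.2.2, a.coord ∘ L.ψ, by subst hf; exact a.mem.2,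
    h.base_mem _ (at_coord a ha)⟩

theorem Fits.value_inner (h : L.Fits r c κ c' κ' scale l side ζ) (a : L.family.Pt r c κ)
    (ha : ‖scale a.coord‖ = (p : ℝ) ^ (-(l : ℤ))) (f : F.Node) (hf : leaf a = f) (n : ℕ) :
    (h.inner a ha f hf).value n = innerOf a n := by
  subst hf
  rfl

theorem exists_ix (ζ : ∀ f, L.Ix f → (Fin m ⊕ Fin (d + 1) → ℚ_[p]) → ℚ_[p])
    (a : L.family.Pt r c κ) {f : F.Node} (hf : leaf a = f) : ∃ s : L.Ix f,
      L.digit f s a.coord = digitOf a ∧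
        ζ f s a.coord = ζ a.piece.1 a.piece.2.1 a.coord := by
  subst hf
  exact ⟨a.piece.2.1, rfl, rfl⟩

theorem Fits.integral (h : L.Fits r c κ c' κ' scale l side ζ) (a : L.family.Pt r c κ)
    (ha : ‖scale a.coord‖ = (p : ℝ) ^ (-(l : ℤ))) (n : ℕ) : PDvd 0 (a.value n) := by
  revert n
  refine (value_cases (L := L) (P := fun i => PDvd 0 (L.rawFamily.val a.piece i a.coord))).2
    ⟨fun b => ?_, ?_, fun n => ?_⟩
  · change PDvd (p := p) 0 (position F (fun a => (p : ℚ_[p]) ^ (F.depth a - 1)) (leaf a) b)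
    unfold position
    split_ifs
    · exact PDvd.of_norm_eq (norm_prime_pow p _) (by omega)
    · exact PDvd.zero 0
  · exact (PDvd.of_norm_eq (norm_prime_pow p _) (Int.natCast_nonneg _)).zero_mul
      (h.integral_digit _ (at_coord a ha) _ _)
  · refine (PDvd.of_norm_eq (norm_prime_pow p _) (Int.natCast_nonneg _)).zero_mul ?_
    exact (h.presents _ (L.isLeaf _ ⟨a.piece.2.2⟩)).1 (h.inner a ha _ rfl) n

/-- Up to the depth of the leaves, congruence is equality of ancestors in F. Beyond the leaf f, the
common factor p^(depth f) cancels; scale and digit together amount to ζ, and the inner coordinates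
present the side tree. -/
theorem Fits.isPresented (h : L.Fits r c κ c' κ' scale l side ζ)
    (hl : (sideBranch p F side).LeavesAtRoot) :
    (sideBranch p F side).IsPresented
      (fun a : {a : L.family.Pt r c κ // ‖scale a.coord‖ = (p : ℝ) ^ (-(l : ℤ))} => a.1.base)
      (fiber p r c κ) (fun k a b => Near p r (l + k) a.1.base b.1.base)
      (fun k a b => PDvd ((l + k : ℕ) : ℤ) (scale a.1.coord - scale b.1.coord) ∧
        ∀ n, PDvd k (a.1.value n - b.1.value n)) := by
  have := L.finite_tree
  have hat : ∀ a : {a : L.family.Pt r c κ // ‖scale a.coord‖ = (p : ℝ) ^ (-(l : ℤ))},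
      L.At r c κ scale l a.1.coord := fun a => at_coord a.1 a.2
  have hleaf : ∀ a : L.family.Pt r c κ, F.IsLeaf (leaf a) := fun a => L.isLeaf _ ⟨a.piece.2.2⟩
  have hdig : ∀ (a : {a : L.family.Pt r c κ // ‖scale a.coord‖ = (p : ℝ) ^ (-(l : ℤ))}) (i : ℕ),
      i ≤ F.depth (leaf a.1) → PDvd i ((p : ℚ_[p]) ^ F.depth (leaf a.1) * digitOf a.1) :=
    fun a i hi => (PDvd.of_norm_eq (norm_prime_pow p _) (by exact_mod_cast hi)).mul_zero
      (h.integral_digit _ (hat a) _ _)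
  have hinn : ∀ (a : {a : L.family.Pt r c κ // ‖scale a.coord‖ = (p : ℝ) ^ (-(l : ℤ))}) (i : ℕ) n,
      i ≤ F.depth (leaf a.1) → PDvd i ((p : ℚ_[p]) ^ F.depth (leaf a.1) * innerOf a.1 n) := by
    intro a i n hi
    refine (PDvd.of_norm_eq (norm_prime_pow p _) (by exact_mod_cast hi)).mul_zero ?_
    have := (h.presents _ (hleaf a.1)).1 (h.inner a.1 a.2 _ rfl) n
    rwa [h.value_inner] at this
  have hlow : ∀ (i : ℕ) (a b : {a : L.family.Pt r c κ // ‖scale a.coord‖ = (p : ℝ) ^ (-(l : ℤ))}),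
      Near p r (l + i) a.1.base b.1.base → i ≤ F.depth (leaf a.1) → i ≤ F.depth (leaf b.1) →
      F.anc (leaf a.1) i = F.anc (leaf b.1) i →
      PDvd ((l + i : ℕ) : ℤ) (scale a.1.coord - scale b.1.coord) ∧
        ∀ n, PDvd i (a.1.value n - b.1.value n) := by
    intro i a b hab ha hb hanc
    refine ⟨h.scale_near _ _ (hat a) (hat b) i (ha.trans (h.depth_le _)) hab, cong_iff.2 ⟨?_, ?_, ?_⟩⟩
    · exact (constPosition_congr i ha hb).1 hanc
    · exact (hdig a i ha).sub (hdig b i hb)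
    · exact fun n => (hinn a i n ha).sub (hinn b i n hb)
  let z : {a : L.family.Pt r c κ // ‖scale a.coord‖ = (p : ℝ) ^ (-(l : ℤ))} → ℤ_[p] := fun a =>
    ⟨ζ a.1.piece.1 a.1.piece.2.1 a.1.coord, PDvd.zero_iff.1 (h.integral_zeta _ (hat a) _ _)⟩
  refine IsPresented.sideBranch hl (fun a => leaf a.1) (fun a => hleaf a.1)
    z
    (A' := fun f => (L.fam f).Pt r c' κ') (β' := fun _ => Fin m' → ℚ_[p])
    (w' := fun f a => a.base) (W' := fun _ => fiber p r c' κ')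
    (C' := fun f k a b => Near p r k a.base b.base)
    (R' := fun f k a b => ∀ i, PDvd k (a.value i - b.value i)) (fun f hf => (h.presents f hf).2)
    (fun f a => h.inner a.1.1 a.1.2 f a.2) ?_ ?_ ?_ ?_ ?_
  · intro i a b hab hne
    constructor
    · rintro ⟨-, hR⟩
      have hpos := (cong_iff.1 hR).1
      have key : ∀ j, j ≤ i → j ≤ F.depth (leaf a.1) → j ≤ F.depth (leaf b.1) →
          F.anc (leaf a.1) j = F.anc (leaf b.1) j := fun j hj hja hjb =>
        (constPosition_congr (p := p) j hja hjb).2 fun x => (hpos x).mono (by exact_mod_cast hj)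
      -- If congruence extended beyond the depth of one of the leaves, that leaf would be an
      -- ancestor of the other and hence equal to it.
      have hia : i ≤ F.depth (leaf a.1) := by
        by_contra hlt
        rcases le_total (F.depth (leaf a.1)) (F.depth (leaf b.1)) with hle | hle
        · have h1 := key _ (by omega) le_rfl hle
          rw [anc_self] at h1
          exact hne (IsAnc.eq_of_isLeaf ⟨hle, h1.symm⟩ (hleaf a.1))
        · have h1 := key _ (by omega) hle le_rfl
          rw [anc_self] at h1
          exact hne (IsAnc.eq_of_isLeaf ⟨hle, h1⟩ (hleaf b.1)).symm
      have hib : i ≤ F.depth (leaf b.1) := by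
        by_contra hlt
        have h1 := key _ (by omega) (by omega) le_rfl
        rw [anc_self] at h1
        exact hne (IsAnc.eq_of_isLeaf ⟨by omega, h1⟩ (hleaf b.1)).symm
      exact ⟨hia, hib, key i le_rfl hia hib⟩
    · rintro ⟨ha, hb, hanc⟩
      exact hlow i a b hab ha hb hanc
  · intro i a b hab hf hi
    exact hlow i a b hab hi (hf ▸ hi) (by rw [hf])
  · rintro f k ⟨a, rfl⟩ ⟨b, hb⟩ hab
    obtain ⟨s, hd, hz⟩ := exists_ix ζ b.1 hb
    have key := h.zeta_iff _ _ (hat a) (hat b) (leaf a.1) a.1.piece.2.1 s k hab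
    have hzz : ‖z a - z b‖ ≤ (p : ℝ) ^ (-(k : ℤ)) ↔
        PDvd k (ζ (leaf a.1) a.1.piece.2.1 a.1.coord -
          ζ (leaf a.1) s b.1.coord) := by
      rw [hz]
      rfl
    have hb' : leaf b.1 = leaf a.1 := hb
    have hmul : ∀ x y : ℚ_[p], PDvd ((F.depth (leaf a.1) + k : ℕ) : ℤ)
        ((p : ℚ_[p]) ^ F.depth (leaf a.1) * x - (p : ℚ_[p]) ^ F.depth (leaf b.1) * y) ↔
          PDvd k (x - y) := by
      intro x y
      rw [hb', ← mul_sub, Nat.cast_add]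
      exact PDvd.mul_iff (norm_prime_pow p _)
    dsimp only
    rw [hzz, ← key, cong_iff, hmul, hd]
    simp only [hmul, h.value_inner]
    constructor
    · rintro ⟨h1, -, h2, h3⟩
      exact ⟨⟨h1, h2⟩, h3⟩
    · rintro ⟨⟨h1, h2⟩, h3⟩
      refine ⟨h1, fun j => ?_, h2, h3⟩
      rw [hb', sub_self]
      exact PDvd.zero _
  · rintro f k ⟨a, rfl⟩ ⟨b, hb⟩ hab hz
    obtain ⟨s, -, hs⟩ := exists_ix ζ b.1 hb
    refine h.near _ _ (hat a) (hat b) (leaf a.1) a.1.piece.2.1 s k hab ?_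
    rw [hs]
    exact hz
  · intro f hf w hw k z
    obtain ⟨b, hb, hbs⟩ := h.exists_zeta f w hw k z
    refine ⟨b, hb, fun a' ha' => ?_⟩
    obtain ⟨σ, s, hσ, hσ', hσw, hσz⟩ := hbs a'.coord ((L.fam f).ne_zero a'.mem) ha'
    obtain ⟨P, σ', hP, hP'⟩ := a'
    dsimp only at hσ'
    subst hσ'
    have hσf : (fun i => σ (Sum.inl i)) ∈ fiber p r c κ := hσ.2.1
    exact ⟨⟨⟨⟨⟨f, s, P⟩, σ, ⟨hσ.1, hP⟩, hσf⟩, hσ.2.2⟩, rfl⟩, hσw, rfl, hσz⟩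

end LocalFamily

end

/-! ### Families for parametrized trees -/

section

open RTree Filter

variable {p : ℕ} [hp : Fact p.Prime] {m d : ℕ}

variable (p d) in
/-- The values of a parametrized tree are presented by families. -/
def HasFamilies {m : ℕ} (M : Set (Fin m → ℤ)) (T : PTree m) : Prop :=
  ∀ᶠ r : ℕ in atTop, ∀ c : Fin m → ℤ, ∃ 𝓕 : Family p m d ℕ, ∀ κ ∈ M, 𝓕.Presents r c κ (T κ)

theorem LeavesAtRoot.of_sideBranch {F : RTree} {side : F.Node → RTree}
    (h : (sideBranch p F side).LeavesAtRoot) {f : F.Node} (hf : F.IsLeaf f) :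
    (side f).LeavesAtRoot := by
  have := RTree.LeavesAtRoot.of_attach h f
  rw [if_pos hf] at this
  exact this.of_prod

/-- F has finitely many leaves, so one r works for all of them. Nodes that are not leaves receive
the empty family, so that every point belongs to a leaf. -/
theorem IsSideBranch.exists_families {N : Set (Fin m → ℤ)} {B : PTree m} {P : PTree m → Prop}
    (h : IsSideBranch p P N B) (hP : ∀ T, P T → (∀ κ ∈ N, (T κ).LeavesAtRoot) → HasFamilies p d N T)
    (hB : ∀ κ ∈ N, (B κ).LeavesAtRoot) :
    ∃ (F : RTree) (side : F.Node → PTree m), Finite F.Node ∧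
      (∀ κ ∈ N, Nonempty (RTree.Iso (B κ) (sideBranch p F fun w => side w κ))) ∧
      ∀ᶠ r : ℕ in atTop, (∀ f, F.depth f ≤ r) ∧ ∀ c : Fin m → ℤ,
        ∃ fam : F.Node → Family p m d ℕ, (∀ f, Nonempty (fam f).Piece → F.IsLeaf f) ∧
          ∀ κ ∈ N, ∀ f, F.IsLeaf f → (fam f).Presents r c κ (side f κ) := by
  classical
  obtain ⟨F, side, hfin, -, hside, hiso⟩ := h
  refine ⟨F, side, hfin, hiso, ?_⟩
  have h1 : ∀ᶠ r : ℕ in atTop, ∀ f, F.IsLeaf f → ∀ c : Fin m → ℤ, ∃ 𝓕 : Family p m d ℕ,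
      ∀ κ ∈ N, 𝓕.Presents r c κ (side f κ) := by
    rw [eventually_all]
    intro f
    by_cases hf : F.IsLeaf f
    · filter_upwards [hP _ (hside f hf).1 fun κ hκ => by
        obtain ⟨e⟩ := hiso κ hκ
        exact LeavesAtRoot.of_sideBranch (p := p) ((hB κ hκ).of_iso e) hf] with r hr _
      exact hr
    · exact Eventually.of_forall fun r h => absurd h hf
  have h2 : ∀ᶠ r : ℕ in atTop, ∀ f, F.depth f ≤ r :=
    eventually_all.2 fun f => eventually_ge_atTop _
  filter_upwards [h1, h2] with r hr hr2
  refine ⟨hr2, fun c => ?_⟩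
  have : Nonempty (Family p m d ℕ) := ⟨Family.empty⟩
  choose! fam hfam using fun f hf => hr f hf c
  refine ⟨fun f => if F.IsLeaf f then fam f else Family.empty, fun f hf => ?_,
    fun κ hκ f hf => ?_⟩
  · by_contra hl
    dsimp only at hf
    rw [if_neg hl] at hf
    obtain ⟨x⟩ := hf
    exact x.elim
  · dsimp only
    rw [if_pos hf]
    exact hfam f hf κ hκ

/-- A non-empty finite tree has a leaf, and the side tree there carries the definability of N. -/
theorem IsSideBranch.isDefinableGamma {N : Set (Fin m → ℤ)} {B : PTree m} {P : PTree m → Prop}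
    (h : IsSideBranch p P N B) (hP : ∀ T, P T → IsDefinableGamma p N) : IsDefinableGamma p N := by
  obtain ⟨F, side, hfin, ⟨x⟩, hside, -⟩ := h
  obtain ⟨f, hf, -⟩ := F.exists_isLeaf x
  exact hP _ (hside f hf).1

theorem IsLevel.isDefinableGamma {M : Set (Fin m → ℤ)} {T : PTree m} (h : IsLevel p d m M T) :
    IsDefinableGamma p M := by
  cases d <;> exact h.1

/-! ### Side branches at joints -/

/-- The family for a side branch at a joint. -/
noncomputable def jointFamily (m d : ℕ) {F : RTree} (hF : Finite F.Node)
    (fam : F.Node → Family p m d ℕ) (hfam : ∀ f, Nonempty (fam f).Piece → F.IsLeaf f) :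
    LocalFamily p m m d F where
  finite_tree := hF
  ψ := Sum.map id Fin.succ
  Ix _ := Unit
  finite _ := inferInstance
  digit _ _ σ := σ (Sum.inr 0)
  isTame_digit _ _ := IsTame.proj _
  fam := fam
  isLeaf := hfam
  dom := (⋂ i, {σ | σ i = 0}ᶜ) ∩ {σ | ‖σ (Sum.inr 0)‖ ≤ 1}
  isDef_dom := (IsDef.iInter fun i => ((IsDefFun.proj i).setOf_eq (IsDefFun.const 0)).compl).inter
    (isDef_norm_le_one (IsDefFun.proj _))
  ne_zero _ h i := Set.mem_iInter.1 h.1 i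

/-- The depth of a joint is determined by κ, so the scale depends on w only and the new coordinate
is free to be the element of ℤ_p; here ζ is the digit itself. -/
theorem IsSideBranch.exists_joint_family {N : Set (Fin m → ℤ)} {B : PTree m} {P : PTree m → Prop}
    (h : IsSideBranch p P N B) (hP : ∀ T, P T → (∀ κ ∈ N, (T κ).LeavesAtRoot) → HasFamilies p d N T)
    (hB : ∀ κ ∈ N, (B κ).LeavesAtRoot) : ∀ᶠ r : ℕ in atTop, ∀ (c : Fin m → ℤ)
      (τ : (Fin m → ℚ_[p]) → ℚ_[p]) (D : (Fin m → ℤ) → ℕ),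
      (∀ κ ∈ N, ∀ w ∈ fiber p r c κ, ‖τ w‖ = (p : ℝ) ^ (-(D κ : ℤ))) →
      (∀ κ ∈ N, ∀ w ∈ fiber p r c κ, ∀ w' ∈ fiber p r c κ, ∀ k, Near p r k w w' →
        PDvd k (τ w - τ w')) →
      ∃ 𝓖 : Family p m (d + 1) ℕ, ∀ κ ∈ N,
        (∀ (a : 𝓖.Pt r c κ) n, PDvd 0 (a.value n)) ∧
        (B κ).IsPresented (fun a : {a : 𝓖.Pt r c κ //
            ‖τ fun i => a.coord (Sum.inl i)‖ = (p : ℝ) ^ (-(D κ : ℤ))} => a.1.base)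
          (fiber p r c κ) (fun k a b => Near p r (D κ + k) a.1.base b.1.base)
          (fun k a b => PDvd ((D κ + k : ℕ) : ℤ)
              (τ (fun i => a.1.coord (Sum.inl i)) - τ fun i => b.1.coord (Sum.inl i)) ∧
            ∀ n, PDvd k (a.1.value n - b.1.value n)) := by
  obtain ⟨F, side, hfin, hiso, hev⟩ := h.exists_families hP hB
  filter_upwards [hev] with r ⟨hdepth, hr⟩ c τ D hτ hτ'
  obtain ⟨fam, hfam, hpres⟩ := hr c
  let L := jointFamily m d hfin fam hfam
  refine ⟨L.family, fun κ hκ => ?_⟩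
  have hp0 : (p : ℚ_[p]) ≠ 0 := by exact_mod_cast hp.1.ne_zero
  have hfits : L.Fits r c κ c κ (fun σ => τ fun i => σ (Sum.inl i)) (D κ) (fun f => side f κ)
      (fun _ _ σ => σ (Sum.inr 0)) :=
    { depth_le := hdepth
      presents := hpres κ hκ
      base_mem := fun σ h => h.2.1
      integral_digit := fun σ h _ _ => PDvd.zero_iff.2 h.1.2
      integral_zeta := fun σ h _ _ => PDvd.zero_iff.2 h.1.2
      scale_near := fun σ σ' h h' i _ hn => hτ' κ hκ _ h.2.1 _ h'.2.1 _ hn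
      zeta_iff := fun σ σ' h h' f _ _ k hn =>
        ⟨fun h => h.2, fun hz => ⟨hτ' κ hκ _ h.2.1 _ h'.2.1 _ hn, hz⟩⟩
      near := fun σ σ' h h' f _ _ k hn _ => hn.mono (by omega)
      exists_zeta := by
        intro f w hw k z
        refine ⟨w, hw, fun σ' hσ' hw' => ?_⟩
        -- Torus coordinates are non-zero, so the element 0 of ℤ_p is replaced by p^k, which agrees
        -- with it to the required precision.
        obtain ⟨y, hy, hy1, hyz⟩ : ∃ y : ℚ_[p], y ≠ 0 ∧ ‖y‖ ≤ 1 ∧ PDvd k (y - (z : ℚ_[p])) := by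
          by_cases hz : (z : ℚ_[p]) = 0
          · refine ⟨(p : ℚ_[p]) ^ k, pow_ne_zero _ hp0, ?_, ?_⟩
            · exact PDvd.zero_iff.1 (PDvd.of_norm_eq (norm_prime_pow p k) (by omega))
            · rw [hz, sub_zero]
              exact PDvd.of_norm_eq (norm_prime_pow p k) le_rfl
          · exact ⟨z, hz, z.2, by rw [sub_self]; exact PDvd.zero _⟩
        refine ⟨Sum.elim w (Fin.cons y fun j => σ' (Sum.inr j)), (), ⟨⟨Set.mem_iInter.2 ?_, hy1⟩,
          hw, hτ κ hκ w hw⟩, ?_, rfl, hyz⟩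
        · rintro (i | j)
          · exact (hw i).1
          · refine Fin.cases ?_ (fun j => ?_) j
            · exact hy
            · exact hσ' _
        · funext i
          rcases i with i | j
          · exact (congrFun hw' i).symm
          · rfl }
  obtain ⟨e⟩ := hiso κ hκ
  refine ⟨fun a => hfits.integral a (hτ κ hκ _ a.base_mem), ?_⟩
  exact (hfits.isPresented ((hB κ hκ).of_iso e)).of_iso e.symm

/-! ### Side branches at bones -/

theorem norm_eq_one_of_pdvd_sub_one {r : ℕ} (hr : 0 < r) {η : ℚ_[p]} (hη : PDvd r (η - 1)) :
    ‖η‖ = 1 := by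
  rw [← norm_one (α := ℚ_[p])]
  refine Padic.norm_eq_of_norm_sub_lt_right (lt_of_le_of_lt hη ?_)
  rw [norm_one, ← zpow_zero (p : ℝ)]
  exact zpow_lt_zpow_right₀ (one_lt_cast_prime p) (by omega)

theorem prime_zpow_mul_mem_leadingOne {r : ℕ} (hr : 0 < r) {η : ℚ_[p]} (hη : PDvd r (η - 1))
    (q : ℤ) : (p : ℚ_[p]) ^ q * η ∈ leadingOne p r ∧ ((p : ℚ_[p]) ^ q * η).valuation = q ∧
      (p : ℚ_[p]) ^ q * η / (p : ℚ_[p]) ^ ((p : ℚ_[p]) ^ q * η).valuation = η := by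
  have hp0 : (p : ℚ_[p]) ≠ 0 := by exact_mod_cast hp.1.ne_zero
  have h1 : ‖(p : ℚ_[p]) ^ q * η‖ = (p : ℝ) ^ (-q) := by
    rw [norm_mul, norm_eq_one_of_pdvd_sub_one hr hη, mul_one, norm_zpow, Padic.norm_p, inv_zpow']
  obtain ⟨h2, h3⟩ := norm_eq_zpow_iff.1 h1
  have h4 : (p : ℚ_[p]) ^ q * η / (p : ℚ_[p]) ^ ((p : ℚ_[p]) ^ q * η).valuation = η := by
    rw [h3, mul_div_cancel_left₀ _ (zpow_ne_zero _ hp0)]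
  exact ⟨⟨h2, by rwa [h4]⟩, h3, h4⟩

theorem pdvd_pow_sub_one_add_padicValNat {N r : ℕ} (hN : N ≠ 0) (hr : padicValNat p N < r) {η : ℚ_[p]}
    (hη : PDvd r (η - 1)) : PDvd ((r + padicValNat p N : ℕ) : ℤ) (η ^ N - 1) := by
  have h := norm_pow_sub_pow hN hr hη (y := 1) (by rw [sub_self]; exact PDvd.zero _)
  rw [one_pow] at h
  rw [PDvd, h, Nat.cast_add, neg_add, zpow_add₀ (cast_prime_pos p).ne', mul_comm]
  exact mul_le_mul_of_nonneg_right hη (zpow_pos (cast_prime_pos p) _).le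

/-- The coordinates of the parameter of a side branch at a bone. -/
def boneIndex (m d : ℕ) : Fin (m + 1) ⊕ Fin d → Fin m ⊕ Fin (d + 1) :=
  Sum.elim (Fin.snoc (α := fun _ => Fin m ⊕ Fin (d + 1)) (fun i => Sum.inl i) (Sum.inr 0))
    fun j => Sum.inr j.succ

theorem mem_fiber_snoc {r : ℕ} {c κ : Fin m → ℤ} {c' l : ℤ} {x : Fin (m + 1) → ℚ_[p]} :
    x ∈ fiber p r (Fin.snoc c c' : Fin (m + 1) → ℤ) (Fin.snoc κ l : Fin (m + 1) → ℤ) ↔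
      (fun i => x (Fin.castSucc i)) ∈ fiber p r c κ ∧ x (Fin.last m) ≠ 0 ∧
        l = c' + (r.factorial : ℤ) * (x (Fin.last m)).valuation := by
  simp only [fiber, Set.mem_ofPred_eq, Fin.forall_fin_succ', Fin.snoc_castSucc, Fin.snoc_last]

/-- The family for a side branch at a bone. -/
noncomputable def boneFamily {r : ℕ} (hr : 0 < r) (c : Fin (m + 1) → ℤ) {N : Set (Fin (m + 1) → ℤ)}
    (hN : IsDefinableGamma p N) {F : RTree} (hF : Finite F.Node)
    (fam : F.Node → Family p (m + 1) d ℕ) (hfam : ∀ f, Nonempty (fam f).Piece → F.IsLeaf f) :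
    LocalFamily p m (m + 1) d F where
  finite_tree := hF
  ψ := boneIndex m d
  -- The quotients (η^(r!) - 1)/p^(depth f) only cover the multiples of p^(r + v(r!) - depth f); the
  -- digits represent the missing residues.
  Ix f := Fin (p ^ (r + padicValNat p r.factorial - F.depth f))
  finite _ := inferInstance
  digit _ s _ := ((s : ℕ) : ℚ_[p])
  isTame_digit _ _ := IsTame.const _
  fam := fam
  isLeaf := hfam
  -- The last condition says that the parameter (κ, λ) encoded by σ lies in N. It confines the depth
  -- to the inside of the bone.
  dom := ((⋂ i, {σ | σ i = 0}ᶜ) ∩ {σ | σ (Sum.inr 0) ∈ leadingOne p r}) ∩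
    {σ | (fun i => (p : ℚ_[p]) ^ c i * σ (boneIndex m d (Sum.inl i)) ^ r.factorial) ∈
      {x : Fin (m + 1) → ℚ_[p] | (∀ i, x i ≠ 0) ∧ (fun i => (x i).valuation) ∈ N}}
  isDef_dom := ((IsDef.iInter fun i => ((IsDefFun.proj i).setOf_eq (IsDefFun.const 0)).compl).inter
    (isDef_leadingOne hr (IsDefFun.proj _))).inter
      (IsDef.preimage_map (fun _ => (IsDefFun.const _).mul ((IsDefFun.proj _).pow _)) hN)
  ne_zero _ h i := Set.mem_iInter.1 h.1.1 i

theorem valuation_prime_zpow_mul_pow {x : ℚ_[p]} (hx : x ≠ 0) (a : ℤ) (n : ℕ) :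
    (p : ℚ_[p]) ^ a * x ^ n ≠ 0 ∧
      ((p : ℚ_[p]) ^ a * x ^ n).valuation = a + (n : ℤ) * x.valuation := by
  rw [← norm_eq_zpow_iff, norm_mul, norm_pow, norm_zpow, Padic.norm_p,
    Padic.norm_eq_zpow_neg_valuation hx, inv_zpow', ← zpow_natCast, ← zpow_mul,
    ← zpow_add₀ (cast_prime_pos p).ne']
  congr 1
  ring

/-- The new coordinate is y = p^q η with η in 1 + p^r ℤ_p. Its valuation yields the depth l = c' +
r! q, and η^(r!) with the digit yields the element of ℤ_p. Thus y serves both as the last parameter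
of the side tree and as the coordinate of T(ℤ_p), and only one dimension is spent. -/
theorem IsSideBranch.exists_bone_family {N : Set (Fin (m + 1) → ℤ)} {B : PTree (m + 1)}
    {P : PTree (m + 1) → Prop} (h : IsSideBranch p P N B)
    (hP : ∀ T, P T → (∀ κ ∈ N, (T κ).LeavesAtRoot) → HasFamilies p d N T)
    (hP' : ∀ T, P T → IsDefinableGamma p N) (hB : ∀ κ ∈ N, (B κ).LeavesAtRoot) :
    ∀ᶠ r : ℕ in atTop, ∀ (c : Fin m → ℤ) (c' : ℤ),
      ∃ 𝓖 : Family p m (d + 1) ℕ,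
        (∀ κ (a : 𝓖.Pt r c κ), ∃ q : ℤ,
          (Fin.snoc κ (c' + r.factorial * q) : Fin (m + 1) → ℤ) ∈ N ∧
            ‖(p : ℚ_[p]) ^ c' * a.coord (Sum.inr 0) ^ r.factorial‖ =
              (p : ℝ) ^ (-(c' + r.factorial * q))) ∧
        ∀ (κ : Fin m → ℤ) (l : ℕ), (Fin.snoc κ (l : ℤ) : Fin (m + 1) → ℤ) ∈ N →
          (∃ q : ℤ, (l : ℤ) = c' + r.factorial * q) →
          (∀ a : 𝓖.Pt r c κ, ‖(p : ℚ_[p]) ^ c' * a.coord (Sum.inr 0) ^ r.factorial‖ =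
            (p : ℝ) ^ (-(l : ℤ)) → ∀ n, PDvd 0 (a.value n)) ∧
          (B (Fin.snoc κ (l : ℤ) : Fin (m + 1) → ℤ)).IsPresented (fun a : {a : 𝓖.Pt r c κ //
              ‖(p : ℚ_[p]) ^ c' * a.coord (Sum.inr 0) ^ r.factorial‖ = (p : ℝ) ^ (-(l : ℤ))} =>
                a.1.base)
            (fiber p r c κ) (fun k a b => Near p r (l + k) a.1.base b.1.base)
            (fun k a b => PDvd ((l + k : ℕ) : ℤ)
                ((p : ℚ_[p]) ^ c' * a.1.coord (Sum.inr 0) ^ r.factorial -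
                  (p : ℚ_[p]) ^ c' * b.1.coord (Sum.inr 0) ^ r.factorial) ∧
              ∀ n, PDvd k (a.1.value n - b.1.value n)) := by
  obtain ⟨F, side, hfin, hiso, hev⟩ := h.exists_families hP hB
  filter_upwards [hev, eventually_gt_atTop 0] with r ⟨hdepth, hr⟩ hr0 c c'
  obtain ⟨fam, hfam, hpres⟩ := hr (Fin.snoc c c' : Fin (m + 1) → ℤ)
  have hp0 : (p : ℚ_[p]) ≠ 0 := by exact_mod_cast hp.1.ne_zero
  have hK : r.factorial ≠ 0 := r.factorial_ne_zero
  -- By Legendre's formula. Hence taking r!-th roots on 1 + p^r ℤ_p loses less precision than the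
  -- p^r that `Near` allows.
  have hν : padicValNat p r.factorial < r := padicValNat_factorial_lt_of_ne_zero p hr0.ne'
  let L := boneFamily hr0 (Fin.snoc c c' : Fin (m + 1) → ℤ) (h.isDefinableGamma hP') hfin fam hfam
  have hψ : ∀ (σ : Fin m ⊕ Fin (d + 1) → ℚ_[p]) (i : Fin m),
      σ (boneIndex m d (Sum.inl i.castSucc)) = σ (Sum.inl i) := fun σ i => by
    simp [boneIndex]
  have hψ' : ∀ σ : Fin m ⊕ Fin (d + 1) → ℚ_[p],
      σ (boneIndex m d (Sum.inl (Fin.last m))) = σ (Sum.inr 0) := fun σ => by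
    simp [boneIndex]
  have hdomN : ∀ (κ : Fin m → ℤ) (σ : Fin m ⊕ Fin (d + 1) → ℚ_[p]), (∀ i, σ i ≠ 0) →
      (fun i => σ (Sum.inl i)) ∈ fiber p r c κ →
      (fun i => ((p : ℚ_[p]) ^ (Fin.snoc c c' : Fin (m + 1) → ℤ) i *
        σ (boneIndex m d (Sum.inl i)) ^ r.factorial).valuation) =
          (Fin.snoc κ (c' + r.factorial * (σ (Sum.inr 0)).valuation) : Fin (m + 1) → ℤ) := by
    intro κ σ hσ hw
    funext i
    rw [(valuation_prime_zpow_mul_pow (hσ _) _ _).2]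
    refine Fin.lastCases ?_ (fun i => ?_) i
    · rw [hψ' σ, Fin.snoc_last, Fin.snoc_last]
    · rw [hψ σ i, Fin.snoc_castSucc, Fin.snoc_castSucc]
      exact ((hw i).2).symm
  refine ⟨L.family, fun κ a => ?_, fun κ l hl ⟨q, hq⟩ => ?_⟩
  · have ha : a.coord ∈ L.dom := a.mem.1
    have ha0 := L.ne_zero _ ha
    refine ⟨(a.coord (Sum.inr 0)).valuation, ?_, ?_⟩
    · rw [← hdomN κ a.coord ha0 a.base_mem]
      exact ha.2.2
    · rw [norm_eq_zpow_iff]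
      exact valuation_prime_zpow_mul_pow (ha0 _) _ _
  let η : (Fin m ⊕ Fin (d + 1) → ℚ_[p]) → ℚ_[p] := fun σ =>
    σ (Sum.inr 0) / (p : ℚ_[p]) ^ (σ (Sum.inr 0)).valuation
  let scale : (Fin m ⊕ Fin (d + 1) → ℚ_[p]) → ℚ_[p] := fun σ =>
    (p : ℚ_[p]) ^ c' * σ (Sum.inr 0) ^ r.factorial
  have hη : ∀ σ, L.At r c κ scale l σ → PDvd r (η σ - 1) := fun σ h => h.1.1.2.2
  have hval : ∀ σ, L.At r c κ scale l σ →
      (l : ℤ) = c' + r.factorial * (σ (Sum.inr 0)).valuation := by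
    intro σ h
    have h1 := (norm_eq_zpow_iff.1 h.2.2).2
    rw [← h1]
    exact (valuation_prime_zpow_mul_pow (L.ne_zero _ h.1 _) _ _).2
  have hscale : ∀ σ, L.At r c κ scale l σ → scale σ = (p : ℚ_[p]) ^ l * η σ ^ r.factorial := by
    intro σ h
    simp only [scale, η]
    rw [← zpow_natCast (p : ℚ_[p]) l, hval σ h, div_pow, zpow_add₀ hp0, mul_comm (r.factorial : ℤ),
      zpow_mul, zpow_natCast]
    have := zpow_ne_zero (σ (Sum.inr 0)).valuation hp0
    field_simp
  have hε : ∀ σ, L.At r c κ scale l σ →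
      PDvd ((r + padicValNat p r.factorial : ℕ) : ℤ) (η σ ^ r.factorial - 1) := fun σ h =>
    pdvd_pow_sub_one_add_padicValNat hK hν (hη σ h)
  have hscale_iff : ∀ σ σ', L.At r c κ scale l σ → L.At r c κ scale l σ' → ∀ k : ℕ,
      PDvd ((l + k : ℕ) : ℤ) (scale σ - scale σ') ↔
        PDvd k (η σ ^ r.factorial - η σ' ^ r.factorial) := by
    intro σ σ' h h' k
    rw [hscale σ h, hscale σ' h', ← mul_sub, Nat.cast_add]
    exact PDvd.mul_iff (norm_prime_pow p l)
  have hfits : L.Fits r c κ (Fin.snoc c c' : Fin (m + 1) → ℤ)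
      (Fin.snoc κ (l : ℤ) : Fin (m + 1) → ℤ) scale l
      (fun f => side f (Fin.snoc κ (l : ℤ) : Fin (m + 1) → ℤ))
      (fun f s σ => L.digit f s σ + (η σ ^ r.factorial - 1) / (p : ℚ_[p]) ^ F.depth f) := by
    refine ⟨hdepth, hpres _ hl, ?_, ?_, ?_, ?_, ?_, ?_, ?_⟩
    · intro σ h
      rw [mem_fiber_snoc]
      change (fun i => σ (boneIndex m d (Sum.inl (Fin.castSucc i)))) ∈ _ ∧
        σ (boneIndex m d (Sum.inl (Fin.last m))) ≠ 0 ∧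
          _ = _ + _ * (σ (boneIndex m d (Sum.inl (Fin.last m)))).valuation
      simp only [hψ, hψ']
      exact ⟨h.2.1, L.ne_zero _ h.1 _, hval σ h⟩
    · exact fun σ h f s => PDvd.natCast _
    · refine fun σ h f s => (PDvd.natCast _).add (pdvd_div_prime_pow.2 ((hε σ h).mono ?_))
      have := hdepth f
      omega
    · intro σ σ' h h' i hi _
      rw [hscale_iff σ σ' h h']
      -- All η^(r!) are congruent to 1 modulo p^(r + v(r!)), so the scales agree up to depth l + r
      -- without further assumption.
      exact ((hε σ h).trans (hε σ' h').sub_comm).mono (by omega)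
    · intro σ σ' h h' f s s' k _
      rw [hscale_iff σ σ' h h', Nat.cast_add]
      exact (pdvd_digit_sub_iff s.2 s'.2 (hε σ h) (hε σ' h')).symm
    · intro σ σ' h h' f s s' k hn hz
      have h1 := ((pdvd_digit_sub_iff s.2 s'.2 (hε σ h) (hε σ' h')).1 hz).1
      -- Recovering η from η^(r!) costs v(r!) digits, and v(r!) < r.
      have h2 : PDvd ((k : ℤ) - r) (η σ - η σ') := by
        have h3 := norm_pow_sub_pow hK hν (hη σ h) (hη σ' h')
        rw [PDvd, h3] at h1
        have h4 := mul_le_mul_of_nonneg_left h1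
          (zpow_pos (cast_prime_pos p) (padicValNat p r.factorial : ℤ)).le
        rw [← mul_assoc, ← zpow_add₀ (cast_prime_pos p).ne', ← zpow_add₀ (cast_prime_pos p).ne',
          add_neg_cancel, zpow_zero, one_mul] at h4
        exact h4.trans (zpow_le_zpow_right₀ (one_lt_cast_prime p).le (by omega))
      have hvv : (σ (Sum.inr 0)).valuation = (σ' (Sum.inr 0)).valuation := by
        have h3 := hval σ h
        rw [hval σ' h'] at h3
        have h4 : (r.factorial : ℤ) ≠ 0 := by exact_mod_cast hK
        exact (mul_left_cancel₀ h4 (add_left_cancel h3)).symm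
      have hn0 := L.ne_zero _ h.1 (Sum.inr 0)
      have hn0' := L.ne_zero _ h'.1 (Sum.inr 0)
      have hnear : RelClose ((p : ℝ) ^ ((r : ℤ) - k)) (σ (Sum.inr 0)) (σ' (Sum.inr 0)) := by
        refine ⟨?_, hn0', ?_⟩
        · rw [Padic.norm_eq_zpow_neg_valuation hn0, Padic.norm_eq_zpow_neg_valuation hn0', hvv]
        · have h3 : σ (Sum.inr 0) - σ' (Sum.inr 0) =
              (η σ - η σ') * (p : ℚ_[p]) ^ (σ' (Sum.inr 0)).valuation := by
            simp only [η, hvv]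
            have := zpow_ne_zero (σ' (Sum.inr 0)).valuation hp0
            field_simp
          rw [h3, norm_mul, norm_zpow, Padic.norm_p, inv_zpow',
            Padic.norm_eq_zpow_neg_valuation hn0']
          refine mul_le_mul_of_nonneg_right (h2.trans_eq ?_) (zpow_pos (cast_prime_pos p) _).le
          congr 1
          ring
      refine Fin.forall_fin_succ'.2 ⟨fun i => ?_, ?_⟩
      · change RelClose _ (σ (boneIndex m d (Sum.inl i.castSucc)))
          (σ' (boneIndex m d (Sum.inl i.castSucc)))
        rw [hψ σ i, hψ σ' i]
        exact hn.mono (by omega) i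
      · change RelClose _ (σ (boneIndex m d (Sum.inl (Fin.last m))))
          (σ' (boneIndex m d (Sum.inl (Fin.last m))))
        rw [hψ' σ, hψ' σ']
        exact hnear
    · intro f w hw k z
      -- Digit and unit are chosen from z, and the exponent q from l; this determines y and thereby
      -- the parameter point of the side tree.
      obtain ⟨s, hs, ε, hε1, hεz⟩ := exists_digit_approx hK hν
        (j := F.depth f) ((hdepth f).trans (Nat.le_add_right _ _)) k z
      obtain ⟨hy, hyv, hyη⟩ := prime_zpow_mul_mem_leadingOne hr0 hε1 q
      set y := (p : ℚ_[p]) ^ q * ε with hydef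
      refine ⟨(Fin.snoc w y : Fin (m + 1) → ℚ_[p]), ?_, fun σ' hσ' hw' => ?_⟩
      · rw [mem_fiber_snoc]
        simp only [Fin.snoc_castSucc, Fin.snoc_last]
        exact ⟨hw, hy.1, by rw [hyv, hq]⟩
      have hσ0 : ∀ i, (Sum.elim w (Fin.cons y fun j => σ' (Sum.inr j)) :
          Fin m ⊕ Fin (d + 1) → ℚ_[p]) i ≠ 0 := by
        rintro (i | j)
        · exact (hw i).1
        · refine Fin.cases ?_ (fun j => ?_) j
          · exact hy.1
          · exact hσ' _
      refine ⟨Sum.elim w (Fin.cons y fun j => σ' (Sum.inr j)), ⟨s, hs⟩,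
        ⟨⟨⟨Set.mem_iInter.2 hσ0, hy⟩, ?_⟩, hw, ?_⟩, ?_, rfl, ?_⟩
      · refine ⟨fun i => (valuation_prime_zpow_mul_pow (hσ0 _) _ _).1, ?_⟩
        rw [hdomN κ _ hσ0 hw]
        change (Fin.snoc κ (c' + r.factorial * y.valuation) : Fin (m + 1) → ℤ) ∈ N
        rw [hyv, ← hq]
        exact hl
      · rw [norm_eq_zpow_iff, hq, ← hyv]
        exact valuation_prime_zpow_mul_pow hy.1 _ _
      · funext i
        rcases i with i | j
        · refine Eq.trans ?_ (congrFun hw' i).symm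
          refine Fin.lastCases ?_ (fun i => ?_) i
          · rw [Fin.snoc_last]
            exact hψ' _
          · rw [Fin.snoc_castSucc]
            exact hψ _ i
        · rfl
      · change PDvd k (((s : ℕ) : ℚ_[p]) + ((y / (p : ℚ_[p]) ^ y.valuation) ^ r.factorial - 1) /
          (p : ℚ_[p]) ^ F.depth f - (z : ℚ_[p]))
        rw [hyη]
        exact hεz
  obtain ⟨e⟩ := hiso _ hl
  exact ⟨fun a ha => hfits.integral a ha,
    (hfits.isPresented ((hB _ hl).of_iso e)).of_iso e.symm⟩

end

/-! ### The induction on the level -/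

section

open RTree Filter

variable {p : ℕ} [hp : Fact p.Prime] {m d : ℕ}

theorem Family.Presents.of_iso {ι : Type} {𝓕 : Family p m d ι} {r : ℕ} {c κ : Fin m → ℤ}
    {T T' : RTree} (e : Iso T T') (h : 𝓕.Presents r c κ T) : 𝓕.Presents r c κ T' :=
  ⟨h.1, h.2.of_iso e⟩

/-- Attaching the one-point tree to all nodes does not change a tree. -/
theorem RTree.nonempty_iso_attach_point (T : RTree) :
    Nonempty (Iso (T.attach fun _ => point) T) := by
  have hsurj : Function.Surjective (attachInl (T := T) fun _ => point) :=
    attach_cases (fun v => ⟨v, rfl⟩) fun v b hb => absurd hb (lt_irrefl 0)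
  refine ⟨RelIso.symm ⟨Equiv.ofBijective _ ⟨attachInl_injective, hsurj⟩, fun {v w} =>
    ⟨fun h => ?_, child_attachInl⟩⟩⟩
  cases h with
  | base h => exact h

theorem Skeleton.exists_scales {M : Set (Fin m → ℤ)} (S : Skeleton M) :
    ∀ᶠ r : ℕ in atTop, ∀ c : Fin m → ℤ, ∃ τ : S.shape.Node → (Fin m → ℚ_[p]) → ℚ_[p],
      (∀ v, IsTame (τ v)) ∧
      (∀ v, ¬ S.Virtual v → ∀ κ ∈ M, ∀ w ∈ fiber p r c κ,
        ‖τ v w‖ = (p : ℝ) ^ (-(S.pathLength v κ : ℤ))) ∧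
      ∀ v, ¬ S.Virtual v → ∀ κ ∈ M, ∀ w ∈ fiber p r c κ, ∀ w' ∈ fiber p r c κ, ∀ k,
        Near p r k w w' → PDvd k (τ v w - τ v w') := by
  have := S.finite
  have h : ∀ᶠ r : ℕ in atTop, ∀ v, ∀ c : Fin m → ℤ, ∃ τ : (Fin m → ℚ_[p]) → ℚ_[p], IsTame τ ∧
      (¬ S.Virtual v → ∀ κ ∈ M, ∀ w ∈ fiber p r c κ,
        ‖τ w‖ = (p : ℝ) ^ (-(S.pathLength v κ : ℤ))) ∧
      (¬ S.Virtual v → ∀ κ ∈ M, ∀ w ∈ fiber p r c κ, ∀ w' ∈ fiber p r c κ, ∀ k,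
        Near p r k w w' → PDvd k (τ w - τ w')) := by
    rw [eventually_all]
    intro v
    by_cases hv : S.Virtual v
    · exact Eventually.of_forall fun r c => ⟨_, IsTame.const 0, fun h => absurd hv h,
        fun h => absurd hv h⟩
    · filter_upwards [S.exists_scale (p := p) hv] with r hr c
      obtain ⟨τ, h1, h2, h3⟩ := hr c
      exact ⟨τ, h1, fun _ => h2, fun _ => h3⟩
  filter_upwards [h] with r hr c
  choose τ h1 h2 h3 using fun v => hr v c
  exact ⟨τ, h1, h2, h3⟩

theorem Assembly.exists_family {r : ℕ} {M : Set (Fin m → ℤ)} {S : Skeleton M} {c : Fin m → ℤ}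
    (A : Assembly p d r S c) (B : ∀ κ, (S.tree κ).Node → RTree) {T : PTree m}
    (hF : ∀ κ ∈ M, A.Fits κ (B κ)) (hl : ∀ κ ∈ M, (T κ).LeavesAtRoot)
    (hT : ∀ κ ∈ M, Nonempty (Iso (T κ) ((S.tree κ).attach (B κ)))) :
    ∃ 𝓕 : Family p m d ℕ, ∀ κ ∈ M, 𝓕.Presents r c κ (T κ) := by
  have := S.finite
  obtain ⟨e⟩ : Nonempty (ℕ ≃ S.shape.Node ⊕ Unit ⊕ ℕ) := nonempty_equiv_of_countable
  refine ⟨A.family.reindex e, fun κ hκ => ?_⟩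
  obtain ⟨f⟩ := hT κ hκ
  exact ((Assembly.presents hκ (hF κ hκ) ((hl κ hκ).of_iso f)).of_iso f.symm).reindex e

/-- Only virtual joints contribute points. A tree with real leaf joints is not excluded, but then
its leaf is the root and no path is needed. -/
theorem hasFamilies_zero {M : Set (Fin m → ℤ)} {T : PTree m} (h : IsLevel p 0 m M T)
    (hl : ∀ κ ∈ M, (T κ).LeavesAtRoot) : HasFamilies p 0 M T := by
  obtain ⟨-, S, hS⟩ := h
  filter_upwards [S.exists_scales (p := p)] with r hr c
  obtain ⟨τ, h1, h2, h3⟩ := hr c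
  let A : Assembly p 0 r S c :=
    -- Empty families are still needed, because `Fits` asks for an index at every node.
    { Ix := S.shape.Node
      finite := S.finite
      joint := id
      fam := fun _ => Family.empty
      scale := fun _ _ => 0
      isTame_scale := fun _ => IsTame.const 0
      τ := τ
      isTame_τ := h1
      norm_τ := h2
      τ_near := h3 }
  have he : ∀ {κ} i (a : (A.fam i).Pt r c κ), False := fun i a => a.piece.elim
  refine A.exists_family (fun κ _ => point) (fun κ hκ => ?_) hl fun κ hκ => ?_
  · refine ⟨fun i a => (he i a).elim, fun i a => (he i a).elim, fun x => ⟨x.1.1, rfl,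
      fun i a => (he i a).elim, ?_⟩⟩
    exact ⟨fun k a => (he _ a.1).elim, fun k a => (he _ a.1).elim, fun k a => (he _ a.1).elim,
      fun k a => (he _ a.1).elim, fun y hy => absurd (fun z hz => hz) hy⟩
  · obtain ⟨e⟩ := hS κ hκ
    obtain ⟨f⟩ := (S.tree κ).nonempty_iso_attach_point
    exact ⟨e.trans f.symm⟩

/-- One family for each real joint, and one for each bone and each class of depths modulo r!, are
assembled along the skeleton. For r ≥ ρ the classes modulo r! refine those modulo ρ, on which the
side branches depend. -/
theorem hasFamilies_succ (IH : ∀ (m : ℕ) (M : Set (Fin m → ℤ)) (T : PTree m), IsLevel p d m M T →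
      (∀ κ ∈ M, (T κ).LeavesAtRoot) → HasFamilies p d M T)
    {M : Set (Fin m → ℤ)} {T : PTree m} (h : IsLevel p (d + 1) m M T)
    (hl : ∀ κ ∈ M, (T κ).LeavesAtRoot) : HasFamilies p (d + 1) M T := by
  classical
  obtain ⟨-, ρ, S, J, E, hρ, -, hJ, hE, hS⟩ := h
  have := S.finite
  have : NeZero ρ := ⟨hρ.ne'⟩
  have hfill : ∀ κ ∈ M, (S.fill J E κ).LeavesAtRoot := fun κ hκ => by
    obtain ⟨e⟩ := hS κ hκ
    exact (hl κ hκ).of_iso e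
  have hjoint := eventually_all.2 fun v : {v // ¬ S.Virtual v} =>
    (hJ v.1 v.2).exists_joint_family (IH m M) fun κ hκ => by
      have h1 : S.jointDepth v.1 κ = (S.pathLength v.1 κ : ℕ∞) := by
        rw [Skeleton.jointDepth, if_neg v.2]
      have := LeavesAtRoot.of_attach (hfill κ hκ) ⟨(v.1, S.pathLength v.1 κ), S.isNode_joint h1⟩
      rwa [if_pos h1] at this
  have hbone := eventually_all.2 fun x : {v // 0 < S.shape.depth v} × ZMod ρ =>
    (hE _ x.1.1 (child_parent x.1.2) x.2).exists_bone_family (IH (m + 1) _)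
      (fun T => IsLevel.isDefinableGamma) (by
        rintro _ ⟨κ, hκ, l, rfl, hlc, h1, h2⟩
        have := LeavesAtRoot.of_attach (hfill κ hκ)
          ⟨(x.1.1, l), Or.inr ⟨_, child_parent x.1.2, h1, h2.le⟩⟩
        rwa [if_neg h2.ne', hlc] at this)
  filter_upwards [S.exists_scales (p := p), hjoint, hbone, eventually_ge_atTop ρ] with r hτ hjoint
    hbone hr c
  obtain ⟨τ, h1, h2, h3⟩ := hτ c
  have hN := r.factorial_pos
  have : NeZero r.factorial := ⟨hN.ne'⟩
  choose jf hjf using fun v : {v // ¬ S.Virtual v} => hjoint v c (τ v.1) (S.pathLength v.1)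
    (h2 v.1 v.2) (h3 v.1 v.2)
  -- The depths congruent to x.2 modulo r! are those of the form c' + r! q with c' = x.2.
  choose bf hbf hbf' using fun (x : {v // 0 < S.shape.depth v} × Fin r.factorial) =>
    hbone ⟨x.1, ((x.2 : ℕ) : ZMod ρ)⟩ c ((x.2 : ℕ) : ℤ)
  let A : Assembly p (d + 1) r S c :=
    { Ix := {v // ¬ S.Virtual v} ⊕ {v // 0 < S.shape.depth v} × Fin r.factorial
      finite := inferInstance
      joint := Sum.elim (fun v => v.1) fun x => x.1.1
      fam := Sum.elim jf bf
      scale := Sum.elim (fun v σ => τ v.1 fun i => σ (Sum.inl i)) fun x σ =>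
        (p : ℚ_[p]) ^ ((x.2 : ℕ) : ℤ) * σ (Sum.inr 0) ^ r.factorial
      isTame_scale := by
        rintro (v | x)
        · exact (h1 v.1).reindex Sum.inl
        · exact (IsTame.const _).mul ((IsTame.proj _).pow _)
      τ := τ
      isTame_τ := h1
      norm_τ := h2
      τ_near := h3 }
  have hbone' : ∀ κ (x : {v // 0 < S.shape.depth v} × Fin r.factorial) (a : (bf x).Pt r c κ),
      ∃ (l : ℕ) (q : ℤ), (l : ℤ) = ((x.2 : ℕ) : ℤ) + r.factorial * q ∧
        (Fin.snoc κ (l : ℤ) : Fin (m + 1) → ℤ) ∈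
          S.boneSet (S.shape.parent x.1.1) x.1.1 ((x.2 : ℕ) : ZMod ρ) ∧
        ‖(p : ℚ_[p]) ^ ((x.2 : ℕ) : ℤ) * a.coord (Sum.inr 0) ^ r.factorial‖ =
          (p : ℝ) ^ (-(l : ℤ)) ∧
        S.jointDepth (S.shape.parent x.1.1) κ < (l : ℕ∞) ∧ (l : ℕ∞) < S.jointDepth x.1.1 κ := by
    intro κ x a
    obtain ⟨q, hq, hq'⟩ := hbf x κ a
    obtain ⟨κ', hκ', l, he, hc, hlt, hlt'⟩ := id hq
    have hl' : ((x.2 : ℕ) : ℤ) + r.factorial * q = l := by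
      have := congrFun he (Fin.last m)
      rwa [Fin.snoc_last, Fin.snoc_last] at this
    have hκκ : κ = κ' := funext fun i => by
      have := congrFun he i.castSucc
      rwa [Fin.snoc_castSucc, Fin.snoc_castSucc] at this
    subst hκκ
    rw [hl'] at hq hq'
    exact ⟨l, q, hl'.symm, hq, hq', hlt, hlt'⟩
  have hinj : ∀ {x : ℝ} {k l : ℕ}, x = (p : ℝ) ^ (-(k : ℤ)) → x = (p : ℝ) ^ (-(l : ℤ)) → k = l := by
    intro x k l hk hl
    have := zpow_right_injective₀ (cast_prime_pos p) (one_lt_cast_prime p).ne' (hk.symm.trans hl)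
    omega
  have hjd : ∀ v : {v // ¬ S.Virtual v}, ∀ κ, S.jointDepth v.1 κ = (S.pathLength v.1 κ : ℕ∞) :=
    fun v κ => by rw [Skeleton.jointDepth, if_neg v.2]
  refine A.exists_family (fun κ x => if S.jointDepth x.1.1 κ = (x.1.2 : ℕ∞) then J x.1.1 κ
    else E x.1.1 (x.1.2 : ZMod ρ) (Fin.snoc κ (x.1.2 : ℤ) : Fin (m + 1) → ℤ)) (fun κ hκ => ?_) hl
    fun κ hκ => ?_
  · refine ⟨?_, ?_, ?_⟩
    · rintro (v | x) a
      · exact ⟨_, h2 v.1 v.2 κ hκ _ a.base_mem, Skeleton.isNode_pathLength v.2⟩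
      · obtain ⟨l, q, -, -, hn, hlt, hlt'⟩ := hbone' κ x a
        exact ⟨l, hn, Or.inr ⟨_, child_parent x.1.2, hlt, hlt'.le⟩⟩
    · rintro (v | x) a
      · exact (hjf v κ hκ).1 a
      · obtain ⟨l, q, hl, hmem, hn, -⟩ := hbone' κ x a
        exact (hbf' x κ l hmem ⟨q, hl⟩).1 a hn
    · rintro ⟨⟨v, l⟩, hx⟩
      dsimp only
      by_cases hv : S.jointDepth v κ = (l : ℕ∞)
      · have hvv : ¬ S.Virtual v := fun h => by
          rw [Skeleton.jointDepth, if_pos h] at hv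
          exact absurd hv (ENat.top_ne_natCast l)
        obtain rfl : S.pathLength v κ = l := by
          rw [hjd ⟨v, hvv⟩ κ] at hv
          exact_mod_cast hv
        rw [if_pos hv]
        refine ⟨Sum.inl ⟨v, hvv⟩, rfl, ?_, (hjf ⟨v, hvv⟩ κ hκ).2⟩
        -- Points of bone families sit strictly inside their bones, never at the depth of the joint.
        rintro (v' | x) a hj hn
        · exact congrArg Sum.inl (Subtype.ext hj)
        · obtain ⟨l, q, -, -, hn', -, hlt'⟩ := hbone' κ x a
          have hll := hinj hn hn'
          have hj' : x.1.1 = v := hj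
          rw [hj', hv, hll] at hlt'
          exact absurd hlt' (lt_irrefl _)
      · rw [if_neg hv]
        have h0 : 0 < S.shape.depth v := by
          rw [Nat.pos_iff_ne_zero]
          intro h0
          rcases hx with ⟨-, hx⟩ | ⟨u, hu, -⟩
          · dsimp only at hx
            rw [hx, Skeleton.jointDepth, if_neg fun h => by
              have := S.virtual_pos v h
              omega, S.pathLength_root h0] at hv
            exact hv rfl
          · have := S.shape.depth_child hu
            dsimp only at this
            omega
        have hlt : S.jointDepth (S.shape.parent v) κ < (l : ℕ∞) ∧
            (l : ℕ∞) < S.jointDepth v κ := by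
          rcases hx with ⟨hx, -⟩ | ⟨u, hu, hx, hx'⟩
          · dsimp only at hx
            omega
          · rw [parent_eq hu]
            exact ⟨hx, lt_of_le_of_ne hx' fun h => hv h.symm⟩
        let s : Fin r.factorial := ⟨l % r.factorial, Nat.mod_lt _ hN⟩
        have hls : (l : ℤ) = ((s : ℕ) : ℤ) + r.factorial * (l / r.factorial : ℕ) := by
          exact_mod_cast (Nat.mod_add_div l r.factorial).symm
        have hcl : (l : ZMod ρ) = ((s : ℕ) : ZMod ρ) := by
          rw [ZMod.natCast_eq_natCast_iff]
          exact ((Nat.mod_modEq l r.factorial).of_dvd (Nat.dvd_factorial hρ hr)).symm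
        have hmem : (Fin.snoc κ (l : ℤ) : Fin (m + 1) → ℤ) ∈
            S.boneSet (S.shape.parent v) v ((s : ℕ) : ZMod ρ) :=
          ⟨κ, hκ, l, rfl, hcl, hlt.1, hlt.2⟩
        rw [hcl]
        refine ⟨Sum.inr ⟨⟨v, h0⟩, s⟩, rfl, ?_, (hbf' ⟨⟨v, h0⟩, s⟩ κ l hmem ⟨_, hls⟩).2⟩
        -- The valuation l of the scale determines the index: a point of a joint family would make
        -- this node the copy of a joint, and for a bone family the class modulo r! must be that of
        -- l.
        rintro (v' | ⟨v', s'⟩) a hj hn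
        · have h4 := hinj hn (h2 v'.1 v'.2 κ hκ _ a.base_mem)
          have h5 := hjd v' κ
          have hj' : v'.1 = v := hj
          rw [← h4, hj'] at h5
          exact absurd h5 hv
        · obtain ⟨l', q, hl', -, hn', -⟩ := hbone' κ ⟨v', s'⟩ a
          have hll := hinj hn hn'
          subst hll
          have hss : s' = s := by
            refine Fin.ext ?_
            have h6 : ((s' : ℕ) : ℤ) = (l : ℤ) % r.factorial := by
              rw [hl', Int.add_mul_emod_self_left, Int.emod_eq_of_lt (by omega)]
              exact_mod_cast s'.2
            exact_mod_cast h6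
          subst hss
          have hvv : v' = ⟨v, h0⟩ := Subtype.ext hj
          subst hvv
          rfl
  · exact hS κ hκ

/-- The number m of parameters varies in the induction, because the side branches at a bone have the
depth of the node as an additional parameter. -/
theorem hasFamilies (p : ℕ) [Fact p.Prime] (d m : ℕ) (M : Set (Fin m → ℤ)) (T : PTree m)
    (h : IsLevel p d m M T) (hl : ∀ κ ∈ M, (T κ).LeavesAtRoot) : HasFamilies p d M T := by
  induction d generalizing m with
  | zero => exact hasFamilies_zero h hl
  | succ d ih => exact hasFamilies_succ ih h hl

end

/-! ### From families without parameters to definable sets -/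

section

open RTree Filter

variable {p : ℕ} [hp : Fact p.Prime]

/-- The node of depth `k` of `T(X)` below a point of `X ∩ ℤ_p ^ n`. -/
noncomputable def residueNode {n : ℕ} {X : Set (Fin n → ℚ_[p])} (k : ℕ) (x : Fin n → ℤ_[p])
    (hx : (fun i => (x i : ℚ_[p])) ∈ X) : (treeOf p X).Node :=
  ⟨k, fun i => PadicInt.toZModPow k (x i), x, hx, fun _ => rfl⟩

section

variable {n : ℕ} {X : Set (Fin n → ℚ_[p])}

theorem child_residueNode (k : ℕ) (x : Fin n → ℤ_[p]) (hx : (fun i => (x i : ℚ_[p])) ∈ X) :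
    (treeOf p X).Child (residueNode k x hx) (residueNode (k + 1) x hx) := by
  refine .mk _ _ fun i => ?_
  simp only
  rw [← RingHom.comp_apply, PadicInt.zmod_cast_comp_toZModPow k (k + 1) (Nat.le_succ k)]

theorem exists_residueNode (v : (treeOf p X).Node) :
    ∃ x hx, v = residueNode ((treeOf p X).depth v) x hx := by
  obtain ⟨k, a, x, hx, ha⟩ := v
  refine ⟨x, hx, ?_⟩
  obtain rfl : (fun i => PadicInt.toZModPow k (x i)) = a := funext ha
  rfl

/-- A node is the residue of a point of X, and this point has residues at all depths. -/
theorem not_isLeaf_treeOf (v : (treeOf p X).Node) : ¬ (treeOf p X).IsLeaf v := by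
  obtain ⟨x, hx, hv⟩ := exists_residueNode v
  rw [hv]
  exact fun h => h _ (child_residueNode _ x hx)

theorem residueNode_eq_iff (k : ℕ) (x y : Fin n → ℤ_[p]) (hx : (fun i => (x i : ℚ_[p])) ∈ X)
    (hy : (fun i => (y i : ℚ_[p])) ∈ X) : residueNode k x hx = residueNode k y hy ↔
      ∀ i, PDvd k ((x i : ℚ_[p]) - (y i : ℚ_[p])) := by
  have h1 : residueNode k x hx = residueNode k y hy ↔
      ∀ i, PadicInt.toZModPow k (x i) = PadicInt.toZModPow k (y i) := by
    constructor
    · intro h i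
      have h1 := eq_of_heq (Sigma.mk.inj h).2
      exact congrFun (congrArg Subtype.val h1) i
    · intro h
      exact Sigma.ext rfl (heq_of_eq (Subtype.ext (funext h)))
  rw [h1]
  exact forall_congr' fun i => toZModPow_eq_iff k (x i) (y i)

end

namespace Family

variable {d : ℕ} (𝓕 : Family p 0 d ℕ)

/-- The number of coordinates of a family that are not identically zero. -/
noncomputable def size : ℕ := 𝓕.support_finite.toFinset.card

/-- An enumeration of the coordinates of a family that are not identically zero. -/
noncomputable def index (i : Fin 𝓕.size) : ℕ := (𝓕.support_finite.toFinset.equivFin.symm i).1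

/-- The union of the images of the pieces of a family without parameters. -/
def image : Set (Fin 𝓕.size → ℚ_[p]) :=
  {x | ∃ P, ∃ σ ∈ 𝓕.dom P, ∀ i, x i = 𝓕.val P (𝓕.index i) σ}

/-- The coordinates omitted from the image vanish identically, so congruences lose nothing. -/
theorem forall_index {Q : ℕ → Prop} (h : ∀ i, (∀ P, 𝓕.val P i = fun _ => 0) → Q i) :
    (∀ i, Q i) ↔ ∀ i, Q (𝓕.index i) := by
  refine ⟨fun h _ => h _, fun h' i => ?_⟩
  by_cases hi : i ∈ 𝓕.support_finite.toFinset
  · have h1 : 𝓕.index (𝓕.support_finite.toFinset.equivFin ⟨i, hi⟩) = i :=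
      congrArg Subtype.val (Equiv.symm_apply_apply _ _)
    exact h1 ▸ h' _
  · refine h i fun P => ?_
    by_contra hP
    exact hi (𝓕.support_finite.mem_toFinset.2 ⟨P, hP⟩)

theorem isDefinable_image : IsDefinable p 𝓕.image := by
  have := 𝓕.finite
  have h : ∀ P, IsDef {y : Fin 𝓕.size ⊕ (Fin 0 ⊕ Fin d) → ℚ_[p] | y ∘ Sum.inr ∈ 𝓕.dom P ∧
      ∀ i, y (Sum.inl i) = 𝓕.val P (𝓕.index i) (y ∘ Sum.inr)} := by
    intro P
    refine ((𝓕.isDef_dom P).preimage_comp Sum.inr).inter ?_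
    have : {y : Fin 𝓕.size ⊕ (Fin 0 ⊕ Fin d) → ℚ_[p] | ∀ i, y (Sum.inl i) =
        𝓕.val P (𝓕.index i) (y ∘ Sum.inr)} = ⋂ i, {y | y (Sum.inl i) =
          𝓕.val P (𝓕.index i) (y ∘ Sum.inr)} := by
      ext y
      simp
    change IsDef {y : Fin 𝓕.size ⊕ (Fin 0 ⊕ Fin d) → ℚ_[p] | ∀ i, y (Sum.inl i) =
        𝓕.val P (𝓕.index i) (y ∘ Sum.inr)}
    rw [this]
    exact IsDef.iInter fun i => (IsDefFun.proj (Sum.inl i)).setOf_eq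
      ((𝓕.isTame_val P _).1.reindex Sum.inr)
  have h' : IsDef 𝓕.image := by
    convert IsDef.iUnion fun P => (h P).exists_of_finite using 1
    ext x
    simp only [image, Set.mem_ofPred_eq, Set.mem_iUnion]
    refine exists_congr fun P => ⟨?_, ?_⟩
    · rintro ⟨σ, hσ, hx⟩
      exact ⟨σ, hσ, hx⟩
    · rintro ⟨σ, hσ, hx⟩
      exact ⟨σ, hσ, hx⟩
  exact h'

theorem dim_image_le : dim p 𝓕.image ≤ d := by
  have := 𝓕.finite
  let ψ : Fin 0 ⊕ Fin d → Fin d := Sum.elim Fin.elim0 id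
  choose G hG hGm hGv using fun P i => ((𝓕.isTame_val P (𝓕.index i)).reindex ψ).2
  refine dim_le_of_monomial (G := ⋃ P, {g | ∀ i, g i ∈ G P i})
    (Set.finite_iUnion fun P => Set.Finite.pi' (hG P)) ?_ ?_
  · intro g hg i
    obtain ⟨P, hP⟩ := Set.mem_iUnion.1 hg
    exact hGm P i _ (hP i)
  · rintro x ⟨P, σ, hσ, hx⟩
    have hσ0 : ∀ j, σ (Sum.inr j) ≠ 0 := fun j => 𝓕.ne_zero hσ _
    choose g hg hg' using fun i => hGv P i (fun j => σ (Sum.inr j)) hσ0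
    refine ⟨g, Set.mem_iUnion.2 ⟨P, hg⟩, fun j => σ (Sum.inr j), hσ0, fun i => ?_⟩
    rw [hx, ← hg']
    congr 1
    funext j
    rcases j with j | j
    · exact j.elim0
    · rfl

/-- Without parameters the fiber is a single point and `Near` is vacuous. The residues of the points
of X then form a presentation of T(X) by the same relation that presents T. -/
theorem Presents.nonempty_iso {𝓕 : Family p 0 d ℕ} {r : ℕ} {c κ : Fin 0 → ℤ} {T : RTree}
    (h : 𝓕.Presents r c κ T) (hT : ∀ v, ¬ T.IsLeaf v) :
    Nonempty (RTree.Iso (treeOf p 𝓕.image) T) := by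
  let x : 𝓕.Pt r c κ → Fin 𝓕.size → ℤ_[p] := fun a i =>
    ⟨a.value (𝓕.index i), PDvd.zero_iff.1 (h.1 a _)⟩
  have hx : ∀ a, (fun i => (x a i : ℚ_[p])) ∈ 𝓕.image := fun a =>
    ⟨a.piece, a.coord, a.mem, fun i => rfl⟩
  refine RTree.IsPresented.nonempty_iso (w := fun a : 𝓕.Pt r c κ => a.base)
    (W := fiber p r c κ) (C := fun k a b => Near p r k a.base b.base)
    (R := fun k a b => ∀ i, PDvd k (a.value i - b.value i))
    ⟨fun k a => residueNode k (x a) (hx a), fun k a => rfl, fun k a => child_residueNode _ _ _,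
      fun k a b _ => ?_, fun v _ b _ => ?_⟩ h.2 ⟨Fin.elim0, fun i => i.elim0⟩
    (fun k a b i => i.elim0) not_isLeaf_treeOf hT
  · rw [residueNode_eq_iff]
    refine (𝓕.forall_index (Q := fun i => PDvd k (a.value i - b.value i)) fun i hi => ?_).symm
    have h0 : ∀ a : 𝓕.Pt r c κ, a.value i = 0 := fun a => congrFun (hi a.piece) a.coord
    rw [h0, h0, sub_zero]
    exact PDvd.zero _
  · obtain ⟨y, hy, hv⟩ := exists_residueNode v
    obtain ⟨P, σ, hσ, hyσ⟩ := id hy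
    refine ⟨⟨P, σ, hσ, fun i => i.elim0⟩, funext fun i => i.elim0, ?_⟩
    have : x ⟨P, σ, hσ, fun i => i.elim0⟩ = y := funext fun i => Subtype.ext (hyσ i).symm
    conv_rhs => rw [hv]
    simp only [this]

end Family

end

end PadicTrees

theorem mainTheorem3 (p : ℕ) [Fact p.Prime] (d : ℕ) (T : PadicTrees.RTree)
    (hT : PadicTrees.IsLevelTree p d T) (hleaf : ∀ v, ¬ T.IsLeaf v) :
    ∃ (n : ℕ) (X : Set (Fin n → ℚ_[p])),
      PadicTrees.IsDefinable p X ∧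
      PadicTrees.dim p X ≤ (d : WithBot ℕ∞) ∧
      Nonempty (PadicTrees.RTree.Iso (PadicTrees.treeOf p X) T) := by
  obtain ⟨r, hr⟩ := (PadicTrees.hasFamilies p d 0 Set.univ (fun _ => T) hT
    fun _ _ v hv => absurd hv (hleaf v)).exists
  obtain ⟨𝓕, h𝓕⟩ := hr 0
  exact ⟨𝓕.size, 𝓕.image, 𝓕.isDefinable_image, 𝓕.dim_image_le,
    (h𝓕 0 (Set.mem_univ _)).nonempty_iso hleaf⟩
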